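/- Let $\lambda\ge 14$ be a real number, $r\ge 1$ an integer, $I=[0,4]$, $\delta=\lambda^{-r}$. For $n\ge1$ put $$x_n=1+\tfrac1n,\quad y_n=x_n+\tfrac1{2n^2},\quad M_n=2\left\lfloor\tfrac{\lambda^n}{2n^2}\right\rfloor-1,\quad m_n=1-\tfrac1{(n+1)^2},\quad k_n=\tfrac{2\lambda^r}{M_n},\quad C=\tfrac1{4\delta^2},$$ $$w_n=y_{n+1}+\tfrac{n+2}{2n(n+1)^2M_{n+1}k_{n+1}},\quad h_n=\lambda^{-nr}x_n-\lambda^{-(n+1)r}x_n,\quad l_n=x_n-w_n .$$ *Oscillating functions.* Choose $C^\infty$ functions $s_n:[0,M_n]\to[-m_n,1]$ ($n\ge1$) such that $s_n(0)=0$, $s_n(M_n)=1$; $s_n$ is strictly increasing on $[j,j+1]$ for each even integer $0\le j<M_n$ and strictly decreasing on $[j,j+1]$ for each odd integer $0\le j<M_n$; $s_n(t)=1-C(t-j)^2$ for $|t-j|\le\delta$ if $0<j<M_n$ is odd, and $s_n(t)=-m_n+C(t-j)^2$ for $|t-j|\le\delta$ if $0<j<M_n$ is even; $s_n(t)=k_n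 t$ on $[0,\delta]$ and $s_n(t)=k_n(t-M_n)+1$ on $[M_n-\delta,M_n]$; for each $k\ge1$, $\sup_n\|s_n^{(k)}\|_\infty<\infty$; $\|s_n'\|_\infty\le\lambda^r$; and $|s_n'(t)|\ge\min\{\frac12,k_n\}$ whenever $|t-j|\ge\delta$ for all integers $0<j<M_n$. *Connecting functions.* Choose $C^\infty$ functions $\varphi_n:[0,1]\to[0,1]$ ($n\ge1$) with $\varphi_n(0)=0$, $\varphi_n(1)=1$, $\varphi_n'(0)=2h_n^{-1}l_n\lambda^{-nr}$, $\varphi_n'(1)=2h_n^{-1}l_n\lambda^{-(n-1)r}$, $\varphi_n^{(k)}(0)=\varphi_n^{(k)}(1)=0$ for $k\ge2$, $\sup_n\|\varphi_n^{(k)}\|_\infty<\infty$ for each $k\ge1$, and $\frac23\varphi_n'(0)\le\varphi_n'\le\lambda^r$ on $[0,1]$. *The map.* Let $f_r$ be a map on $I$ such that - $f_r(t)=\lambda^r t$ on $[0,\frac52\delta]$; $f_r(t)=4-\frac32\delta^{-1}(t-\frac12)^2$ for $|t-\frac12|\le\delta$; $f_r(t)=\delta^{1-2r}(t-1)^{2r}$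 on $[1-\delta,1]$; $f_r(t)=4+\lambda^r(t-4)$ on $[4-\frac32\delta,4]$; - for $n\ge1$: $f_r(t)=\lambda^{-nr}\left[x_n+(y_n-x_n)\,s_n\!\left(M_n\frac{t-x_n}{y_n-x_n}\right)\right]$ on $[x_n,y_n]$; $f_r(t)=\lambda^{-(n+1)r}\left[y_{n+1}+M_{n+1}k_{n+1}(t-y_{n+1})\right]$ on $[y_{n+1},w_n]$; $f_r(t)=\lambda^{-(n+1)r}x_n+h_n\,\varphi_n\!\left(\frac{t-w_n}{l_n}\right)$ on $[w_n,x_n]$; - on each of $[\frac52\delta,\frac12-\delta]$, $[\frac12+\delta,1-\delta]$, $[y_1,4-\frac32\delta]$ the map $f_r$ is $C^\infty$ and at the two end points its one-sided derivatives of all orders (order $0$ included) agree with those of the formulas above on the adjacent intervals; moreover $\frac32\le f_r'\le\lambda^r$ on the first and the third of these intervals and $-\lambda^r\le f_r'\le-\frac32$ on the second. **Proposition.** For every real $\lambda\ge14$ and every integer $r\ge1$ such choices exist, that is, there is at least one such map $f_r$. Every such $f_r$ maps $[0,4]$ into $[0,4]$, is $C^r$ on $[0,4]$ and $C^\infty$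 on $[0,4]\setminus\{1\}$, satisfies $\|f_r'\|_\infty=\sup_{t\in[0,4]}|f_r'(t)|=\lambda^r$, and is topologically mixing: for all nonempty open subsets $U,V$ of $[0,4]$ there is $N\ge0$ with $f_r^{-n}(U)\cap V\ne\emptyset$ for every $n\ge N$. Moreover, for every nondegenerate subinterval $J\subset[0,4]$ there is $k\ge0$ with $f_r^k(J)=[0,4]$. -/

import Mathlib

open Set
open scoped ContDiff

namespace MixingInterval

/-- A self-map `T` of a topological space is topologically mixing if for all nonempty open `U`, `V`
there is `N` such that `T⁻ⁿ U` meets `V` for every `n ≥ N`. -/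
def IsTopMixing {X : Type*} [TopologicalSpace X] (T : X → X) : Prop :=
  ∀ U V : Set X, IsOpen U → IsOpen V → U.Nonempty → V.Nonempty →
    ∃ N : ℕ, ∀ n : ℕ, N ≤ n → ((T^[n]) ⁻¹' U ∩ V).Nonempty

noncomputable section

/-- `x_n = 1 + 1/n` (used for `n ≥ 1`). -/
def xPt (n : ℕ) : ℝ := 1 + 1 / (n : ℝ)

/-- `y_n = x_n + 1/(2n²)` (used for `n ≥ 1`); in particular `y_1 = 5/2`. -/
def yPt (n : ℕ) : ℝ := xPt n + 1 / (2 * (n : ℝ) ^ 2)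

/-- The odd integer `M_n = 2[λⁿ/(2n²)] - 1`. -/
def osc (lam : ℝ) (n : ℕ) : ℤ := 2 * ⌊lam ^ n / (2 * (n : ℝ) ^ 2)⌋ - 1

/-- `m_n = 1 - 1/(n+1)²`. -/
def mMin (n : ℕ) : ℝ := 1 - 1 / ((n : ℝ) + 1) ^ 2

/-- `δ = λ^{-r}`. -/
def delta (lam : ℝ) (r : ℕ) : ℝ := (lam ^ r)⁻¹

/-- `C = 1/(4δ²)`. -/
def curv (lam : ℝ) (r : ℕ) : ℝ := 1 / (4 * delta lam r ^ 2)

/-- `k_n = 2λ^r / M_n`. -/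
def slope (lam : ℝ) (r n : ℕ) : ℝ := 2 * lam ^ r / (osc lam n : ℝ)

/-- `w_n = y_{n+1} + (n+2) / (2n(n+1)² M_{n+1} k_{n+1})`. -/
def wPt (lam : ℝ) (r n : ℕ) : ℝ :=
  yPt (n + 1) + ((n : ℝ) + 2) /
    (2 * (n : ℝ) * ((n : ℝ) + 1) ^ 2 * (osc lam (n + 1) : ℝ) * slope lam r (n + 1))

/-- `h_n = λ^{-nr} x_n - λ^{-(n+1)r} x_n`, the height of the graph over `[w_n, x_n]`. -/
def height (lam : ℝ) (r n : ℕ) : ℝ := delta lam r ^ n * xPt n - delta lam r ^ (n + 1) * xPt n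

/-- `l_n = x_n - w_n`. -/
def len (lam : ℝ) (r n : ℕ) : ℝ := xPt n - wPt lam r n

/-- The conditions on the `C^∞` oscillating functions `s_n : [0, M_n] → [-m_n, 1]`, `n ≥ 1`.
By the strict monotonicity conditions the local extrema of `s_n` in `]0, M_n[` are the integers
`0 < j < M_n`: maxima at the odd ones, minima at the even ones. -/
structure IsOscFamily (lam : ℝ) (r : ℕ) (s : ℕ → ℝ → ℝ) : Prop where
  smooth : ∀ n, 1 ≤ n → ContDiffOn ℝ ∞ (s n) (Icc 0 (osc lam n : ℝ))
  mapsTo : ∀ n, 1 ≤ n → MapsTo (s n) (Icc 0 (osc lam n : ℝ)) (Icc (-mMin n) 1)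
  map_zero : ∀ n, 1 ≤ n → s n 0 = 0
  map_end : ∀ n, 1 ≤ n → s n (osc lam n : ℝ) = 1
  increasing : ∀ n, 1 ≤ n → ∀ j : ℤ, 0 ≤ j → j < osc lam n → Even j →
    StrictMonoOn (s n) (Icc (j : ℝ) (j + 1))
  decreasing : ∀ n, 1 ≤ n → ∀ j : ℤ, 0 ≤ j → j < osc lam n → Odd j →
    StrictAntiOn (s n) (Icc (j : ℝ) (j + 1))
  near_max : ∀ n, 1 ≤ n → ∀ j : ℤ, 0 < j → j < osc lam n → Odd j →
    ∀ t : ℝ, |t - j| ≤ delta lam r → s n t = 1 - curv lam r * (t - j) ^ 2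
  near_min : ∀ n, 1 ≤ n → ∀ j : ℤ, 0 < j → j < osc lam n → Even j →
    ∀ t : ℝ, |t - j| ≤ delta lam r → s n t = -mMin n + curv lam r * (t - j) ^ 2
  near_end : ∀ n, 1 ≤ n → ∀ t ∈ Icc ((osc lam n : ℝ) - delta lam r) (osc lam n : ℝ),
    s n t = slope lam r n * (t - (osc lam n : ℝ)) + 1
  near_zero : ∀ n, 1 ≤ n → ∀ t ∈ Icc 0 (delta lam r), s n t = slope lam r n * t
  deriv_bounded : ∀ k : ℕ, 1 ≤ k → ∃ A : ℝ, ∀ n, 1 ≤ n → ∀ t ∈ Icc 0 (osc lam n : ℝ),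
    |iteratedDerivWithin k (s n) (Icc 0 (osc lam n : ℝ)) t| ≤ A
  deriv_le : ∀ n, 1 ≤ n → ∀ t ∈ Icc 0 (osc lam n : ℝ),
    |derivWithin (s n) (Icc 0 (osc lam n : ℝ)) t| ≤ lam ^ r
  le_deriv : ∀ n, 1 ≤ n → ∀ t ∈ Icc 0 (osc lam n : ℝ),
    (∀ j : ℤ, 0 < j → j < osc lam n → delta lam r ≤ |t - j|) →
    min (1 / 2) (slope lam r n) ≤ |derivWithin (s n) (Icc 0 (osc lam n : ℝ)) t|

/-- The conditions on the `C^∞` connecting functions `φ_n : [0, 1] → [0, 1]`, `n ≥ 1`. -/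
structure IsConnFamily (lam : ℝ) (r : ℕ) (φ : ℕ → ℝ → ℝ) : Prop where
  smooth : ∀ n, 1 ≤ n → ContDiffOn ℝ ∞ (φ n) (Icc 0 1)
  mapsTo : ∀ n, 1 ≤ n → MapsTo (φ n) (Icc 0 1) (Icc 0 1)
  map_zero : ∀ n, 1 ≤ n → φ n 0 = 0
  map_one : ∀ n, 1 ≤ n → φ n 1 = 1
  deriv_zero : ∀ n, 1 ≤ n → derivWithin (φ n) (Icc 0 1) 0 =
    2 * (height lam r n)⁻¹ * len lam r n * delta lam r ^ n
  deriv_one : ∀ n, 1 ≤ n → derivWithin (φ n) (Icc 0 1) 1 =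
    2 * (height lam r n)⁻¹ * len lam r n * delta lam r ^ (n - 1)
  flat_zero : ∀ n, 1 ≤ n → ∀ k : ℕ, 2 ≤ k → iteratedDerivWithin k (φ n) (Icc 0 1) 0 = 0
  flat_one : ∀ n, 1 ≤ n → ∀ k : ℕ, 2 ≤ k → iteratedDerivWithin k (φ n) (Icc 0 1) 1 = 0
  deriv_bounded : ∀ k : ℕ, 1 ≤ k → ∃ B : ℝ, ∀ n, 1 ≤ n → ∀ t ∈ Icc (0 : ℝ) 1,
    |iteratedDerivWithin k (φ n) (Icc 0 1) t| ≤ B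
  le_deriv : ∀ n, 1 ≤ n → ∀ t ∈ Icc (0 : ℝ) 1,
    2 / 3 * derivWithin (φ n) (Icc 0 1) 0 ≤ derivWithin (φ n) (Icc 0 1) t
  deriv_le : ∀ n, 1 ≤ n → ∀ t ∈ Icc (0 : ℝ) 1, derivWithin (φ n) (Icc 0 1) t ≤ lam ^ r

/-- On `[a, b]` the function `g` is `C^∞`, and it is glued in a `C^∞` way to the function `p` at `a`
and to the function `q` at `b`: all its one-sided derivatives there (the order `0` included) are
those of `p`, respectively `q`. -/
structure IsSmoothJoin (p q : ℝ → ℝ) (a b : ℝ) (g : ℝ → ℝ) : Prop where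
  smooth : ContDiffOn ℝ ∞ g (Icc a b)
  left : ∀ k : ℕ, iteratedDerivWithin k g (Icc a b) a = iteratedDeriv k p a
  right : ∀ k : ℕ, iteratedDerivWithin k g (Icc a b) b = iteratedDeriv k q b

/-- The formula near the fixed point `0`. -/
def pieceZero (lam : ℝ) (r : ℕ) (t : ℝ) : ℝ := lam ^ r * t

/-- The formula near `1/2`: `4 - C₀ (t - 1/2)²` with `C₀ = (3/2) δ⁻¹`. -/
def pieceHalf (lam : ℝ) (r : ℕ) (t : ℝ) : ℝ := 4 - 3 / 2 * (delta lam r)⁻¹ * (t - 1 / 2) ^ 2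

/-- The formula on the left of `1`: `C₁ (t - 1)^{2r}` with `C₁ = δ^{1-2r}`. -/
def pieceOne (lam : ℝ) (r : ℕ) (t : ℝ) : ℝ := delta lam r ^ (1 - 2 * (r : ℤ)) * (t - 1) ^ (2 * r)

/-- The affine formula around `y_n`: value `λ^{-nr} y_n` at `y_n`, slope `λ^{-nr} M_n k_n`. -/
def pieceY (lam : ℝ) (r n : ℕ) (t : ℝ) : ℝ :=
  delta lam r ^ n * yPt n + delta lam r ^ n * (osc lam n : ℝ) * slope lam r n * (t - yPt n)

/-- The formula near the fixed point `4`. -/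
def pieceFour (lam : ℝ) (r : ℕ) (t : ℝ) : ℝ := 4 + lam ^ r * (t - 4)

/-- `f` is a map `f_r` built on `[0, 4]`, with the parameter `λ`, from the choices `s_n`, `φ_n` and
from `C^∞` completions on `[5δ/2, 1/2 - δ]`, `[1/2 + δ, 1 - δ]` and `[y_1, 4 - 3δ/2]`.
The intervals below cover `[0, 4]`; the values of `f` elsewhere are irrelevant. -/
structure IsConstructedMap (lam : ℝ) (r : ℕ) (s φ : ℕ → ℝ → ℝ) (f : ℝ → ℝ) : Prop where
  oscFamily : IsOscFamily lam r s
  connFamily : IsConnFamily lam r φ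
  eq_zero : ∀ t ∈ Icc 0 (5 / 2 * delta lam r), f t = pieceZero lam r t
  eq_half : ∀ t ∈ Icc (1 / 2 - delta lam r) (1 / 2 + delta lam r), f t = pieceHalf lam r t
  eq_one : ∀ t ∈ Icc (1 - delta lam r) 1, f t = pieceOne lam r t
  eq_osc : ∀ n, 1 ≤ n → ∀ t ∈ Icc (xPt n) (yPt n), f t = delta lam r ^ n *
    (xPt n + (yPt n - xPt n) * s n ((osc lam n : ℝ) * ((t - xPt n) / (yPt n - xPt n))))
  eq_affine : ∀ n, 1 ≤ n → ∀ t ∈ Icc (yPt (n + 1)) (wPt lam r n), f t = pieceY lam r (n + 1) t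
  eq_conn : ∀ n, 1 ≤ n → ∀ t ∈ Icc (wPt lam r n) (xPt n), f t =
    delta lam r ^ (n + 1) * xPt n + height lam r n * φ n ((t - wPt lam r n) / len lam r n)
  eq_four : ∀ t ∈ Icc (4 - 3 / 2 * delta lam r) 4, f t = pieceFour lam r t
  join_left : IsSmoothJoin (pieceZero lam r) (pieceHalf lam r)
    (5 / 2 * delta lam r) (1 / 2 - delta lam r) f
  join_mid : IsSmoothJoin (pieceHalf lam r) (pieceOne lam r)
    (1 / 2 + delta lam r) (1 - delta lam r) f
  join_right : IsSmoothJoin (pieceY lam r 1) (pieceFour lam r)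
    (yPt 1) (4 - 3 / 2 * delta lam r) f
  slope_left : ∀ t ∈ Icc (5 / 2 * delta lam r) (1 / 2 - delta lam r),
    derivWithin f (Icc (5 / 2 * delta lam r) (1 / 2 - delta lam r)) t ∈ Icc (3 / 2) (lam ^ r)
  slope_mid : ∀ t ∈ Icc (1 / 2 + delta lam r) (1 - delta lam r),
    derivWithin f (Icc (1 / 2 + delta lam r) (1 - delta lam r)) t ∈ Icc (-lam ^ r) (-(3 / 2))
  slope_right : ∀ t ∈ Icc (yPt 1) (4 - 3 / 2 * delta lam r),
    derivWithin f (Icc (yPt 1) (4 - 3 / 2 * delta lam r)) t ∈ Icc (3 / 2) (lam ^ r)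

end

end MixingInterval

/-!
The parameters fit together through a few identities. As `M_n k_n = 2 λ^r`, the graph has slope
`2 λ^r δⁿ` on both sides of `y_n` and on the right of `x_n`, where `φ_n` is made to match it. The
minima of the oscillations have the height `δⁿ y_{n+1}` (`xPt_sub_mMin`) and the maxima the height
`δⁿ y_n`.

*Smoothness.* All formulas agree to infinite order where they meet (`contDiffOn_left`,
`contDiffOn_right`). At `1` the left side is flat to order `2r - 1`. On the right, rescaling makes the
`k`-th derivative over `[x_n, y_n]` of size `δⁿ (y_n - x_n) (M_n / (y_n - x_n))^k`, which is
`O(λ^{n(k - r)} / n²)`, so the derivatives of order at most `r` tend to `0`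
(`exists_iteratedDeriv_bound`) and the two sides form a `C^r` function.

*Covering.* Call special the fixed points `0` and `4`, the points `x_n`, `y_n` and all turning points.
A segment with a special end point has an iterate that covers `[0, 4]` (`covers_special`). Indeed
`0`, `4`, `x_n` and `y_n` are periodic and repelling, the turning points are mapped to them, and a
segment expanding away from a periodic point grows until it contains `[w_n, x_n]` or `[1/2, 1]`, or a
segment already treated; `f` maps `[1/2, 1]` onto `[0, 4]`.

A segment without special points is stretched by the factor `5/4` by some iterate (`stretches`). The
slope of `f`, or of `f^{n+1}` over `[y_{n+1}, y_n]`, is large enough except near the turning points.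
There the orbit lands close to a repelling periodic point and stays in its linear zone for a while; at
the time of escape the displacement has the size of the zone, and since the turning point is of power
type, the ratio of this displacement to the original distance from the turning point is a lower bound
for the total expansion. Repeated stretching has to stop, and it stops only at a segment with a
special point. So every nondegenerate interval is eventually mapped onto `[0, 4]` (`covers`), and
mixing follows.

*Existence.* A smooth function with prescribed germs at the ends of an interval and derivative in
`[m, M]` is obtained by integrating a blend of the two outer derivatives with a constant, which is
chosen to give the right increment (`exists_join`). The derivatives of the result are bounded
uniformly over boundary data that are bounded multiples of fixed functions (`exists_join_uniform`);
this yields the laps of all `s_n` and all `φ_n` at once, with bounds independent of `n`.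
-/

namespace MixingInterval

open Filter Topology

/-! ### Gluing smooth functions on intervals -/

theorem hasDerivWithinAt_iteratedDerivWithin {N : ℕ∞} {f : ℝ → ℝ} {s : Set ℝ}
    (hs : UniqueDiffOn ℝ s) (hf : ContDiffOn ℝ N f s) {k : ℕ} (hk : (k : ℕ∞) < N) {t : ℝ}
    (ht : t ∈ s) :
    HasDerivWithinAt (iteratedDerivWithin k f s) (iteratedDerivWithin (k + 1) f s t) s t := by
  rw [iteratedDerivWithin_succ]
  exact (hf.differentiableOn_iteratedDerivWithin (by exact_mod_cast hk) hs t ht).hasDerivWithinAt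

theorem iteratedDerivWithin_eq_of_subset {k : ℕ} {f : ℝ → ℝ} {s s' : Set ℝ} (hss : s ⊆ s')
    (hs : UniqueDiffOn ℝ s) (hs' : UniqueDiffOn ℝ s') (hf : ContDiffOn ℝ k f s') {t : ℝ}
    (ht : t ∈ s) : iteratedDerivWithin k f s t = iteratedDerivWithin k f s' t := by
  rw [iteratedDerivWithin, iteratedDerivWithin, iteratedFDerivWithin_subset hss hs hs' hf ht]

/-- A tower of functions, each the derivative within `s` of the preceding one, consists of the
iterated derivatives of its bottom member. -/
theorem iteratedDerivWithin_eq_of_hasDerivWithinAt {N : ℕ∞} {f : ℝ → ℝ} {F : ℕ → ℝ → ℝ}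
    {s : Set ℝ} (hs : UniqueDiffOn ℝ s) (h0 : EqOn f (F 0) s)
    (h : ∀ k : ℕ, (k : ℕ∞) < N → ∀ t ∈ s, HasDerivWithinAt (F k) (F (k + 1) t) s t) (k : ℕ)
    (hk : (k : ℕ∞) ≤ N) : EqOn (iteratedDerivWithin k f s) (F k) s := by
  induction k with
  | zero => simpa using h0
  | succ k ih =>
    have hk' : (k : ℕ∞) < N := lt_of_lt_of_le (by exact_mod_cast Nat.lt_succ_self k) hk
    intro t ht
    rw [iteratedDerivWithin_succ, derivWithin_congr (ih hk'.le) (ih hk'.le ht)]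
    exact (h k hk' t ht).derivWithin (hs t ht)

/-- A tower of functions, each the derivative within `s` of the preceding one and all continuous,
witnesses `C^N`. -/
theorem contDiffOn_of_hasDerivWithinAt {N : ℕ∞} {f : ℝ → ℝ} {F : ℕ → ℝ → ℝ}
    {s : Set ℝ} (hs : UniqueDiffOn ℝ s) (h0 : EqOn f (F 0) s)
    (h : ∀ k : ℕ, (k : ℕ∞) < N → ∀ t ∈ s, HasDerivWithinAt (F k) (F (k + 1) t) s t)
    (hc : ∀ k : ℕ, (k : ℕ∞) ≤ N → ContinuousOn (F k) s) : ContDiffOn ℝ N f s := by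
  have key := iteratedDerivWithin_eq_of_hasDerivWithinAt hs h0 h
  refine contDiffOn_of_continuousOn_differentiableOn_deriv (fun m hm => ?_) (fun m hm => ?_)
  · exact (hc m hm).congr (key m hm)
  · have : DifferentiableOn ℝ (F m) s := fun t ht => (h m hm t ht).differentiableWithinAt
    exact this.congr (key m hm.le)

/-- Gluing at a point where all one-sided derivatives agree. -/
theorem contDiffOn_Icc_glue {N : ℕ∞} {f : ℝ → ℝ} {a b c : ℝ} (hab : a < b) (hbc : b < c)
    (h₁ : ContDiffOn ℝ N f (Icc a b)) (h₂ : ContDiffOn ℝ N f (Icc b c))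
    (h : ∀ k : ℕ, (k : ℕ∞) ≤ N →
      iteratedDerivWithin k f (Icc a b) b = iteratedDerivWithin k f (Icc b c) b) :
    ContDiffOn ℝ N f (Icc a c) := by
  have u₁ := uniqueDiffOn_Icc hab
  have u₂ := uniqueDiffOn_Icc hbc
  set F : ℕ → ℝ → ℝ := fun k t =>
    if t ≤ b then iteratedDerivWithin k f (Icc a b) t else iteratedDerivWithin k f (Icc b c) t
  have e₁ : ∀ k, EqOn (F k) (iteratedDerivWithin k f (Icc a b)) (Icc a b) := fun k t ht => by
    simp [F, ht.2]
  have e₂ : ∀ k : ℕ, (k : ℕ∞) ≤ N →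
      EqOn (F k) (iteratedDerivWithin k f (Icc b c)) (Icc b c) := fun k hk t ht => by
    rcases ht.1.eq_or_lt with rfl | hlt
    · simp [F, h k hk]
    · simp [F, not_le.2 hlt]
  have un : Icc a c = Icc a b ∪ Icc b c := (Icc_union_Icc_eq_Icc hab.le hbc.le).symm
  refine contDiffOn_of_hasDerivWithinAt (F := F) (uniqueDiffOn_Icc (hab.trans hbc)) ?_ ?_ ?_
  · intro t ht
    by_cases htb : t ≤ b <;> simp [F, htb]
  · intro k hk t ht
    have hk1 : ((k + 1 : ℕ) : ℕ∞) ≤ N := by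
      have := Order.add_one_le_of_lt hk
      exact_mod_cast this
    rw [un]
    refine HasDerivWithinAt.union ?_ ?_
    · by_cases htb : t ≤ b
      · have ht' : t ∈ Icc a b := ⟨ht.1, htb⟩
        rw [e₁ (k + 1) ht']
        exact (hasDerivWithinAt_iteratedDerivWithin u₁ h₁ hk ht').congr (e₁ k) (e₁ k ht')
      · exact HasFDerivWithinAt.of_notMem_closure (by
          rw [isClosed_Icc.closure_eq]; exact fun h' => htb h'.2)
    · by_cases htb : b ≤ t
      · have ht' : t ∈ Icc b c := ⟨htb, ht.2⟩
        rw [e₂ (k + 1) hk1 ht']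
        exact (hasDerivWithinAt_iteratedDerivWithin u₂ h₂ hk ht').congr (e₂ k hk.le)
          (e₂ k hk.le ht')
      · exact HasFDerivWithinAt.of_notMem_closure (by
          rw [isClosed_Icc.closure_eq]; exact fun h' => htb h'.1)
  · intro k hk
    have hk' : (k : ℕ∞ω) ≤ ((N : ℕ∞) : ℕ∞ω) := by exact_mod_cast hk
    rw [un]
    refine ContinuousOn.union_of_isClosed ?_ ?_ isClosed_Icc isClosed_Icc
    · exact (h₁.continuousOn_iteratedDerivWithin hk' u₁).congr (e₁ k)
    · exact (h₂.continuousOn_iteratedDerivWithin hk' u₂).congr (e₂ k hk)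

/-- A function that is `C^N` on `]a, b]`, and whose derivatives of order at most `N` all tend to `0`
at `a`, is `C^N` and flat to order `N` at `a`. -/
theorem contDiffOn_Icc_of_tendsto {N : ℕ∞} {f : ℝ → ℝ} {a b : ℝ} (hab : a < b)
    (hf : ContDiffOn ℝ N f (Ioc a b)) (hfa : f a = 0)
    (h : ∀ k : ℕ, (k : ℕ∞) ≤ N →
      Tendsto (iteratedDerivWithin k f (Ioc a b)) (𝓝[>] a) (𝓝 0)) :
    ContDiffOn ℝ N f (Icc a b) ∧
      ∀ k : ℕ, (k : ℕ∞) ≤ N → iteratedDerivWithin k f (Icc a b) a = 0 := by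
  have u : UniqueDiffOn ℝ (Ioc a b) := uniqueDiffOn_Ioc a b
  set F : ℕ → ℝ → ℝ := fun k t => if t ≤ a then 0 else iteratedDerivWithin k f (Ioc a b) t
  have e : ∀ k, EqOn (F k) (iteratedDerivWithin k f (Ioc a b)) (Ioc a b) := fun k t ht => by
    simp [F, ht.1]
  have Fa : ∀ k, F k a = 0 := fun k => by simp [F]
  have un : Icc a b = insert a (Ioc a b) := (Ioc_insert_left hab.le).symm
  have nh : 𝓝[Ioc a b] a = 𝓝[>] a := nhdsWithin_Ioc_eq_nhdsGT hab
  have lim : ∀ k : ℕ, (k : ℕ∞) ≤ N → Tendsto (F k) (𝓝[>] a) (𝓝 0) := fun k hk => by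
    refine (h k hk).congr' ?_
    filter_upwards [Ioc_mem_nhdsGT hab] with t ht using (e k ht).symm
  have eqs : EqOn f (F 0) (Icc a b) := by
    intro t ht
    rcases ht.1.eq_or_lt with rfl | hlt
    · rw [Fa, hfa]
    · rw [e 0 ⟨hlt, ht.2⟩]; simp
  have dIoc : ∀ k : ℕ, (k : ℕ∞) < N → ∀ t ∈ Ioc a b,
      HasDerivWithinAt (F k) (F (k + 1) t) (Ioc a b) t := fun k hk t ht => by
    rw [e (k + 1) ht]
    exact (hasDerivWithinAt_iteratedDerivWithin u hf hk ht).congr (e k) (e k ht)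
  have dIcc : ∀ k : ℕ, (k : ℕ∞) < N → ∀ t ∈ Icc a b,
      HasDerivWithinAt (F k) (F (k + 1) t) (Icc a b) t := by
    intro k hk t ht
    have hk1 : ((k + 1 : ℕ) : ℕ∞) ≤ N := by
      have := Order.add_one_le_of_lt hk
      exact_mod_cast this
    rcases ht.1.eq_or_lt with rfl | hlt
    · rw [Fa]
      refine (hasDerivWithinAt_Ici_of_tendsto_deriv (s := Ioc a b)
        (fun t ht => (dIoc k hk t ht).differentiableWithinAt) ?_ (Ioc_mem_nhdsGT hab) ?_).mono
        Icc_subset_Ici_self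
      · rw [ContinuousWithinAt, nh, Fa]
        exact lim k hk.le
      · refine (lim (k + 1) hk1).congr' ?_
        filter_upwards [Ioo_mem_nhdsGT hab] with t ht
        have := (dIoc k hk t ⟨ht.1, ht.2.le⟩).hasDerivAt (Ioc_mem_nhds ht.1 ht.2)
        exact this.deriv.symm
    · have := dIoc k hk t ⟨hlt, ht.2⟩
      refine this.mono_of_mem_nhdsWithin ?_
      rw [mem_nhdsWithin]
      exact ⟨Ioi a, isOpen_Ioi, hlt, fun z hz => ⟨hz.1, hz.2.2⟩⟩
  refine ⟨contDiffOn_of_hasDerivWithinAt (F := F) (uniqueDiffOn_Icc hab) eqs dIcc ?_, ?_⟩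
  · intro k hk t ht
    have hk' : (k : ℕ∞ω) ≤ ((N : ℕ∞) : ℕ∞ω) := by exact_mod_cast hk
    rcases ht.1.eq_or_lt with rfl | hlt
    · rw [un, continuousWithinAt_insert_self, ContinuousWithinAt, nh, Fa]
      exact lim k hk
    · have := ((hf.continuousOn_iteratedDerivWithin hk' u).congr (e k)) t ⟨hlt, ht.2⟩
      refine this.mono_of_mem_nhdsWithin ?_
      rw [mem_nhdsWithin]
      exact ⟨Ioi a, isOpen_Ioi, hlt, fun z hz => ⟨hz.1, hz.2.2⟩⟩
  · intro k hk
    rw [iteratedDerivWithin_eq_of_hasDerivWithinAt (F := F) (uniqueDiffOn_Icc hab) eqs dIcc k hk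
      ⟨le_rfl, hab.le⟩, Fa]

/-- Derivatives of an affinely rescaled function. -/
theorem iteratedDerivWithin_rescale {f g : ℝ → ℝ} {s s' : Set ℝ} {A B α a : ℝ}
    (hs : UniqueDiffOn ℝ s) (hs' : UniqueDiffOn ℝ s') (hg : ContDiffOn ℝ ∞ g s')
    (hm : ∀ t ∈ s, α * (t - a) ∈ s') (hf : ∀ t ∈ s, f t = A + B * g (α * (t - a))) :
    ContDiffOn ℝ ∞ f s ∧ ∀ k : ℕ, 1 ≤ k → ∀ t ∈ s, iteratedDerivWithin k f s t =
      B * α ^ k * iteratedDerivWithin k g s' (α * (t - a)) := by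
  have hc : ContDiffOn ℝ ∞ f s := by
    refine ContDiffOn.congr ?_ hf
    exact contDiffOn_const.add (contDiffOn_const.mul
      (hg.comp (by fun_prop : ContDiff ℝ ∞ fun t : ℝ => α * (t - a)).contDiffOn hm))
  refine ⟨hc, ?_⟩
  set F : ℕ → ℝ → ℝ := fun k t =>
    (if k = 0 then A else 0) + B * α ^ k * iteratedDerivWithin k g s' (α * (t - a))
  have key := iteratedDerivWithin_eq_of_hasDerivWithinAt (N := ⊤) (f := f) (F := F) hs
    (fun t ht => by simp [F, hf t ht]) (fun k hk t ht => by
      have h1 := hasDerivWithinAt_iteratedDerivWithin hs' hg hk (hm t ht)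
      have h2 : HasDerivWithinAt (fun t : ℝ => α * (t - a)) α s t := by
        simpa using (((hasDerivAt_id t).sub_const a).const_mul α).hasDerivWithinAt
      have h3 := ((h1.scomp t h2 hm).const_mul (B * α ^ k)).const_add (if k = 0 then A else 0)
      refine h3.congr_deriv ?_
      simp only [F, smul_eq_mul, Nat.succ_ne_zero, if_false]
      ring)
  intro k hk t ht
  rw [key k le_top ht]
  simp [F, Nat.one_le_iff_ne_zero.1 hk]

theorem iteratedDerivWithin_Icc_eq_of_eqOn {f g : ℝ → ℝ} {a b : ℝ} (hab : a < b)
    (hg : ContDiff ℝ ∞ g) (h : EqOn f g (Icc a b)) (k : ℕ) {t : ℝ} (ht : t ∈ Icc a b) :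
    iteratedDerivWithin k f (Icc a b) t = iteratedDeriv k g t := by
  rw [iteratedDerivWithin_congr h ht, iteratedDerivWithin_eq_iteratedDeriv (uniqueDiffOn_Icc hab)
    (hg.contDiffAt.of_le (by exact_mod_cast le_top)) ht]

/-- The mean value inequality for one-sided derivatives. -/
theorem mul_sub_le_of_le_derivWithin {f : ℝ → ℝ} {a b C : ℝ}
    (hf : DifferentiableOn ℝ f (Icc a b)) (h : ∀ t ∈ Ioo a b, C ≤ derivWithin f (Icc a b) t)
    {p q : ℝ} (hp : a ≤ p) (hpq : p ≤ q) (hq : q ≤ b) : C * (q - p) ≤ f q - f p := by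
  refine (convex_Icc a b).mul_sub_le_image_sub_of_le_deriv hf.continuousOn
    (hf.mono interior_subset) ?_ p ⟨hp, hpq.trans hq⟩ q ⟨hp.trans hpq, hq⟩ hpq
  intro t ht
  rw [interior_Icc] at ht
  rw [← derivWithin_of_mem_nhds (Icc_mem_nhds ht.1 ht.2)]
  exact h t ht

/-! ### The numerical parameters -/

section Parameters

variable {lam : ℝ} {r : ℕ}

theorem pow_ge (hlam : 14 ≤ lam) (hr : 1 ≤ r) : 14 ≤ lam ^ r :=
  hlam.trans (le_self_pow₀ (by linarith) (by omega))

theorem delta_pos (hlam : 14 ≤ lam) : 0 < delta lam r := by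
  unfold delta; positivity

theorem delta_mul_pow (hlam : 14 ≤ lam) : delta lam r * lam ^ r = 1 := by
  unfold delta
  have : lam ^ r ≠ 0 := by positivity
  field_simp

theorem delta_le (hlam : 14 ≤ lam) (hr : 1 ≤ r) : delta lam r ≤ 1 / 14 := by
  have := pow_ge hlam hr
  rw [delta, ← one_div]
  exact one_div_le_one_div_of_le (by norm_num) this

/-- This is what makes `M_n ≥ 13`, and it uses `λ ≥ 14` to the full at `n = 1`. -/
theorem fourteen_mul_sq_le (hlam : 14 ≤ lam) {n : ℕ} (hn : 1 ≤ n) :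
    14 * (n : ℝ) ^ 2 ≤ lam ^ n := by
  induction n, hn using Nat.le_induction with
  | base => simpa using hlam
  | succ n hn ih =>
    have h1 : (1 : ℝ) ≤ n := by exact_mod_cast hn
    have h2 : 0 < lam ^ n := by positivity
    have h3 := mul_le_mul_of_nonneg_left hlam h2.le
    rw [pow_succ lam]
    push_cast
    nlinarith

theorem osc_ge_int (hlam : 14 ≤ lam) {n : ℕ} (hn : 1 ≤ n) : 13 ≤ osc lam n := by
  have h1 : (1 : ℝ) ≤ n := by exact_mod_cast hn
  have h := fourteen_mul_sq_le hlam hn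
  have : (7 : ℤ) ≤ ⌊lam ^ n / (2 * (n : ℝ) ^ 2)⌋ := by
    rw [Int.le_floor, le_div_iff₀ (by positivity)]
    push_cast
    linarith
  unfold osc
  omega

theorem osc_ge (hlam : 14 ≤ lam) {n : ℕ} (hn : 1 ≤ n) : (13 : ℝ) ≤ osc lam n := by
  exact_mod_cast osc_ge_int hlam hn

theorem osc_odd (n : ℕ) : Odd (osc lam n) := by
  unfold osc
  exact ⟨⌊lam ^ n / (2 * (n : ℝ) ^ 2)⌋ - 1, by ring⟩

theorem osc_mul_sq_le {n : ℕ} (hn : 1 ≤ n) : (osc lam n : ℝ) * (n : ℝ) ^ 2 ≤ lam ^ n := by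
  have h1 : (1 : ℝ) ≤ n := by exact_mod_cast hn
  have h := Int.floor_le (lam ^ n / (2 * (n : ℝ) ^ 2))
  rw [le_div_iff₀ (by positivity)] at h
  unfold osc
  push_cast
  nlinarith

theorem osc_mul_slope (hlam : 14 ≤ lam) {n : ℕ} (hn : 1 ≤ n) :
    (osc lam n : ℝ) * slope lam r n = 2 * lam ^ r := by
  have := osc_ge hlam hn
  unfold slope
  have : (osc lam n : ℝ) ≠ 0 := by positivity
  field_simp

theorem slope_pos (hlam : 14 ≤ lam) {n : ℕ} (hn : 1 ≤ n) : 0 < slope lam r n := by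
  have := osc_ge hlam hn
  unfold slope
  positivity

theorem slope_le (hlam : 14 ≤ lam) {n : ℕ} (hn : 1 ≤ n) :
    slope lam r n ≤ 2 / 13 * lam ^ r := by
  have := osc_ge hlam hn
  have h := osc_mul_slope (r := r) hlam hn
  have := slope_pos (r := r) hlam hn
  nlinarith

/-- `M_n` times the least slope of `s_n` away from its extrema. -/
theorem le_osc_mul_min (hlam : 14 ≤ lam) (hr : 1 ≤ r) {n : ℕ} (hn : 1 ≤ n) :
    13 / 2 ≤ (osc lam n : ℝ) * min (1 / 2) (slope lam r n) := by
  have h1 := osc_ge hlam hn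
  have h2 := osc_mul_slope (r := r) hlam hn
  have h3 := pow_ge hlam hr
  rcases min_choice (1 / 2) (slope lam r n) with h | h <;> rw [h] <;> linarith

theorem mMin_bounds {n : ℕ} (hn : 1 ≤ n) : 3 / 4 ≤ mMin n ∧ mMin n ≤ 1 := by
  have h1 : (1 : ℝ) ≤ n := by exact_mod_cast hn
  unfold mMin
  have : 1 / ((n : ℝ) + 1) ^ 2 ≤ 1 / 4 :=
    one_div_le_one_div_of_le (by norm_num) (by nlinarith)
  have : 0 ≤ 1 / ((n : ℝ) + 1) ^ 2 := by positivity
  constructor <;> linarith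

theorem xPt_gt {n : ℕ} (hn : 1 ≤ n) : 1 < xPt n := by
  have h1 : (1 : ℝ) ≤ n := by exact_mod_cast hn
  unfold xPt
  have : 0 < 1 / (n : ℝ) := by positivity
  linarith

theorem xPt_le {n : ℕ} (hn : 1 ≤ n) : xPt n ≤ 2 := by
  have h1 : (1 : ℝ) ≤ n := by exact_mod_cast hn
  unfold xPt
  have : 1 / (n : ℝ) ≤ 1 := by rw [div_le_one (by linarith)]; exact h1
  linarith

theorem yPt_sub_xPt (n : ℕ) : yPt n - xPt n = 1 / (2 * (n : ℝ) ^ 2) := by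
  unfold yPt; ring

theorem xPt_lt_yPt {n : ℕ} (hn : 1 ≤ n) : xPt n < yPt n := by
  have h1 : (1 : ℝ) ≤ n := by exact_mod_cast hn
  have := yPt_sub_xPt n
  have : 0 < 1 / (2 * (n : ℝ) ^ 2) := by positivity
  linarith

theorem yPt_one : yPt 1 = 5 / 2 := by
  unfold yPt xPt; norm_num

theorem xPt_sub_yPt {n : ℕ} (hn : 1 ≤ n) :
    xPt n - yPt (n + 1) = ((n : ℝ) + 2) / (2 * (n : ℝ) * ((n : ℝ) + 1) ^ 2) := by
  have h1 : (1 : ℝ) ≤ n := by exact_mod_cast hn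
  unfold yPt xPt
  push_cast
  field_simp
  ring

theorem yPt_succ_lt_xPt {n : ℕ} (hn : 1 ≤ n) : yPt (n + 1) < xPt n := by
  have h1 : (1 : ℝ) ≤ n := by exact_mod_cast hn
  have := xPt_sub_yPt hn
  have : 0 < ((n : ℝ) + 2) / (2 * (n : ℝ) * ((n : ℝ) + 1) ^ 2) := by positivity
  linarith

/-- The minima of the rescaled `s_n` have height `y_{n+1}`. -/
theorem xPt_sub_mMin {n : ℕ} (hn : 1 ≤ n) :
    xPt n - mMin n * (yPt n - xPt n) = yPt (n + 1) := by
  have h1 : (1 : ℝ) ≤ n := by exact_mod_cast hn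
  unfold yPt xPt mMin
  push_cast
  field_simp
  ring

theorem yPt_gt {n : ℕ} (hn : 1 ≤ n) : 1 < yPt n := (xPt_gt hn).trans (xPt_lt_yPt hn)

theorem yPt_anti {m n : ℕ} (hm : 1 ≤ m) (hmn : m ≤ n) : yPt n ≤ yPt m := by
  induction n, hmn using Nat.le_induction with
  | base => exact le_rfl
  | succ n hn ih =>
    exact ((yPt_succ_lt_xPt (hm.trans hn)).trans (xPt_lt_yPt (hm.trans hn))).le.trans ih

theorem yPt_le {n : ℕ} (hn : 1 ≤ n) : yPt n ≤ 5 / 2 := yPt_one ▸ yPt_anti le_rfl hn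

theorem tendsto_yPt : Tendsto yPt atTop (𝓝 1) := by
  have h1 : Tendsto (fun n : ℕ => 1 / (n : ℝ)) atTop (𝓝 0) := tendsto_one_div_atTop_nhds_zero_nat
  have : yPt = fun n : ℕ => 1 + 1 / (n : ℝ) + 1 / 2 * ((1 / (n : ℝ)) * (1 / (n : ℝ))) := by
    funext n
    unfold yPt xPt
    congr 1
    rcases eq_or_ne (n : ℝ) 0 with h | h
    · simp [h]
    · field_simp
  rw [this]
  have := (h1.const_add 1).add ((h1.mul h1).const_mul (1 / 2))
  rwa [mul_zero, mul_zero, add_zero, add_zero] at this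

/-- `]1, y_1[` is covered by the intervals `[y_{n+1}, y_n[`. -/
theorem exists_yPt_le {t : ℝ} (h1 : 1 < t) (h2 : t < yPt 1) :
    ∃ n : ℕ, 1 ≤ n ∧ yPt (n + 1) ≤ t ∧ t < yPt n := by
  classical
  have hex : ∃ n : ℕ, 1 ≤ n ∧ yPt (n + 1) ≤ t := by
    obtain ⟨n, hn⟩ := ((tendsto_yPt.eventually (gt_mem_nhds h1)).and (eventually_ge_atTop 1)).exists
    exact ⟨n, hn.2, (yPt_anti hn.2 n.le_succ).trans hn.1.le⟩
  refine ⟨Nat.find hex, (Nat.find_spec hex).1, (Nat.find_spec hex).2, ?_⟩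
  rcases Nat.lt_or_ge 1 (Nat.find hex) with h | h
  · have := Nat.find_min hex (m := Nat.find hex - 1) (by omega)
    by_contra hc
    refine this ⟨by omega, ?_⟩
    rw [Nat.sub_add_cancel (by omega)]
    exact not_lt.1 hc
  · rwa [le_antisymm h (Nat.find_spec hex).1]

/-- The affine piece on `[y_{n+1}, w_n]` is a fraction `δ / 2` of the gap `[y_{n+1}, x_n]`, so that
the expansion by `2 λ^r` around `y_{n+1}` maps it onto the gap. -/
theorem wPt_sub_yPt (hlam : 14 ≤ lam) {n : ℕ} (hn : 1 ≤ n) :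
    wPt lam r n - yPt (n + 1) = (xPt n - yPt (n + 1)) * (delta lam r / 2) := by
  have h1 : (1 : ℝ) ≤ n := by exact_mod_cast hn
  have h2 := osc_mul_slope (r := r) hlam (n := n + 1) (by omega)
  have h3 : lam ^ r ≠ 0 := by positivity
  rw [xPt_sub_yPt hn, wPt, mul_assoc _ (osc lam (n + 1) : ℝ), h2, delta]
  field_simp
  ring

theorem len_eq (hlam : 14 ≤ lam) {n : ℕ} (hn : 1 ≤ n) :
    len lam r n = (xPt n - yPt (n + 1)) * (1 - delta lam r / 2) := by
  have := wPt_sub_yPt (r := r) hlam hn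
  unfold len
  linarith

theorem len_pos (hlam : 14 ≤ lam) (hr : 1 ≤ r) {n : ℕ} (hn : 1 ≤ n) : 0 < len lam r n := by
  rw [len_eq hlam hn]
  have := delta_le hlam hr
  have := yPt_succ_lt_xPt hn
  exact mul_pos (by linarith) (by linarith)

theorem wPt_lt_xPt (hlam : 14 ≤ lam) (hr : 1 ≤ r) {n : ℕ} (hn : 1 ≤ n) :
    wPt lam r n < xPt n := by
  have := len_pos hlam hr hn
  unfold len at this
  linarith

theorem yPt_lt_wPt (hlam : 14 ≤ lam) {n : ℕ} (hn : 1 ≤ n) :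
    yPt (n + 1) < wPt lam r n := by
  have := delta_pos (r := r) hlam
  have h2 := yPt_succ_lt_xPt hn
  have h3 := wPt_sub_yPt (r := r) hlam hn
  have : 0 < (xPt n - yPt (n + 1)) * (delta lam r / 2) := mul_pos (by linarith) (by linarith)
  linarith

theorem height_eq (n : ℕ) : height lam r n = delta lam r ^ n * xPt n * (1 - delta lam r) := by
  unfold height; ring

theorem height_pos (hlam : 14 ≤ lam) (hr : 1 ≤ r) {n : ℕ} (hn : 1 ≤ n) :
    0 < height lam r n := by
  rw [height_eq]
  have h1 := delta_le hlam hr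
  have h2 := xPt_gt hn
  have h3 := delta_pos (r := r) hlam
  have : 0 < 1 - delta lam r := by linarith
  positivity

theorem delta_pow_le (hlam : 14 ≤ lam) (hr : 1 ≤ r) (n : ℕ) :
    delta lam r ^ n ≤ (lam ^ n)⁻¹ := by
  rw [← inv_pow]
  refine pow_le_pow_left₀ (delta_pos hlam).le ?_ n
  unfold delta
  exact inv_anti₀ (by linarith) (le_self_pow₀ (by linarith) (by omega))

theorem height_le_len (hlam : 14 ≤ lam) (hr : 1 ≤ r) {n : ℕ} (hn : 1 ≤ n) :
    height lam r n ≤ len lam r n := by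
  have h1 : (1 : ℝ) ≤ n := by exact_mod_cast hn
  have hd := delta_le hlam hr
  have hd0 := delta_pos (r := r) hlam
  have hx := xPt_sub_yPt hn
  have hp : 0 < xPt n - yPt (n + 1) := by linarith [yPt_succ_lt_xPt hn]
  have e1 : delta lam r ^ n * (14 * (n : ℝ) ^ 2) ≤ 1 := by
    have := delta_pow_le hlam hr n
    have h14 := fourteen_mul_sq_le hlam hn
    have hl : 0 < lam ^ n := by positivity
    calc delta lam r ^ n * (14 * (n : ℝ) ^ 2) ≤ (lam ^ n)⁻¹ * lam ^ n := by gcongr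
      _ = 1 := by field_simp
  have hx2 : xPt n ≤ 2 := xPt_le hn
  have e2 : delta lam r ^ n * xPt n ≤ xPt n - yPt (n + 1) := by
    have hA : (n : ℝ) ^ 2 * ((xPt n - yPt (n + 1)) * 14) ≥ 2 := by
      rw [hx]
      rw [ge_iff_le, ← sub_nonneg]
      have : (n : ℝ) ^ 2 * (((n : ℝ) + 2) / (2 * (n : ℝ) * ((n : ℝ) + 1) ^ 2) * 14) - 2
        = (7 * n * (n + 2) - 2 * (n + 1) ^ 2) / ((n : ℝ) + 1) ^ 2 := by
        field_simp
        ring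
      rw [this]
      apply div_nonneg _ (by positivity)
      nlinarith
    have hn2 : (0 : ℝ) < (n : ℝ) ^ 2 * 14 := by positivity
    have hdn : 0 < delta lam r ^ n := by positivity
    have : delta lam r ^ n * xPt n * ((n : ℝ) ^ 2 * 14) ≤
        (xPt n - yPt (n + 1)) * ((n : ℝ) ^ 2 * 14) := by
      have := mul_le_mul_of_nonneg_left e1 (zero_le_one.trans (xPt_gt hn).le)
      linarith
    exact le_of_mul_le_mul_right this hn2
  rw [height_eq, len_eq hlam hn]
  exact mul_le_mul e2 (by linarith) (by linarith) hp.le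

/-- The one-sided derivative of `φ_n` at `0`. -/
theorem conn_slope_bounds (hlam : 14 ≤ lam) (hr : 1 ≤ r) {n : ℕ} (hn : 1 ≤ n) :
    0 < 2 * (height lam r n)⁻¹ * len lam r n * delta lam r ^ n ∧
    2 * (height lam r n)⁻¹ * len lam r n * delta lam r ^ n ≤ 1 / 2 := by
  have h1 : (1 : ℝ) ≤ n := by exact_mod_cast hn
  have hd := delta_le hlam hr
  have hd0 := delta_pos (r := r) hlam
  have hh := height_pos hlam hr hn
  have hl := len_pos hlam hr hn
  refine ⟨by positivity, ?_⟩
  have hdn : 0 < delta lam r ^ n := by positivity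
  have : 2 * (height lam r n)⁻¹ * len lam r n * delta lam r ^ n =
      2 * len lam r n / (xPt n * (1 - delta lam r)) := by
    rw [height_eq]
    have := xPt_gt hn
    have h3 : (1 - delta lam r) ≠ 0 := by linarith
    field_simp
  have hx := xPt_gt hn
  rw [this, div_le_iff₀ (mul_pos (by linarith) (by linarith)), len_eq hlam hn]
  have hx' : xPt n - yPt (n + 1) ≤ 3 / 8 * (1 / n) := by
    rw [xPt_sub_yPt hn, ← sub_nonneg]
    have : 3 / 8 * (1 / (n : ℝ)) - ((n : ℝ) + 2) / (2 * (n : ℝ) * ((n : ℝ) + 1) ^ 2)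
      = (3 * ((n : ℝ) + 1) ^ 2 - 4 * (n + 2)) / (8 * n * (n + 1) ^ 2) := by
      field_simp
      ring
    rw [this]
    apply div_nonneg _ (by positivity)
    nlinarith
  have hx2 : xPt n = 1 + 1 / (n : ℝ) := rfl
  have hn1 : 1 / (n : ℝ) ≤ 1 := by rw [div_le_one (by linarith)]; exact h1
  have hn0 : 0 < 1 / (n : ℝ) := by positivity
  rw [hx2] at hx' ⊢
  have hp : 0 < xPt n - yPt (n + 1) := by linarith [yPt_succ_lt_xPt hn]
  rw [hx2] at hp
  have a1 : (1 + 1 / (n : ℝ) - yPt (n + 1)) * (1 - delta lam r / 2) ≤ 3 / 8 * (1 / n) := by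
    nlinarith
  have a2 : (1 + 1 / (n : ℝ)) * (1 - delta lam r) ≥ (1 + 1 / (n : ℝ)) * (13 / 14) := by
    apply mul_le_mul_of_nonneg_left <;> linarith
  linarith

/-- The formula on the left of `1`, freed of its negative exponent. -/
theorem pieceOne_eq (hlam : 14 ≤ lam) (t : ℝ) :
    pieceOne lam r t = delta lam r * ((1 - t) / delta lam r) ^ (2 * r) := by
  have hd0 := delta_pos (r := r) hlam
  unfold pieceOne
  rw [zpow_sub₀ hd0.ne', zpow_one, div_pow, ← neg_sub t 1, neg_pow]
  have : ((-1 : ℝ) ^ (2 * r)) = 1 := by simp [pow_mul]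
  rw [this]
  have e : delta lam r ^ (2 * (r : ℤ)) = delta lam r ^ (2 * r) := by norm_cast
  rw [e]
  ring

end Parameters

/-! ### Smoothness away from `1` -/

theorem iteratedDeriv_affine (A B c x : ℝ) (k : ℕ) :
    iteratedDeriv k (fun t => A + B * (t - c)) x =
      if k = 0 then A + B * (x - c) else if k = 1 then B else 0 := by
  have h1 : deriv (fun t => A + B * (t - c)) = fun _ => B := by
    funext t
    simp
  rcases k with _ | _ | k
  · simp
  · simp [iteratedDeriv_succ', h1]
  · rw [iteratedDeriv_succ', h1, iteratedDeriv_succ']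
    simp

theorem iteratedDerivWithin_left_of_eqOn {f g : ℝ → ℝ} {a c b : ℝ} (hac : a < c) (hcb : c ≤ b)
    (hf : ContDiffOn ℝ ∞ f (Icc a b)) (hg : ContDiff ℝ ∞ g) (h : EqOn f g (Icc a c)) (k : ℕ) :
    iteratedDerivWithin k f (Icc a b) a = iteratedDeriv k g a := by
  rw [← iteratedDerivWithin_Icc_eq_of_eqOn hac hg h k (left_mem_Icc.2 hac.le)]
  exact (iteratedDerivWithin_eq_of_subset (Icc_subset_Icc_right hcb) (uniqueDiffOn_Icc hac)
    (uniqueDiffOn_Icc (hac.trans_le hcb)) (hf.of_le (by exact_mod_cast le_top))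
    (left_mem_Icc.2 hac.le)).symm

theorem iteratedDerivWithin_right_of_eqOn {f g : ℝ → ℝ} {a c b : ℝ} (hac : a ≤ c) (hcb : c < b)
    (hf : ContDiffOn ℝ ∞ f (Icc a b)) (hg : ContDiff ℝ ∞ g) (h : EqOn f g (Icc c b)) (k : ℕ) :
    iteratedDerivWithin k f (Icc a b) b = iteratedDeriv k g b := by
  rw [← iteratedDerivWithin_Icc_eq_of_eqOn hcb hg h k (right_mem_Icc.2 hcb.le)]
  exact (iteratedDerivWithin_eq_of_subset (Icc_subset_Icc_left hac) (uniqueDiffOn_Icc hcb)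
    (uniqueDiffOn_Icc (hac.trans_lt hcb)) (hf.of_le (by exact_mod_cast le_top))
    (right_mem_Icc.2 hcb.le)).symm

theorem contDiff_pieceZero {lam : ℝ} {r : ℕ} : ContDiff ℝ ∞ (pieceZero lam r) := by
  unfold pieceZero; fun_prop

theorem contDiff_pieceHalf {lam : ℝ} {r : ℕ} : ContDiff ℝ ∞ (pieceHalf lam r) := by
  unfold pieceHalf; fun_prop

theorem contDiff_pieceOne {lam : ℝ} {r : ℕ} : ContDiff ℝ ∞ (pieceOne lam r) := by
  unfold pieceOne; fun_prop

theorem contDiff_pieceY {lam : ℝ} {r n : ℕ} : ContDiff ℝ ∞ (pieceY lam r n) := by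
  unfold pieceY; fun_prop

theorem contDiff_pieceFour {lam : ℝ} {r : ℕ} : ContDiff ℝ ∞ (pieceFour lam r) := by
  unfold pieceFour; fun_prop

/-- The left-hand formula at `1` is flat up to order `2r - 1`, which is why it joins a function that
is flat to order `r` on the right. -/
theorem iteratedDeriv_pieceOne {lam : ℝ} {r k : ℕ} (hk : k < 2 * r) :
    iteratedDeriv k (pieceOne lam r) 1 = 0 := by
  have : pieceOne lam r = fun t => delta lam r ^ (1 - 2 * (r : ℤ)) * (t - 1) ^ (2 * r) := rfl
  rw [this, iteratedDeriv_const_mul_field]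
  have h2 := iteratedDeriv_comp_sub_const (n := k) (f := fun z : ℝ => z ^ (2 * r)) (s := (1 : ℝ))
  rw [h2]
  simp only [sub_self]
  rw [iteratedDeriv_fun_pow_zero, if_neg (by omega), Nat.cast_zero, mul_zero]

/-- The affine formula of `f` on a right neighbourhood of `x_n`. -/
noncomputable def pieceX (lam : ℝ) (r n : ℕ) (t : ℝ) : ℝ :=
  delta lam r ^ n * xPt n + delta lam r ^ n * (2 * lam ^ r) * (t - xPt n)

theorem contDiff_pieceX {lam : ℝ} {r n : ℕ} : ContDiff ℝ ∞ (pieceX lam r n) := by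
  unfold pieceX; fun_prop

/-- The factor `M_n / (y_n - x_n)` rescaling `[x_n, y_n]` to `[0, M_n]`. -/
noncomputable def zoom (lam : ℝ) (n : ℕ) : ℝ := (osc lam n : ℝ) / (yPt n - xPt n)

theorem zoom_pos {lam : ℝ} (hlam : 14 ≤ lam) {n : ℕ} (hn : 1 ≤ n) : 0 < zoom lam n :=
  div_pos (by linarith [osc_ge hlam hn]) (by linarith [xPt_lt_yPt hn])

theorem zoom_mul {lam : ℝ} {n : ℕ} (hn : 1 ≤ n) :
    zoom lam n * (yPt n - xPt n) = osc lam n := by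
  have : yPt n - xPt n ≠ 0 := by linarith [xPt_lt_yPt hn]
  unfold zoom
  field_simp

theorem zoom_mem {lam : ℝ} (hlam : 14 ≤ lam) {n : ℕ} (hn : 1 ≤ n) {t : ℝ}
    (ht : t ∈ Icc (xPt n) (yPt n)) :
    zoom lam n * (t - xPt n) ∈ Icc 0 (osc lam n : ℝ) := by
  have := zoom_pos hlam hn
  refine ⟨mul_nonneg this.le (by linarith [ht.1]), ?_⟩
  rw [← zoom_mul hn]
  exact mul_le_mul_of_nonneg_left (by linarith [ht.2]) this.le

section Map

variable {lam : ℝ} {r : ℕ} {s φ : ℕ → ℝ → ℝ} {f : ℝ → ℝ}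

theorem IsConstructedMap.osc_eq (hf : IsConstructedMap lam r s φ f) {n : ℕ} (hn : 1 ≤ n)
    {t : ℝ} (ht : t ∈ Icc (xPt n) (yPt n)) :
    f t = delta lam r ^ n * xPt n +
      delta lam r ^ n * (yPt n - xPt n) * s n (zoom lam n * (t - xPt n)) := by
  rw [hf.eq_osc n hn t ht, zoom]
  have : (osc lam n : ℝ) * ((t - xPt n) / (yPt n - xPt n)) =
    (osc lam n : ℝ) / (yPt n - xPt n) * (t - xPt n) := by ring
  rw [this]
  ring

theorem IsConstructedMap.osc_rescale (hf : IsConstructedMap lam r s φ f) (hlam : 14 ≤ lam)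
    {n : ℕ} (hn : 1 ≤ n) :
    ContDiffOn ℝ ∞ f (Icc (xPt n) (yPt n)) ∧ ∀ k : ℕ, 1 ≤ k → ∀ t ∈ Icc (xPt n) (yPt n),
      iteratedDerivWithin k f (Icc (xPt n) (yPt n)) t =
      delta lam r ^ n * (yPt n - xPt n) * zoom lam n ^ k *
        iteratedDerivWithin k (s n) (Icc 0 (osc lam n : ℝ)) (zoom lam n * (t - xPt n)) :=
  iteratedDerivWithin_rescale (uniqueDiffOn_Icc (xPt_lt_yPt hn))
    (uniqueDiffOn_Icc (by linarith [osc_ge hlam hn])) (hf.oscFamily.smooth n hn)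
    (fun _ ht => zoom_mem hlam hn ht) (fun _ ht => hf.osc_eq hn ht)

theorem IsConstructedMap.conn_eq (hf : IsConstructedMap lam r s φ f)
    {n : ℕ} (hn : 1 ≤ n) {t : ℝ} (ht : t ∈ Icc (wPt lam r n) (xPt n)) :
    f t = delta lam r ^ (n + 1) * xPt n +
      height lam r n * φ n ((len lam r n)⁻¹ * (t - wPt lam r n)) := by
  rw [hf.eq_conn n hn t ht, div_eq_inv_mul]

theorem conn_mem (hlam : 14 ≤ lam) (hr : 1 ≤ r) {n : ℕ} (hn : 1 ≤ n) {t : ℝ}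
    (ht : t ∈ Icc (wPt lam r n) (xPt n)) :
    (len lam r n)⁻¹ * (t - wPt lam r n) ∈ Icc (0 : ℝ) 1 := by
  have h := len_pos hlam hr hn
  refine ⟨mul_nonneg (by positivity) (by linarith [ht.1]), ?_⟩
  rw [inv_mul_le_iff₀ h, len]
  linarith [ht.2]

theorem IsConstructedMap.conn_rescale (hf : IsConstructedMap lam r s φ f) (hlam : 14 ≤ lam)
    (hr : 1 ≤ r) {n : ℕ} (hn : 1 ≤ n) :
    ContDiffOn ℝ ∞ f (Icc (wPt lam r n) (xPt n)) ∧
      ∀ k : ℕ, 1 ≤ k → ∀ t ∈ Icc (wPt lam r n) (xPt n),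
      iteratedDerivWithin k f (Icc (wPt lam r n) (xPt n)) t =
      height lam r n * (len lam r n)⁻¹ ^ k *
        iteratedDerivWithin k (φ n) (Icc 0 1) ((len lam r n)⁻¹ * (t - wPt lam r n)) :=
  iteratedDerivWithin_rescale (uniqueDiffOn_Icc (wPt_lt_xPt hlam hr hn))
    (uniqueDiffOn_Icc one_pos) (hf.connFamily.smooth n hn)
    (fun _ ht => conn_mem hlam hr hn ht) (fun _ ht => hf.conn_eq hn ht)

theorem IsConstructedMap.eqOn_pieceX (hf : IsConstructedMap lam r s φ f) (hlam : 14 ≤ lam)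
    (hr : 1 ≤ r) {n : ℕ} (hn : 1 ≤ n) :
    EqOn f (pieceX lam r n) (Icc (xPt n) (xPt n + delta lam r / zoom lam n)) := by
  intro t ht
  have hz := zoom_pos hlam hn
  have hM := osc_ge hlam hn
  have hd := delta_le hlam hr
  have h1 : zoom lam n * (t - xPt n) ≤ delta lam r := by
    rw [← le_div_iff₀' hz]; linarith [ht.2]
  have h0 : 0 ≤ zoom lam n * (t - xPt n) := mul_nonneg hz.le (by linarith [ht.1])
  have hty : t ≤ yPt n := by
    have := zoom_mul (lam := lam) hn
    by_contra hc
    push Not at hc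
    have : zoom lam n * (yPt n - xPt n) ≤ zoom lam n * (t - xPt n) :=
      mul_le_mul_of_nonneg_left (by linarith) hz.le
    linarith
  rw [hf.osc_eq hn ⟨ht.1, hty⟩, hf.oscFamily.near_zero n hn _ ⟨h0, h1⟩, pieceX,
    ← osc_mul_slope (r := r) hlam hn, ← zoom_mul (lam := lam) hn]
  ring

theorem delta_div_zoom_lt (hlam : 14 ≤ lam) (hr : 1 ≤ r) {n : ℕ} (hn : 1 ≤ n) :
    delta lam r / zoom lam n < yPt n - xPt n := by
  rw [div_lt_iff₀' (zoom_pos hlam hn), zoom_mul hn]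
  linarith [osc_ge hlam hn, delta_le hlam hr]

theorem IsConstructedMap.eqOn_pieceY_left (hf : IsConstructedMap lam r s φ f) (hlam : 14 ≤ lam)
    (hr : 1 ≤ r) {n : ℕ} (hn : 1 ≤ n) :
    EqOn f (pieceY lam r n) (Icc (yPt n - delta lam r / zoom lam n) (yPt n)) := by
  intro t ht
  have hz := zoom_pos hlam hn
  have hM := osc_ge hlam hn
  have hlt := delta_div_zoom_lt hlam hr hn
  have e : zoom lam n * (t - xPt n) = osc lam n - zoom lam n * (yPt n - t) := by
    rw [← zoom_mul hn]; ring
  have h1 : zoom lam n * (yPt n - t) ≤ delta lam r := by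
    rw [← le_div_iff₀' hz]; linarith [ht.1]
  have h0 : 0 ≤ zoom lam n * (yPt n - t) := mul_nonneg hz.le (by linarith [ht.2])
  rw [hf.osc_eq hn ⟨by linarith [ht.1], ht.2⟩, e,
    hf.oscFamily.near_end n hn _ ⟨by linarith, by linarith⟩, pieceY, ← zoom_mul (lam := lam) hn]
  ring

theorem IsConstructedMap.iteratedDerivWithin_osc_left (hf : IsConstructedMap lam r s φ f)
    (hlam : 14 ≤ lam) (hr : 1 ≤ r) {n : ℕ} (hn : 1 ≤ n) (k : ℕ) :
    iteratedDerivWithin k f (Icc (xPt n) (yPt n)) (xPt n) =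
      iteratedDeriv k (pieceX lam r n) (xPt n) := by
  have h1 := div_pos (delta_pos (r := r) hlam) (zoom_pos hlam hn)
  have h2 := delta_div_zoom_lt hlam hr hn
  exact iteratedDerivWithin_left_of_eqOn (by linarith) (by linarith) (hf.osc_rescale hlam hn).1
    contDiff_pieceX (hf.eqOn_pieceX hlam hr hn) k

theorem IsConstructedMap.iteratedDerivWithin_osc_right (hf : IsConstructedMap lam r s φ f)
    (hlam : 14 ≤ lam) (hr : 1 ≤ r) {n : ℕ} (hn : 1 ≤ n) (k : ℕ) :
    iteratedDerivWithin k f (Icc (xPt n) (yPt n)) (yPt n) =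
      iteratedDeriv k (pieceY lam r n) (yPt n) := by
  have h1 := div_pos (delta_pos (r := r) hlam) (zoom_pos hlam hn)
  have h2 := delta_div_zoom_lt hlam hr hn
  exact iteratedDerivWithin_right_of_eqOn (by linarith) (by linarith) (hf.osc_rescale hlam hn).1
    contDiff_pieceY (hf.eqOn_pieceY_left hlam hr hn) k

/-- The jets of the affine piece and of the connecting piece agree at `w_n`: this fixes the value
prescribed for `φ_n'(0)`. -/
theorem IsConstructedMap.iteratedDerivWithin_conn_left (hf : IsConstructedMap lam r s φ f)
    (hlam : 14 ≤ lam) (hr : 1 ≤ r) {n : ℕ} (hn : 1 ≤ n) (k : ℕ) :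
    iteratedDerivWithin k f (Icc (wPt lam r n) (xPt n)) (wPt lam r n) =
      iteratedDeriv k (pieceY lam r (n + 1)) (wPt lam r n) := by
  have hw := wPt_lt_xPt hlam hr hn
  have hm : wPt lam r n ∈ Icc (wPt lam r n) (xPt n) := ⟨le_rfl, hw.le⟩
  have hl := (len_pos hlam hr hn).ne'
  have hh := (height_pos hlam hr hn).ne'
  have hd : delta lam r * lam ^ r = 1 := delta_mul_pow hlam
  have hY : pieceY lam r (n + 1) = fun t => delta lam r ^ (n + 1) * yPt (n + 1) +
      delta lam r ^ (n + 1) * (osc lam (n + 1) : ℝ) * slope lam r (n + 1) *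
        (t - yPt (n + 1)) := rfl
  have hM := osc_mul_slope (r := r) hlam (n := n + 1) (by omega)
  rw [hY, iteratedDeriv_affine, mul_assoc (delta lam r ^ (n + 1)) (osc lam (n + 1) : ℝ), hM,
    wPt_sub_yPt hlam hn]
  rcases Nat.lt_or_ge k 1 with h | h
  · obtain rfl : k = 0 := by omega
    rw [iteratedDerivWithin_zero, hf.conn_eq hn hm, sub_self, mul_zero,
      hf.connFamily.map_zero n hn, if_pos rfl]
    linear_combination (-(delta lam r ^ (n + 1) * (xPt n - yPt (n + 1)))) * hd
  rw [(hf.conn_rescale hlam hr hn).2 k h _ hm, sub_self, mul_zero, if_neg (by omega)]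
  rcases h.eq_or_lt with rfl | h
  · rw [iteratedDerivWithin_one, hf.connFamily.deriv_zero n hn, if_pos rfl]
    field_simp
    linear_combination (-(delta lam r ^ n)) * hd
  · rw [hf.connFamily.flat_zero n hn k h, if_neg (by omega), mul_zero]

/-- The jets of the connecting piece and of the oscillating piece agree at `x_n`: this fixes the
value prescribed for `φ_n'(1)`. -/
theorem IsConstructedMap.iteratedDerivWithin_conn_right (hf : IsConstructedMap lam r s φ f)
    (hlam : 14 ≤ lam) (hr : 1 ≤ r) {n : ℕ} (hn : 1 ≤ n) (k : ℕ) :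
    iteratedDerivWithin k f (Icc (wPt lam r n) (xPt n)) (xPt n) =
      iteratedDeriv k (pieceX lam r n) (xPt n) := by
  have hw := wPt_lt_xPt hlam hr hn
  have hm : xPt n ∈ Icc (wPt lam r n) (xPt n) := ⟨hw.le, le_rfl⟩
  have hl := (len_pos hlam hr hn).ne'
  have hh := (height_pos hlam hr hn).ne'
  have hd : delta lam r * lam ^ r = 1 := delta_mul_pow hlam
  have hX : pieceX lam r n = fun t => delta lam r ^ n * xPt n +
      delta lam r ^ n * (2 * lam ^ r) * (t - xPt n) := rfl
  have e : (len lam r n)⁻¹ * (xPt n - wPt lam r n) = 1 := by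
    change (len lam r n)⁻¹ * len lam r n = 1
    field_simp
  rw [hX, iteratedDeriv_affine]
  rcases Nat.lt_or_ge k 1 with h | h
  · obtain rfl : k = 0 := by omega
    rw [iteratedDerivWithin_zero, hf.conn_eq hn hm, e, hf.connFamily.map_one n hn, if_pos rfl,
      height]
    ring
  rw [(hf.conn_rescale hlam hr hn).2 k h _ hm, e, if_neg (by omega)]
  rcases h.eq_or_lt with rfl | h
  · rw [iteratedDerivWithin_one, hf.connFamily.deriv_one n hn, if_pos rfl]
    obtain ⟨m, rfl⟩ : ∃ m, n = m + 1 := ⟨n - 1, by omega⟩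
    field_simp
    rw [Nat.add_sub_cancel]
    linear_combination (-(delta lam r ^ m)) * hd
  · rw [hf.connFamily.flat_one n hn k h, if_neg (by omega), mul_zero]

/-- The order of the points where the formulas for the map change. -/
theorem joints_lt (hlam : 14 ≤ lam) (hr : 1 ≤ r) :
    0 < 5 / 2 * delta lam r ∧ 5 / 2 * delta lam r < 1 / 2 - delta lam r ∧
    1 / 2 - delta lam r < 1 / 2 + delta lam r ∧ 1 / 2 + delta lam r < 1 - delta lam r ∧
    1 - delta lam r < 1 ∧ yPt 1 < 4 - 3 / 2 * delta lam r ∧ 4 - 3 / 2 * delta lam r < 4 := by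
  have h1 := delta_le hlam hr
  have h2 := delta_pos (r := r) hlam
  have h3 := yPt_one
  refine ⟨?_, ?_, ?_, ?_, ?_, ?_, ?_⟩ <;> linarith

theorem IsConstructedMap.contDiffOn_left (hf : IsConstructedMap lam r s φ f)
    (hlam : 14 ≤ lam) (hr : 1 ≤ r) : ContDiffOn ℝ ∞ f (Icc 0 1) := by
  obtain ⟨h1, h2, h3, h4, h5, -, -⟩ := joints_lt hlam hr
  have s1 : ContDiffOn ℝ ∞ f (Icc 0 (5 / 2 * delta lam r)) :=
    contDiff_pieceZero.contDiffOn.congr hf.eq_zero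
  have s3 : ContDiffOn ℝ ∞ f (Icc (1 / 2 - delta lam r) (1 / 2 + delta lam r)) :=
    contDiff_pieceHalf.contDiffOn.congr hf.eq_half
  have s5 : ContDiffOn ℝ ∞ f (Icc (1 - delta lam r) 1) :=
    contDiff_pieceOne.contDiffOn.congr hf.eq_one
  have g2 := contDiffOn_Icc_glue h1 h2 s1 hf.join_left.smooth (fun k _ => by
    rw [hf.join_left.left, iteratedDerivWithin_Icc_eq_of_eqOn h1 contDiff_pieceZero hf.eq_zero k
      (right_mem_Icc.2 h1.le)])
  have g3 := contDiffOn_Icc_glue (h1.trans h2) h3 g2 s3 (fun k _ => by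
    rw [← iteratedDerivWithin_eq_of_subset (Icc_subset_Icc_left h1.le) (uniqueDiffOn_Icc h2)
      (uniqueDiffOn_Icc (h1.trans h2)) (g2.of_le (by exact_mod_cast le_top))
      (right_mem_Icc.2 h2.le), hf.join_left.right,
      iteratedDerivWithin_Icc_eq_of_eqOn h3 contDiff_pieceHalf hf.eq_half k (left_mem_Icc.2 h3.le)])
  have g4 := contDiffOn_Icc_glue (h1.trans (h2.trans h3)) h4 g3 hf.join_mid.smooth (fun k _ => by
    rw [hf.join_mid.left]
    exact iteratedDerivWithin_right_of_eqOn (h1.trans h2).le h3 g3 contDiff_pieceHalf hf.eq_half k)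
  refine contDiffOn_Icc_glue (h1.trans (h2.trans (h3.trans h4))) h5 g4 s5 (fun k _ => ?_)
  rw [← iteratedDerivWithin_eq_of_subset (Icc_subset_Icc_left (h1.trans (h2.trans h3)).le)
    (uniqueDiffOn_Icc h4) (uniqueDiffOn_Icc (h1.trans (h2.trans (h3.trans h4))))
    (g4.of_le (by exact_mod_cast le_top)) (right_mem_Icc.2 h4.le), hf.join_mid.right,
    iteratedDerivWithin_Icc_eq_of_eqOn h5 contDiff_pieceOne hf.eq_one k (left_mem_Icc.2 h5.le)]

/-- Smoothness to the right of `1`, extended by induction over one interval `[y_{n+1}, y_n]` at a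
time. The jet at the left end point is what the next step needs. -/
theorem IsConstructedMap.contDiffOn_right (hf : IsConstructedMap lam r s φ f)
    (hlam : 14 ≤ lam) (hr : 1 ≤ r) {n : ℕ} (hn : 1 ≤ n) :
    ContDiffOn ℝ ∞ f (Icc (yPt n) 4) ∧ ∀ k : ℕ,
      iteratedDerivWithin k f (Icc (yPt n) 4) (yPt n) = iteratedDeriv k (pieceY lam r n) (yPt n) := by
  obtain ⟨-, -, -, -, -, h6, h7⟩ := joints_lt hlam hr
  induction n, hn using Nat.le_induction with
  | base =>
    have s7 : ContDiffOn ℝ ∞ f (Icc (4 - 3 / 2 * delta lam r) 4) :=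
      contDiff_pieceFour.contDiffOn.congr hf.eq_four
    have g := contDiffOn_Icc_glue h6 h7 hf.join_right.smooth s7 (fun k _ => by
      rw [hf.join_right.right, iteratedDerivWithin_Icc_eq_of_eqOn h7 contDiff_pieceFour hf.eq_four k
        (left_mem_Icc.2 h7.le)])
    refine ⟨g, fun k => ?_⟩
    rw [← hf.join_right.left]
    exact (iteratedDerivWithin_eq_of_subset (Icc_subset_Icc_right h7.le) (uniqueDiffOn_Icc h6)
      (uniqueDiffOn_Icc (h6.trans h7)) (g.of_le (by exact_mod_cast le_top))
      (left_mem_Icc.2 h6.le)).symm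
  | succ n hn ih =>
    have a1 := yPt_lt_wPt (r := r) hlam hn
    have a2 := wPt_lt_xPt hlam hr hn
    have a3 := xPt_lt_yPt hn
    have a4 : yPt n < 4 := by linarith [yPt_le hn]
    have g1 := contDiffOn_Icc_glue a3 a4 (hf.osc_rescale hlam hn).1 ih.1 (fun k _ => by
      rw [ih.2, hf.iteratedDerivWithin_osc_right hlam hr hn])
    have g2 := contDiffOn_Icc_glue a2 (a3.trans a4) (hf.conn_rescale hlam hr hn).1 g1 (fun k _ => by
      rw [hf.iteratedDerivWithin_conn_right hlam hr hn, ← hf.iteratedDerivWithin_osc_left hlam hr hn]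
      exact iteratedDerivWithin_eq_of_subset (Icc_subset_Icc_right a4.le) (uniqueDiffOn_Icc a3)
        (uniqueDiffOn_Icc (a3.trans a4)) (g1.of_le (by exact_mod_cast le_top))
        (left_mem_Icc.2 a3.le))
    have s1 : ContDiffOn ℝ ∞ f (Icc (yPt (n + 1)) (wPt lam r n)) :=
      contDiff_pieceY.contDiffOn.congr (hf.eq_affine n hn)
    have g3 := contDiffOn_Icc_glue a1 (a2.trans (a3.trans a4)) s1 g2 (fun k _ => by
      rw [iteratedDerivWithin_Icc_eq_of_eqOn a1 contDiff_pieceY (hf.eq_affine n hn) k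
        (right_mem_Icc.2 a1.le), ← hf.iteratedDerivWithin_conn_left hlam hr hn]
      exact iteratedDerivWithin_eq_of_subset (Icc_subset_Icc_right (a3.trans a4).le)
        (uniqueDiffOn_Icc a2) (uniqueDiffOn_Icc (a2.trans (a3.trans a4)))
        (g2.of_le (by exact_mod_cast le_top)) (left_mem_Icc.2 a2.le))
    exact ⟨g3, fun k => iteratedDerivWithin_left_of_eqOn a1 (a2.trans (a3.trans a4)).le g3
      contDiff_pieceY (hf.eq_affine n hn) k⟩

end Map

/-! ### Smoothness at `1` and the size of the derivative -/

section Map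

variable {lam : ℝ} {r : ℕ} {s φ : ℕ → ℝ → ℝ} {f : ℝ → ℝ}

theorem IsConstructedMap.contDiffOn_Ioc (hf : IsConstructedMap lam r s φ f)
    (hlam : 14 ≤ lam) (hr : 1 ≤ r) : ContDiffOn ℝ ∞ f (Ioc 1 4) := by
  intro t ht
  obtain ⟨n, hn, hn1⟩ :=
    ((tendsto_yPt.eventually (gt_mem_nhds ht.1)).and (eventually_ge_atTop 1)).exists
  refine ((hf.contDiffOn_right hlam hr hn1).1 t ⟨hn.le, ht.2⟩).mono_of_mem_nhdsWithin ?_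
  rw [mem_nhdsWithin]
  exact ⟨Ioi (yPt n), isOpen_Ioi, hn, fun z hz => ⟨le_of_lt hz.1, hz.2.2⟩⟩

theorem IsConstructedMap.contDiffOn_diff (hf : IsConstructedMap lam r s φ f)
    (hlam : 14 ≤ lam) (hr : 1 ≤ r) : ContDiffOn ℝ ∞ f (Icc 0 4 \ {1}) := by
  intro t ht
  rcases lt_or_gt_of_ne ht.2 with h | h
  · refine (hf.contDiffOn_left hlam hr t ⟨ht.1.1, le_of_lt h⟩).mono_of_mem_nhdsWithin ?_
    rw [mem_nhdsWithin]
    exact ⟨Iio 1, isOpen_Iio, h, fun z hz => ⟨hz.2.1.1, le_of_lt hz.1⟩⟩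
  · refine (hf.contDiffOn_Ioc hlam hr t ⟨h, ht.1.2⟩).mono_of_mem_nhdsWithin ?_
    rw [mem_nhdsWithin]
    exact ⟨Ioi 1, isOpen_Ioi, h, fun z hz => ⟨hz.1, hz.2.1.2⟩⟩

theorem mem_three_pieces {n : ℕ} {t : ℝ} (ht : t ∈ Icc (yPt (n + 1)) (yPt n)) :
    t ∈ Icc (yPt (n + 1)) (wPt lam r n) ∨ t ∈ Icc (wPt lam r n) (xPt n) ∨
      t ∈ Icc (xPt n) (yPt n) := by
  rcases le_total t (wPt lam r n) with h | h
  · exact Or.inl ⟨ht.1, h⟩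
  rcases le_total t (xPt n) with h' | h'
  · exact Or.inr (Or.inl ⟨h, h'⟩)
  · exact Or.inr (Or.inr ⟨h', ht.2⟩)

theorem iteratedDeriv_pieceY (hlam : 14 ≤ lam) {n : ℕ} (hn : 1 ≤ n) (k : ℕ) (hk : 1 ≤ k) (t : ℝ) :
    iteratedDeriv k (pieceY lam r n) t = if k = 1 then delta lam r ^ n * (2 * lam ^ r) else 0 := by
  have hY : pieceY lam r n = fun t => delta lam r ^ n * yPt n +
      delta lam r ^ n * (osc lam n : ℝ) * slope lam r n * (t - yPt n) := rfl
  rw [hY, iteratedDeriv_affine, mul_assoc (delta lam r ^ n), osc_mul_slope hlam hn,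
    if_neg (by omega)]

/-- The order-`k` derivative of `f` on `[y_{n+1}, y_n]` tends to `0` as `n → ∞` when `k ≤ r`. On the
oscillating part it is `O(λ^{-nr} λ^{nk} / n²)`: this is where the smoothness stops at order `r`. -/
theorem IsConstructedMap.exists_iteratedDeriv_bound (hf : IsConstructedMap lam r s φ f)
    (hlam : 14 ≤ lam) (hr : 1 ≤ r) {k : ℕ} (hk1 : 1 ≤ k) (hk : k ≤ r) :
    ∃ e : ℕ → ℝ, Tendsto e atTop (𝓝 0) ∧ ∀ n, 1 ≤ n → ∀ t ∈ Icc (yPt (n + 1)) (yPt n),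
      |iteratedDerivWithin k f (Ioc 1 4) t| ≤ e n := by
  obtain ⟨A, hA⟩ := hf.oscFamily.deriv_bounded k hk1
  obtain ⟨B, hB⟩ := hf.connFamily.deriv_bounded k hk1
  have hd0 := delta_pos (r := r) hlam
  have hd := delta_le hlam hr
  have hA0 : 0 ≤ A := (abs_nonneg _).trans
    (hA 1 le_rfl 0 ⟨le_rfl, by linarith [osc_ge (n := 1) hlam le_rfl]⟩)
  have hB0 : 0 ≤ B := (abs_nonneg _).trans (hB 1 le_rfl 0 ⟨le_rfl, zero_le_one⟩)
  have lt4 : ∀ n, 1 ≤ n → yPt n ≤ 4 := fun n hn => by linarith [yPt_le hn]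
  have hu : UniqueDiffOn ℝ (Ioc (1 : ℝ) 4) := uniqueDiffOn_Ioc 1 4
  have hcd := hf.contDiffOn_Ioc hlam hr
  refine ⟨fun n => A * 2 ^ k / 2 * ((1 / (n : ℝ)) * (1 / (n : ℝ))) +
    2 * lam ^ r * delta lam r ^ n + 2 * 4 ^ k * B * ((n : ℝ) ^ (2 * k) * delta lam r ^ n), ?_, ?_⟩
  · have h1 : Tendsto (fun n : ℕ => 1 / (n : ℝ)) atTop (𝓝 0) := tendsto_one_div_atTop_nhds_zero_nat
    have h2 : Tendsto (fun n : ℕ => delta lam r ^ n) atTop (𝓝 0) :=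
      tendsto_pow_atTop_nhds_zero_of_lt_one hd0.le (by linarith)
    have h3 := tendsto_pow_const_mul_const_pow_of_lt_one (2 * k) hd0.le (by linarith)
    have := (((h1.mul h1).const_mul (A * 2 ^ k / 2)).add (h2.const_mul (2 * lam ^ r))).add
      (h3.const_mul (2 * 4 ^ k * B))
    simpa only [mul_zero, add_zero] using this
  · intro n hn t ht
    have h1 : (1 : ℝ) ≤ n := by exact_mod_cast hn
    have hx := xPt_gt hn
    have hy := yPt_gt (n := n + 1) (by omega)
    have hw := yPt_lt_wPt (r := r) hlam hn
    have hwx := wPt_lt_xPt hlam hr hn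
    have hxy := xPt_lt_yPt hn
    have p1 : 0 ≤ A * 2 ^ k / 2 * ((1 / (n : ℝ)) * (1 / (n : ℝ))) := by positivity
    have p2 : 0 ≤ 2 * lam ^ r * delta lam r ^ n := by positivity
    have p3 : 0 ≤ 2 * 4 ^ k * B * ((n : ℝ) ^ (2 * k) * delta lam r ^ n) := by positivity
    have sub : ∀ a b : ℝ, 1 < a → a < b → b ≤ 4 → t ∈ Icc a b →
        iteratedDerivWithin k f (Ioc 1 4) t = iteratedDerivWithin k f (Icc a b) t :=
      fun a b ha hab hb htab => (iteratedDerivWithin_eq_of_subset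
        (fun z (hz : z ∈ Icc a b) => (⟨ha.trans_le hz.1, hz.2.trans hb⟩ : z ∈ Ioc (1 : ℝ) 4))
        (uniqueDiffOn_Icc hab) hu
        (hcd.of_le (by exact_mod_cast le_top)) htab).symm
    rcases mem_three_pieces (lam := lam) (r := r) ht with h | h | h
    · rw [sub _ _ hy hw (by linarith [lt4 n hn]) h,
        iteratedDerivWithin_Icc_eq_of_eqOn hw contDiff_pieceY (hf.eq_affine n hn) k h,
        iteratedDeriv_pieceY hlam (by omega) k hk1]
      have : |(if k = 1 then delta lam r ^ (n + 1) * (2 * lam ^ r) else 0)| ≤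
          2 * lam ^ r * delta lam r ^ n := by
        split_ifs
        · rw [abs_of_pos (by positivity), pow_succ]
          have : 0 < lam ^ r * delta lam r ^ n := by positivity
          nlinarith
        · simpa using p2
      linarith
    · rw [sub _ _ (hy.trans hw) hwx (by linarith [lt4 n hn]) h,
        (hf.conn_rescale hlam hr hn).2 k hk1 t h, abs_mul, abs_of_pos (by
          have := height_pos hlam hr hn
          have := len_pos hlam hr hn
          positivity)]
      have b1 := hB n hn _ (conn_mem hlam hr hn h)
      have b2 : height lam r n ≤ 2 * delta lam r ^ n := by
        rw [height_eq]
        have := xPt_le hn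
        have hdn : 0 < delta lam r ^ n := by positivity
        have : delta lam r ^ n * xPt n ≤ delta lam r ^ n * 2 := by gcongr
        have : delta lam r ^ n * xPt n * (1 - delta lam r) ≤ delta lam r ^ n * xPt n * 1 := by
          apply mul_le_mul_of_nonneg_left <;> [linarith; positivity]
        linarith
      have b3 : (len lam r n)⁻¹ ≤ 4 * (n : ℝ) ^ 2 := by
        rw [inv_le_iff_one_le_mul₀ (len_pos hlam hr hn), len_eq hlam hn, xPt_sub_yPt hn]
        have : 4 * (n : ℝ) ^ 2 * (((n : ℝ) + 2) / (2 * n * (n + 1) ^ 2)) ≥ 3 / 2 := by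
          rw [ge_iff_le, ← sub_nonneg]
          have : 4 * (n : ℝ) ^ 2 * (((n : ℝ) + 2) / (2 * n * (n + 1) ^ 2)) - 3 / 2 =
              (4 * n * (n + 2) - 3 * (n + 1) ^ 2) / (2 * ((n : ℝ) + 1) ^ 2) := by
            field_simp
          rw [this]
          exact div_nonneg (by nlinarith) (by positivity)
        nlinarith
      have b4 : (len lam r n)⁻¹ ^ k ≤ 4 ^ k * (n : ℝ) ^ (2 * k) := by
        rw [pow_mul, ← mul_pow]
        exact pow_le_pow_left₀ (by have := len_pos hlam hr hn; positivity) b3 k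
      have : height lam r n * (len lam r n)⁻¹ ^ k *
          |iteratedDerivWithin k (φ n) (Icc 0 1) ((len lam r n)⁻¹ * (t - wPt lam r n))| ≤
          (2 * delta lam r ^ n) * (4 ^ k * (n : ℝ) ^ (2 * k)) * B := by
        have := len_pos hlam hr hn
        gcongr
      linarith
    · rw [sub _ _ hx hxy (lt4 n hn) h,
        (hf.osc_rescale hlam hn).2 k hk1 t h, abs_mul, abs_of_pos (by
          have := zoom_pos hlam hn
          have : 0 < yPt n - xPt n := by linarith
          positivity)]
      have b1 := hA n hn _ (zoom_mem hlam hn h)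
      have b2 : zoom lam n ≤ 2 * lam ^ n := by
        have := osc_mul_sq_le (lam := lam) hn
        rw [zoom, yPt_sub_xPt, div_div_eq_mul_div, div_one]
        linarith
      have b3 : zoom lam n ^ k ≤ 2 ^ k * (lam ^ n) ^ r := by
        calc zoom lam n ^ k ≤ (2 * lam ^ n) ^ k :=
              pow_le_pow_left₀ (zoom_pos hlam hn).le b2 k
          _ = 2 ^ k * (lam ^ n) ^ k := mul_pow _ _ _
          _ ≤ 2 ^ k * (lam ^ n) ^ r := by
              gcongr
              exact one_le_pow₀ (by linarith)
      have b4 : delta lam r ^ n * (lam ^ n) ^ r = 1 := by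
        rw [← pow_mul, mul_comm n r, pow_mul, ← mul_pow, delta_mul_pow hlam, one_pow]
      have hz := zoom_pos hlam hn
      have hyx : 0 < yPt n - xPt n := by linarith
      have : delta lam r ^ n * (yPt n - xPt n) * zoom lam n ^ k *
          |iteratedDerivWithin k (s n) (Icc 0 (osc lam n : ℝ)) (zoom lam n * (t - xPt n))| ≤
          delta lam r ^ n * (yPt n - xPt n) * (2 ^ k * (lam ^ n) ^ r) * A := by
        gcongr
      have e : delta lam r ^ n * (yPt n - xPt n) * (2 ^ k * (lam ^ n) ^ r) * A =
          A * 2 ^ k / 2 * ((1 / (n : ℝ)) * (1 / (n : ℝ))) := by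
        rw [yPt_sub_xPt]
        have : delta lam r ^ n * (1 / (2 * (n : ℝ) ^ 2)) * (2 ^ k * (lam ^ n) ^ r) * A =
          (delta lam r ^ n * (lam ^ n) ^ r) * (1 / (2 * (n : ℝ) ^ 2) * 2 ^ k * A) := by ring
        rw [this, b4]
        field_simp
      linarith

/-- A bound `e n → 0` on the intervals `[y_{n+1}, y_n]` gives a right-hand limit at `1`. -/
theorem tendsto_of_forall_bound {g : ℝ → ℝ} {e : ℕ → ℝ} (he : Tendsto e atTop (𝓝 0))
    (h : ∀ n, 1 ≤ n → ∀ t ∈ Icc (yPt (n + 1)) (yPt n), |g t| ≤ e n) :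
    Tendsto g (𝓝[>] 1) (𝓝 0) := by
  rw [Metric.tendsto_nhds]
  intro ε hε
  obtain ⟨N, hN⟩ := eventually_atTop.1 (he.eventually (gt_mem_nhds hε))
  have hy := yPt_gt (n := N + 1) (by omega)
  filter_upwards [Ioo_mem_nhdsGT hy] with t ht
  obtain ⟨n, hn, h1, h2⟩ := exists_yPt_le ht.1 (ht.2.trans_le (yPt_anti le_rfl (by omega)))
  have hNn : N ≤ n := by
    by_contra hc
    have := yPt_anti (m := n + 1) (n := N + 1) (by omega) (by omega)
    linarith [ht.2]
  rw [dist_zero_right, Real.norm_eq_abs]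
  exact (h n hn t ⟨h1, h2.le⟩).trans_lt (hN n hNn)

theorem IsConstructedMap.osc_mem (hf : IsConstructedMap lam r s φ f) (hlam : 14 ≤ lam) {n : ℕ}
    (hn : 1 ≤ n) {t : ℝ} (ht : t ∈ Icc (xPt n) (yPt n)) :
    f t ∈ Icc (delta lam r ^ n * yPt (n + 1)) (delta lam r ^ n * yPt n) := by
  have h := hf.oscFamily.mapsTo n hn (zoom_mem hlam hn ht)
  have hd0 := delta_pos (r := r) hlam
  have hyx : 0 < yPt n - xPt n := by linarith [xPt_lt_yPt hn]
  have hdn : 0 < delta lam r ^ n := by positivity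
  have hp : 0 < delta lam r ^ n * (yPt n - xPt n) := by positivity
  rw [hf.osc_eq hn ht, ← xPt_sub_mMin hn]
  constructor
  · have := mul_le_mul_of_nonneg_left h.1 hp.le
    linarith
  · have := mul_le_mul_of_nonneg_left h.2 hp.le
    linarith

theorem pieceY_wPt (hlam : 14 ≤ lam) {n : ℕ} (hn : 1 ≤ n) :
    pieceY lam r (n + 1) (wPt lam r n) = delta lam r ^ (n + 1) * xPt n := by
  have hM := osc_mul_slope (r := r) hlam (n := n + 1) (by omega)
  have hd : delta lam r * lam ^ r = 1 := delta_mul_pow hlam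
  rw [pieceY, mul_assoc (delta lam r ^ (n + 1)) (osc lam (n + 1) : ℝ), hM, wPt_sub_yPt hlam hn]
  linear_combination (delta lam r ^ (n + 1) * (xPt n - yPt (n + 1))) * hd

theorem IsConstructedMap.affine_mem (hf : IsConstructedMap lam r s φ f) (hlam : 14 ≤ lam) {n : ℕ}
    (hn : 1 ≤ n) {t : ℝ} (ht : t ∈ Icc (yPt (n + 1)) (wPt lam r n)) :
    f t ∈ Icc (delta lam r ^ (n + 1) * yPt (n + 1)) (delta lam r ^ (n + 1) * xPt n) := by
  have hd0 := delta_pos (r := r) hlam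
  have hM := osc_mul_slope (r := r) hlam (n := n + 1) (by omega)
  have hp : 0 < delta lam r ^ (n + 1) * (2 * lam ^ r) := by positivity
  rw [hf.eq_affine n hn t ht, ← pieceY_wPt hlam hn, pieceY, pieceY,
    mul_assoc (delta lam r ^ (n + 1)) (osc lam (n + 1) : ℝ), hM]
  constructor
  · have := mul_nonneg hp.le (sub_nonneg.2 ht.1)
    linarith
  · have := mul_le_mul_of_nonneg_left ht.2 hp.le
    linarith

theorem IsConstructedMap.conn_mem_Icc (hf : IsConstructedMap lam r s φ f) (hlam : 14 ≤ lam)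
    (hr : 1 ≤ r) {n : ℕ} (hn : 1 ≤ n) {t : ℝ} (ht : t ∈ Icc (wPt lam r n) (xPt n)) :
    f t ∈ Icc (delta lam r ^ (n + 1) * xPt n) (delta lam r ^ n * xPt n) := by
  have h := hf.connFamily.mapsTo n hn (conn_mem hlam hr hn ht)
  have hh := height_pos hlam hr hn
  have e : height lam r n = delta lam r ^ n * xPt n - delta lam r ^ (n + 1) * xPt n := rfl
  rw [hf.conn_eq hn ht]
  constructor
  · have := mul_le_mul_of_nonneg_left h.1 hh.le
    linarith
  · have := mul_le_mul_of_nonneg_left h.2 hh.le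
    linarith

/-- Up to the factor `δⁿ`, the image of `[y_{n+1}, y_n]` lies in `]0, 5/2]`, so the next `n` iterates of
its points are multiplications by `λ^r`. -/
theorem IsConstructedMap.small_mem (hf : IsConstructedMap lam r s φ f) (hlam : 14 ≤ lam)
    (hr : 1 ≤ r) {n : ℕ} (hn : 1 ≤ n) {t : ℝ} (ht : t ∈ Icc (yPt (n + 1)) (yPt n)) :
    0 < f t ∧ f t ≤ 5 / 2 * delta lam r ^ n := by
  have hd0 := delta_pos (r := r) hlam
  have hd := delta_le hlam hr
  have hdn : 0 < delta lam r ^ n := by positivity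
  have hdn1 : 0 < delta lam r ^ (n + 1) := by positivity
  have hy := yPt_gt (n := n + 1) (by omega)
  have hyn := yPt_le hn
  have hx := xPt_lt_yPt hn
  have hx1 := xPt_gt hn
  have q1 : 0 < delta lam r ^ (n + 1) * yPt (n + 1) := by positivity
  have q2 : 0 < delta lam r ^ n * yPt (n + 1) := by positivity
  have q3 : 0 < delta lam r ^ (n + 1) * xPt n := by positivity
  have q4 : delta lam r ^ n * yPt n ≤ delta lam r ^ n * (5 / 2) := by gcongr
  have q5 : delta lam r ^ n * xPt n ≤ delta lam r ^ n * (5 / 2) := by gcongr; linarith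
  have q6 : delta lam r ^ (n + 1) * xPt n ≤ delta lam r ^ n * xPt n := by
    have : delta lam r ^ (n + 1) ≤ delta lam r ^ n :=
      pow_le_pow_of_le_one hd0.le (by linarith) n.le_succ
    gcongr
  rcases mem_three_pieces (lam := lam) (r := r) ht with h | h | h
  · have := hf.affine_mem hlam hn h
    constructor <;> linarith [this.1, this.2]
  · have := hf.conn_mem_Icc hlam hr hn h
    constructor <;> linarith [this.1, this.2]
  · have := hf.osc_mem hlam hn h
    constructor <;> linarith [this.1, this.2]

theorem IsConstructedMap.map_one (hf : IsConstructedMap lam r s φ f) (hlam : 14 ≤ lam)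
    (hr : 1 ≤ r) : f 1 = 0 := by
  have hd0 := delta_pos (r := r) hlam
  rw [hf.eq_one 1 ⟨by linarith, le_rfl⟩, pieceOne, sub_self, zero_pow (by omega), mul_zero]

/-- On the right of `1` all derivatives of order at most `r` tend to `0`, on the left those of order
less than `2r` vanish, so the two sides join. -/
theorem IsConstructedMap.contDiffOn (hf : IsConstructedMap lam r s φ f) (hlam : 14 ≤ lam)
    (hr : 1 ≤ r) : ContDiffOn ℝ r f (Icc 0 4) := by
  have hd0 := delta_pos (r := r) hlam
  have hd := delta_le hlam hr
  have hle : ((r : ℕ∞) : ℕ∞ω) ≤ ∞ := by exact_mod_cast le_top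
  have h2 := contDiffOn_Icc_of_tendsto (N := (r : ℕ∞)) (by norm_num : (1 : ℝ) < 4)
    ((hf.contDiffOn_Ioc hlam hr).of_le hle) (hf.map_one hlam hr) (fun k hk => by
      have hk' : k ≤ r := by exact_mod_cast hk
      rcases Nat.eq_zero_or_pos k with rfl | hk1
      · rw [iteratedDerivWithin_zero]
        refine tendsto_of_forall_bound (e := fun n => 5 / 2 * delta lam r ^ n) ?_ ?_
        · have h2 : Tendsto (fun n : ℕ => delta lam r ^ n) atTop (𝓝 0) :=
            tendsto_pow_atTop_nhds_zero_of_lt_one hd0.le (by linarith)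
          simpa using h2.const_mul (5 / 2)
        · intro n hn t ht
          have := hf.small_mem hlam hr hn ht
          rw [abs_of_pos this.1]
          exact this.2
      · obtain ⟨e, he, hb⟩ := hf.exists_iteratedDeriv_bound hlam hr hk1 hk'
        exact tendsto_of_forall_bound he hb)
  have := contDiffOn_Icc_glue (N := (r : ℕ∞)) one_pos (by norm_num : (1 : ℝ) < 4)
    ((hf.contDiffOn_left hlam hr).of_le hle) h2.1 (fun k hk => by
      have hk' : k ≤ r := by exact_mod_cast hk
      rw [h2.2 k hk, iteratedDerivWithin_right_of_eqOn (c := 1 - delta lam r) (by linarith)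
        (by linarith) (hf.contDiffOn_left hlam hr) contDiff_pieceOne hf.eq_one,
        iteratedDeriv_pieceOne (by omega)])
  exact_mod_cast this

theorem deriv_pieceZero (t : ℝ) : deriv (pieceZero lam r) t = lam ^ r := by
  have e : pieceZero lam r = fun t => lam ^ r * t := rfl
  rw [e]
  simp

theorem deriv_pieceFour (t : ℝ) : deriv (pieceFour lam r) t = lam ^ r := by
  have e : pieceFour lam r = fun t => 4 + lam ^ r * (t - 4) := rfl
  rw [e]
  simp

theorem deriv_pieceHalf (t : ℝ) :
    deriv (pieceHalf lam r) t = 3 * lam ^ r * (1 / 2 - t) := by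
  have h := ((((hasDerivAt_id t).sub_const (1 / 2)).fun_pow 2).const_mul
    (3 / 2 * (delta lam r)⁻¹)).const_sub 4
  have e : pieceHalf lam r = fun t => 4 - 3 / 2 * (delta lam r)⁻¹ * (id t - 1 / 2) ^ 2 := rfl
  rw [e, h.deriv, delta, inv_inv]
  simp
  ring

theorem deriv_pieceOne_eq (hlam : 14 ≤ lam) (t : ℝ) :
    deriv (pieceOne lam r) t = -(2 * r * ((1 - t) / delta lam r) ^ (2 * r - 1)) := by
  have hd0 := delta_pos (r := r) hlam
  have e : pieceOne lam r = fun t => delta lam r * ((1 - t) / delta lam r) ^ (2 * r) :=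
    funext fun t => pieceOne_eq hlam t
  have h := ((((hasDerivAt_id t).const_sub 1).div_const (delta lam r)).fun_pow
    (2 * r)).const_mul (delta lam r)
  simp only [id_eq] at h
  rw [e, h.deriv]
  push_cast
  field_simp

theorem abs_deriv_pieceOne_le (hlam : 14 ≤ lam) (hr : 1 ≤ r) {t : ℝ}
    (ht : t ∈ Icc (1 - delta lam r) 1) : |deriv (pieceOne lam r) t| ≤ 2 * r := by
  have hd0 := delta_pos (r := r) hlam
  have h0 : 0 ≤ (1 - t) / delta lam r := div_nonneg (by linarith [ht.2]) hd0.le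
  have h1 : (1 - t) / delta lam r ≤ 1 := by rw [div_le_one hd0]; linarith [ht.1]
  have h2 : ((1 - t) / delta lam r) ^ (2 * r - 1) ≤ 1 := pow_le_one₀ h0 h1
  have h3 : 0 ≤ ((1 - t) / delta lam r) ^ (2 * r - 1) := pow_nonneg h0 _
  rw [deriv_pieceOne_eq hlam, abs_neg, abs_of_nonneg (by positivity)]
  have : (0 : ℝ) ≤ 2 * r := by positivity
  nlinarith

theorem two_mul_le_pow (hlam : 14 ≤ lam) (r : ℕ) : 2 * (r : ℝ) ≤ lam ^ r := by
  have h1 : (1 : ℝ) + r * 13 ≤ (1 + 13) ^ r := one_add_mul_le_pow (by norm_num) r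
  have h2 : ((1 : ℝ) + 13) ^ r ≤ lam ^ r := pow_le_pow_left₀ (by norm_num) (by linarith) r
  have h3 : (0 : ℝ) ≤ r := by positivity
  linarith

theorem IsConstructedMap.abs_derivWithin_le (hf : IsConstructedMap lam r s φ f) (hlam : 14 ≤ lam)
    (hr : 1 ≤ r) {t : ℝ} (ht : t ∈ Icc (0 : ℝ) 4) : |derivWithin f (Icc 0 4) t| ≤ lam ^ r := by
  obtain ⟨h1, h2, h3, h4, h5, h6, h7⟩ := joints_lt hlam hr
  have hd0 := delta_pos (r := r) hlam
  have hL := pow_ge hlam hr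
  have hdL := delta_mul_pow (r := r) hlam
  have hdiff : DifferentiableOn ℝ f (Icc 0 4) :=
    (hf.contDiffOn hlam hr).differentiableOn (by exact_mod_cast (by omega : r ≠ 0))
  have sub : ∀ a b : ℝ, 0 ≤ a → a < b → b ≤ 4 → t ∈ Icc a b →
      derivWithin f (Icc 0 4) t = derivWithin f (Icc a b) t := fun a b ha hab hb htab =>
    (derivWithin_subset (Icc_subset_Icc ha hb) (uniqueDiffOn_Icc hab t htab) (hdiff t ht)).symm
  have sub' : ∀ (a b : ℝ) (g : ℝ → ℝ), 0 ≤ a → a < b → b ≤ 4 → t ∈ Icc a b → ContDiff ℝ ∞ g →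
      EqOn f g (Icc a b) → derivWithin f (Icc 0 4) t = deriv g t :=
    fun a b g ha hab hb htab hg hfg => by
      rw [sub a b ha hab hb htab, ← iteratedDerivWithin_one,
        iteratedDerivWithin_Icc_eq_of_eqOn hab hg hfg 1 htab, iteratedDeriv_one]
  rcases le_total t 1 with ht1 | ht1
  · rcases le_total t (5 / 2 * delta lam r) with c1 | c1
    · rw [sub' 0 (5 / 2 * delta lam r) _ le_rfl h1 (by linarith) ⟨ht.1, c1⟩ contDiff_pieceZero
        hf.eq_zero]
      rw [deriv_pieceZero, abs_of_pos (by linarith)]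
    rcases le_total t (1 / 2 - delta lam r) with c2 | c2
    · rw [sub _ _ h1.le h2 (by linarith) ⟨c1, c2⟩]
      have := hf.slope_left t ⟨c1, c2⟩
      rw [abs_of_pos (by linarith [this.1])]
      exact this.2
    rcases le_total t (1 / 2 + delta lam r) with c3 | c3
    · rw [sub' _ _ _ (by linarith) h3 (by linarith) ⟨c2, c3⟩ contDiff_pieceHalf hf.eq_half]
      rw [deriv_pieceHalf, abs_mul, abs_of_pos (by positivity)]
      have : |1 / 2 - t| ≤ delta lam r := abs_le.2 ⟨by linarith, by linarith⟩
      calc 3 * lam ^ r * |1 / 2 - t| ≤ 3 * lam ^ r * delta lam r := by gcongr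
        _ = 3 := by linarith
        _ ≤ lam ^ r := by linarith
    rcases le_total t (1 - delta lam r) with c4 | c4
    · rw [sub _ _ (by linarith) h4 (by linarith) ⟨c3, c4⟩]
      have := hf.slope_mid t ⟨c3, c4⟩
      rw [abs_of_neg (by linarith [this.2])]
      linarith [this.1]
    · rw [sub' _ _ _ (by linarith) h5 (by linarith) ⟨c4, ht1⟩ contDiff_pieceOne hf.eq_one]
      exact (abs_deriv_pieceOne_le hlam hr ⟨c4, ht1⟩).trans (two_mul_le_pow hlam r)
  rcases ht1.eq_or_lt with rfl | ht1
  · rw [sub' _ _ _ (by linarith) h5 (by linarith) ⟨h5.le, le_rfl⟩ contDiff_pieceOne hf.eq_one]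
    exact (abs_deriv_pieceOne_le hlam hr ⟨h5.le, le_rfl⟩).trans (two_mul_le_pow hlam r)
  rcases lt_or_ge t (yPt 1) with hty | hty
  · obtain ⟨n, hn, hn1, hn2⟩ := exists_yPt_le ht1 hty
    have hdn : 0 < delta lam r ^ n := by positivity
    have hx := xPt_gt hn
    have hy := yPt_gt (n := n + 1) (by omega)
    have hw := yPt_lt_wPt (r := r) hlam hn
    have hwx := wPt_lt_xPt hlam hr hn
    have hxy := xPt_lt_yPt hn
    have hy4 := yPt_le hn
    rcases mem_three_pieces (lam := lam) (r := r) ⟨hn1, hn2.le⟩ with h | h | h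
    · rw [sub' _ _ _ (by linarith) hw (by linarith) h contDiff_pieceY (hf.eq_affine n hn),
        ← iteratedDeriv_one, iteratedDeriv_pieceY hlam (by omega) 1 le_rfl, if_pos rfl,
        abs_of_pos (by positivity), pow_succ]
      have e : delta lam r ^ n * delta lam r * (2 * lam ^ r) =
        2 * delta lam r ^ n * (delta lam r * lam ^ r) := by ring
      have : delta lam r ^ n ≤ 1 := pow_le_one₀ hd0.le (by linarith [delta_le hlam hr])
      rw [e, hdL]
      linarith
    · rw [sub _ _ (by linarith) hwx (by linarith) h, ← iteratedDerivWithin_one,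
        (hf.conn_rescale hlam hr hn).2 1 le_rfl t h, iteratedDerivWithin_one, pow_one]
      have m := conn_mem hlam hr hn h
      have b1 := hf.connFamily.deriv_le n hn _ m
      have b2 := hf.connFamily.le_deriv n hn _ m
      rw [hf.connFamily.deriv_zero n hn] at b2
      have b3 := (conn_slope_bounds hlam hr hn).1
      have hl := len_pos hlam hr hn
      have hh := height_pos hlam hr hn
      have b4 : height lam r n * (len lam r n)⁻¹ ≤ 1 := by
        rw [← div_eq_mul_inv, div_le_one hl]
        exact height_le_len hlam hr hn
      have b5 : 0 < derivWithin (φ n) (Icc 0 1) ((len lam r n)⁻¹ * (t - wPt lam r n)) := by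
        linarith
      rw [abs_of_pos (by positivity)]
      calc _ ≤ 1 * derivWithin (φ n) (Icc 0 1) ((len lam r n)⁻¹ * (t - wPt lam r n)) := by gcongr
        _ ≤ lam ^ r := by linarith
    · rw [sub _ _ (by linarith) hxy (by linarith) h, ← iteratedDerivWithin_one,
        (hf.osc_rescale hlam hn).2 1 le_rfl t h, iteratedDerivWithin_one, pow_one, mul_assoc
        (delta lam r ^ n), mul_comm (yPt n - xPt n), zoom_mul hn]
      have m := zoom_mem hlam hn h
      have b1 := hf.oscFamily.deriv_le n hn _ m
      have hM := osc_ge hlam hn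
      have b2 : delta lam r ^ n * (osc lam n : ℝ) ≤ 1 := by
        have g1 : (1 : ℝ) ≤ n := by exact_mod_cast hn
        have g2 := osc_mul_sq_le (lam := lam) hn
        have g3 : (osc lam n : ℝ) ≤ lam ^ n := by
            refine le_trans ?_ g2
            exact le_mul_of_one_le_right (by linarith) (one_le_pow₀ g1)
        have g4 := delta_pow_le hlam hr n
        have : 0 < lam ^ n := by positivity
        calc delta lam r ^ n * (osc lam n : ℝ) ≤ (lam ^ n)⁻¹ * lam ^ n := by gcongr
          _ = 1 := by field_simp
      rw [abs_mul, abs_of_pos (by positivity)]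
      calc _ ≤ 1 * |derivWithin (s n) (Icc 0 (osc lam n : ℝ)) (zoom lam n * (t - xPt n))| := by
            gcongr
        _ ≤ lam ^ r := by linarith
  rcases le_total t (4 - 3 / 2 * delta lam r) with c6 | c6
  · rw [sub _ _ (by linarith [yPt_one]) h6 (by linarith) ⟨hty, c6⟩]
    have := hf.slope_right t ⟨hty, c6⟩
    rw [abs_of_pos (by linarith [this.1])]
    exact this.2
  · rw [sub' _ _ _ (by linarith [yPt_one]) h7 le_rfl ⟨c6, ht.2⟩ contDiff_pieceFour hf.eq_four]
    rw [deriv_pieceFour, abs_of_pos (by linarith)]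

/-- The bound `λ^r` is attained at the fixed point `0`. -/
theorem IsConstructedMap.isLUB_derivWithin (hf : IsConstructedMap lam r s φ f) (hlam : 14 ≤ lam)
    (hr : 1 ≤ r) : IsLUB ((fun t => |derivWithin f (Icc 0 4) t|) '' Icc 0 4) (lam ^ r) := by
  obtain ⟨h1, h2, -⟩ := joints_lt hlam hr
  have hd0 := delta_pos (r := r) hlam
  have hL := pow_ge hlam hr
  have h0 : (0 : ℝ) ∈ Icc (0 : ℝ) 4 := ⟨le_rfl, by norm_num⟩
  have hdiff : DifferentiableOn ℝ f (Icc 0 4) :=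
    (hf.contDiffOn hlam hr).differentiableOn (by exact_mod_cast (by omega : r ≠ 0))
  refine IsGreatest.isLUB ⟨⟨0, h0, ?_⟩, ?_⟩
  · have e : derivWithin f (Icc 0 4) 0 = lam ^ r := by
      rw [← derivWithin_subset (Icc_subset_Icc_right (by linarith : 5 / 2 * delta lam r ≤ 4))
        (uniqueDiffOn_Icc h1 0 ⟨le_rfl, h1.le⟩) (hdiff 0 h0), ← iteratedDerivWithin_one,
        iteratedDerivWithin_Icc_eq_of_eqOn h1 contDiff_pieceZero hf.eq_zero 1 ⟨le_rfl, h1.le⟩,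
        iteratedDeriv_one, deriv_pieceZero]
    simp only [e]
    exact abs_of_pos (by linarith)
  · rintro _ ⟨t, ht, rfl⟩
    exact hf.abs_derivWithin_le hlam hr ht

end Map

/-! ### Expansion, invariance of `[0, 4]` and iterates near `1` -/

/-- On `[a, b]` the function `g` increases at least at rate `c`. -/
def ExpandsOn (c : ℝ) (g : ℝ → ℝ) (a b : ℝ) : Prop :=
  ∀ p q, a ≤ p → p ≤ q → q ≤ b → c * (q - p) ≤ g q - g p

theorem ExpandsOn.union {c : ℝ} {g : ℝ → ℝ} {a b d : ℝ} (h₁ : ExpandsOn c g a b)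
    (h₂ : ExpandsOn c g b d) : ExpandsOn c g a d := by
  intro p q hp hpq hq
  rcases le_total q b with h | h
  · exact h₁ p q hp hpq h
  rcases le_total b p with h' | h'
  · exact h₂ p q h' hpq hq
  have a1 := h₁ p b hp h' le_rfl
  have a2 := h₂ b q le_rfl h hq
  linarith

/-- If `g` expands on the core `[a, b]`, and increases at the same average rate between the core and
each point of the margins, then it increases at that rate between any two points that are not in the
same margin. -/
theorem ExpandsOn.le_of_margins {c : ℝ} {g : ℝ → ℝ} {a b p q : ℝ} (h : ExpandsOn c g a b)
    (hab : a ≤ b) (hl : p ≤ a → c * (a - p) ≤ g a - g p) (hr : b ≤ q → c * (q - b) ≤ g q - g b)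
    (hpq : p ≤ q) (hqa : a ≤ q) (hpb : p ≤ b) : c * (q - p) ≤ g q - g p := by
  rcases le_total p a with h1 | h1 <;> rcases le_total b q with h2 | h2
  · linarith [hl h1, hr h2, h a b le_rfl hab le_rfl]
  · linarith [hl h1, h a q le_rfl hqa h2]
  · linarith [hr h2, h p b h1 hpb le_rfl]
  · exact h p q h1 hpq h2

/-- Near a fixed point `c` with one-sided affine expansion by `κ`, a nearby segment is stretched
affinely until it leaves the linear zone of size `E`. -/
theorem exists_escape {T : ℝ → ℝ} {c σ κ E b : ℝ} (hκ : 1 < κ) (hb : 0 < b)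
    (hT : ∀ v, 0 ≤ v → v ≤ E → T (c + σ * v) = c + σ * (κ * v)) :
    ∃ i : ℕ, E < κ ^ i * b ∧ ∀ v, 0 ≤ v → v ≤ b → T^[i] (c + σ * v) = c + σ * (κ ^ i * v) := by
  classical
  have hex : ∃ i : ℕ, E < κ ^ i * b := by
    obtain ⟨i, hi⟩ := pow_unbounded_of_one_lt (E / b) hκ
    exact ⟨i, (div_lt_iff₀ hb).1 hi⟩
  have key : ∀ i ≤ Nat.find hex, ∀ v, 0 ≤ v → v ≤ b →
      T^[i] (c + σ * v) = c + σ * (κ ^ i * v) := by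
    intro i
    induction i with
    | zero => intro _ v _ _; simp
    | succ i ih =>
      intro hi v hv hvb
      have h1 : κ ^ i * b ≤ E := not_lt.1 (Nat.find_min hex (by omega))
      have h2 : κ ^ i * v ≤ κ ^ i * b := by gcongr
      rw [Function.iterate_succ_apply', ih (by omega) v hv hvb,
        hT _ (by positivity) (h2.trans h1), pow_succ]
      ring
  exact ⟨Nat.find hex, Nat.find_spec hex, key _ le_rfl⟩

/-- Some iterate of `f` maps `A` over the whole of `[0, 4]`. -/
def Covers (f : ℝ → ℝ) (A : Set ℝ) : Prop := ∃ k : ℕ, Icc 0 4 ⊆ f^[k] '' A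

theorem Covers.mono {f : ℝ → ℝ} {A B : Set ℝ} (h : Covers f A) (hAB : A ⊆ B) : Covers f B := by
  obtain ⟨k, hk⟩ := h
  exact ⟨k, hk.trans (image_mono hAB)⟩

theorem Covers.of_iterate {f : ℝ → ℝ} {A : Set ℝ} {m : ℕ} (h : Covers f (f^[m] '' A)) :
    Covers f A := by
  obtain ⟨k, hk⟩ := h
  refine ⟨k + m, ?_⟩
  rwa [Function.iterate_add, image_comp]

theorem continuousOn_iterate {f : ℝ → ℝ} {A : Set ℝ} (hf : ContinuousOn f A) (hm : MapsTo f A A)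
    (k : ℕ) : ContinuousOn f^[k] A := by
  induction k with
  | zero => exact continuousOn_id
  | succ k ih =>
    rw [Function.iterate_succ]
    exact ih.comp hf hm

/-- To cover `[0, 4]` from a segment it suffices to do so from the segment joining the images of its
end points. -/
theorem Covers.of_uIcc {f : ℝ → ℝ} (hf : ContinuousOn f (Icc 0 4))
    (hm : MapsTo f (Icc 0 4) (Icc 0 4)) {p q : ℝ} (hp : p ∈ Icc (0 : ℝ) 4) (hq : q ∈ Icc (0 : ℝ) 4)
    (m : ℕ) (h : Covers f (uIcc (f^[m] p) (f^[m] q))) : Covers f (uIcc p q) := by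
  refine Covers.of_iterate (m := m) (h.mono ?_)
  exact intermediate_value_uIcc ((continuousOn_iterate hf hm m).mono (uIcc_subset_Icc hp hq))

/-- Let `c` be a fixed point of `f^m`. If for each `z` on one side of `c` either `[c, z]` already
covers, or `f^m z` is on the same side and further away by the factor `κ > 1`, then every
nondegenerate `[c, z]` on this side covers. -/
theorem covers_of_expanding {f : ℝ → ℝ} (hf : ContinuousOn f (Icc 0 4))
    (hm : MapsTo f (Icc 0 4) (Icc 0 4)) {c κ σ : ℝ} (hκ : 1 < κ) (hc : c ∈ Icc (0 : ℝ) 4) (m : ℕ)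
    (hfix : f^[m] c = c) (h : ∀ z ∈ Icc (0 : ℝ) 4, 0 < σ * (z - c) → Covers f (uIcc c z) ∨
      κ * (σ * (z - c)) ≤ σ * (f^[m] z - c))
    {z : ℝ} (hz : z ∈ Icc (0 : ℝ) 4) (hzc : 0 < σ * (z - c)) : Covers f (uIcc c z) := by
  have key : ∀ i : ℕ, ∀ z ∈ Icc (0 : ℝ) 4, 4 * |σ| < κ ^ i * (σ * (z - c)) →
      Covers f (uIcc c z) := by
    intro i
    induction i with
    | zero =>
      intro z hz h'
      have h1 : |z - c| ≤ 4 := abs_le.2 ⟨by linarith [hz.1, hc.2], by linarith [hz.2, hc.1]⟩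
      have h2 : σ * (z - c) ≤ |σ| * |z - c| := by rw [← abs_mul]; exact le_abs_self _
      have h3 : |σ| * |z - c| ≤ |σ| * 4 := by gcongr
      rw [pow_zero, one_mul] at h'
      linarith
    | succ i ih =>
      intro z hz h'
      have hpos : 0 < σ * (z - c) := by
        have : 0 < κ ^ (i + 1) * (σ * (z - c)) := lt_of_le_of_lt (by positivity) h'
        exact (mul_pos_iff_of_pos_left (by positivity)).1 this
      rcases h z hz hpos with h1 | h1
      · exact h1
      · refine Covers.of_uIcc hf hm hc hz m ?_
        rw [hfix]
        refine ih _ (hm.iterate m hz) (h'.trans_le ?_)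
        rw [pow_succ, mul_assoc]
        gcongr
  obtain ⟨i, hi⟩ := pow_unbounded_of_one_lt (4 * |σ| / (σ * (z - c))) hκ
  exact key i z hz ((div_lt_iff₀ hzc).1 hi)

section Map

variable {lam : ℝ} {r : ℕ} {s φ : ℕ → ℝ → ℝ} {f : ℝ → ℝ}

theorem IsConstructedMap.continuousOn (hf : IsConstructedMap lam r s φ f) (hlam : 14 ≤ lam)
    (hr : 1 ≤ r) : ContinuousOn f (Icc 0 4) := (hf.contDiffOn hlam hr).continuousOn

theorem IsConstructedMap.expandsOn_left (hf : IsConstructedMap lam r s φ f) (hlam : 14 ≤ lam)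
    (hr : 1 ≤ r) : ExpandsOn (3 / 2) f 0 (1 / 2 - delta lam r) := by
  obtain ⟨h1, h2, -⟩ := joints_lt hlam hr
  have hL := pow_ge hlam hr
  refine ExpandsOn.union (b := 5 / 2 * delta lam r) ?_ ?_
  · intro p q hp hpq hq
    rw [hf.eq_zero p ⟨hp, hpq.trans hq⟩, hf.eq_zero q ⟨hp.trans hpq, hq⟩, pieceZero, pieceZero,
      ← mul_sub]
    exact mul_le_mul_of_nonneg_right (by linarith) (by linarith)
  · intro p q hp hpq hq
    exact mul_sub_le_of_le_derivWithin
      (hf.join_left.smooth.differentiableOn (by simp))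
      (fun t ht => (hf.slope_left t ⟨ht.1.le, ht.2.le⟩).1) hp hpq hq

theorem IsConstructedMap.expandsOn_mid (hf : IsConstructedMap lam r s φ f) :
    ExpandsOn (3 / 2) (fun t => -f t) (1 / 2 + delta lam r) (1 - delta lam r) := by
  intro p q hp hpq hq
  refine mul_sub_le_of_le_derivWithin
    (hf.join_mid.smooth.differentiableOn (by simp)).fun_neg (fun t ht => ?_) hp hpq hq
  rw [derivWithin.fun_neg]
  have := (hf.slope_mid t ⟨ht.1.le, ht.2.le⟩).2
  linarith

theorem IsConstructedMap.expandsOn_right (hf : IsConstructedMap lam r s φ f) (hlam : 14 ≤ lam)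
    (hr : 1 ≤ r) : ExpandsOn (3 / 2) f (yPt 1) 4 := by
  obtain ⟨-, -, -, -, -, h6, h7⟩ := joints_lt hlam hr
  have hL := pow_ge hlam hr
  refine ExpandsOn.union (b := 4 - 3 / 2 * delta lam r) ?_ ?_
  · intro p q hp hpq hq
    exact mul_sub_le_of_le_derivWithin
      (hf.join_right.smooth.differentiableOn (by simp))
      (fun t ht => (hf.slope_right t ⟨ht.1.le, ht.2.le⟩).1) hp hpq hq
  · intro p q hp hpq hq
    rw [hf.eq_four p ⟨hp, hpq.trans hq⟩, hf.eq_four q ⟨hp.trans hpq, hq⟩, pieceFour, pieceFour]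
    have : 0 ≤ (lam ^ r - 3 / 2) * (q - p) := mul_nonneg (by linarith) (by linarith)
    linarith

/-- The slope `4/3 δⁿ` comes from `φ_n' ≥ (2/3) φ_n'(0)`; on the affine piece the slope is `2 δⁿ`.
-/
theorem IsConstructedMap.expandsOn_conn (hf : IsConstructedMap lam r s φ f) (hlam : 14 ≤ lam)
    (hr : 1 ≤ r) {n : ℕ} (hn : 1 ≤ n) :
    ExpandsOn (4 / 3 * delta lam r ^ n) f (yPt (n + 1)) (xPt n) := by
  have hd0 := delta_pos (r := r) hlam
  have hdL := delta_mul_pow (r := r) hlam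
  have hdn : 0 < delta lam r ^ n := by positivity
  refine ExpandsOn.union (b := wPt lam r n) ?_ ?_
  · intro p q hp hpq hq
    rw [hf.eq_affine n hn p ⟨hp, hpq.trans hq⟩, hf.eq_affine n hn q ⟨hp.trans hpq, hq⟩, pieceY,
      pieceY, mul_assoc (delta lam r ^ (n + 1)) (osc lam (n + 1) : ℝ),
      osc_mul_slope hlam (by omega), pow_succ]
    have e : delta lam r ^ n * delta lam r * (2 * lam ^ r) = 2 * delta lam r ^ n := by
      linear_combination 2 * delta lam r ^ n * hdL
    rw [e]
    have : 0 ≤ delta lam r ^ n * (q - p) := mul_nonneg hdn.le (by linarith)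
    linarith
  · intro p q hp hpq hq
    refine mul_sub_le_of_le_derivWithin
      ((hf.conn_rescale hlam hr hn).1.differentiableOn (by simp)) (fun t ht => ?_) hp hpq hq
    have ht' : t ∈ Icc (wPt lam r n) (xPt n) := ⟨ht.1.le, ht.2.le⟩
    have h := hf.connFamily.le_deriv n hn _ (conn_mem hlam hr hn ht')
    rw [hf.connFamily.deriv_zero n hn] at h
    rw [← iteratedDerivWithin_one, (hf.conn_rescale hlam hr hn).2 1 le_rfl t ht',
      iteratedDerivWithin_one, pow_one]
    have hl := len_pos hlam hr hn
    have hh := height_pos hlam hr hn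
    have hp : 0 < height lam r n * (len lam r n)⁻¹ := by positivity
    refine le_trans (le_of_eq ?_) (mul_le_mul_of_nonneg_left h hp.le)
    field_simp
    norm_num

theorem IsConstructedMap.map_half (hf : IsConstructedMap lam r s φ f) (hlam : 14 ≤ lam)
    {t : ℝ} (ht : |t - 1 / 2| ≤ delta lam r) :
    f t = 4 - 3 / 2 * lam ^ r * |t - 1 / 2| ^ 2 := by
  have h := abs_le.1 ht
  have hdL := delta_mul_pow (r := r) hlam
  have hd0 := delta_pos (r := r) hlam
  rw [hf.eq_half t ⟨by linarith [h.1], by linarith [h.2]⟩, pieceHalf, sq_abs,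
    eq_inv_of_mul_eq_one_left hdL, inv_inv]

theorem IsConstructedMap.map_near_one (hf : IsConstructedMap lam r s φ f) (hlam : 14 ≤ lam)
    {u : ℝ} (h0 : 0 ≤ u) (hu : u ≤ delta lam r) :
    f (1 - u) = delta lam r * (u / delta lam r) ^ (2 * r) := by
  rw [hf.eq_one (1 - u) ⟨by linarith, by linarith⟩, pieceOne_eq hlam, sub_sub_cancel]

theorem IsConstructedMap.map_yPt_one (hf : IsConstructedMap lam r s φ f) (hlam : 14 ≤ lam)
    (hr : 1 ≤ r) : f (yPt 1) = 5 / 2 * delta lam r := by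
  have h := div_pos (delta_pos (r := r) hlam) (zoom_pos (n := 1) hlam le_rfl)
  rw [hf.eqOn_pieceY_left hlam hr le_rfl ⟨by linarith, le_rfl⟩, pieceY, yPt_one]
  ring

theorem IsConstructedMap.mapsTo (hf : IsConstructedMap lam r s φ f) (hlam : 14 ≤ lam)
    (hr : 1 ≤ r) : MapsTo f (Icc 0 4) (Icc 0 4) := by
  obtain ⟨h1, h2, h3, h4, h5, h6, h7⟩ := joints_lt hlam hr
  have hd0 := delta_pos (r := r) hlam
  have hd := delta_le hlam hr
  have hL := pow_ge hlam hr
  have hdL := delta_mul_pow (r := r) hlam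
  have hsq : lam ^ r * delta lam r ^ 2 = delta lam r := by linear_combination delta lam r * hdL
  intro t ht
  have half : |t - 1 / 2| ≤ delta lam r → f t ∈ Icc (0 : ℝ) 4 := fun h => by
    rw [hf.map_half hlam h]
    have : lam ^ r * |t - 1 / 2| ^ 2 ≤ lam ^ r * delta lam r ^ 2 := by gcongr
    have : 0 ≤ lam ^ r * |t - 1 / 2| ^ 2 := by positivity
    constructor <;> linarith
  rcases le_total t 1 with ht1 | ht1
  · rcases le_total t (1 / 2 - delta lam r) with c1 | c1
    · have a1 := hf.expandsOn_left hlam hr 0 t le_rfl ht.1 c1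
      have a2 := hf.expandsOn_left hlam hr t _ ht.1 c1 le_rfl
      rw [hf.eq_zero 0 ⟨le_rfl, h1.le⟩, pieceZero] at a1
      rw [hf.map_half hlam (by rw [abs_le]; constructor <;> linarith)] at a2
      have : 0 ≤ lam ^ r * |1 / 2 - delta lam r - 1 / 2| ^ 2 := by positivity
      constructor <;> linarith [ht.1]
    rcases le_total t (1 / 2 + delta lam r) with c3 | c3
    · exact half (by rw [abs_le]; constructor <;> linarith)
    have one : ∀ t, 1 - delta lam r ≤ t → t ≤ 1 → f t ∈ Icc 0 (delta lam r) := fun t c4 ht1 => by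
      have := hf.map_near_one hlam (u := 1 - t) (by linarith) (by linarith)
      rw [sub_sub_cancel] at this
      rw [this]
      have b0 : 0 ≤ (1 - t) / delta lam r := div_nonneg (by linarith) hd0.le
      have b1 : (1 - t) / delta lam r ≤ 1 := by rw [div_le_one hd0]; linarith
      have b2 : ((1 - t) / delta lam r) ^ (2 * r) ≤ 1 := pow_le_one₀ b0 b1
      refine ⟨by positivity, ?_⟩
      nlinarith
    rcases le_total t (1 - delta lam r) with c4 | c4
    · have a1 := hf.expandsOn_mid _ t le_rfl c3 c4
      have a2 := hf.expandsOn_mid t _ c3 c4 le_rfl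
      simp only at a1 a2
      rw [hf.map_half hlam (t := 1 / 2 + delta lam r)
        (by rw [abs_le]; constructor <;> linarith)] at a1
      have := (one (1 - delta lam r) le_rfl h5.le).1
      have : 0 ≤ lam ^ r * |1 / 2 + delta lam r - 1 / 2| ^ 2 := by positivity
      constructor <;> linarith
    · have := one t c4 ht1
      exact ⟨this.1, by linarith [this.2]⟩
  rcases ht1.eq_or_lt with rfl | ht1
  · rw [hf.map_one hlam hr]
    norm_num
  rcases lt_or_ge t (yPt 1) with hty | hty
  · obtain ⟨n, hn, hn1, hn2⟩ := exists_yPt_le ht1 hty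
    have h := hf.small_mem hlam hr hn ⟨hn1, hn2.le⟩
    have : delta lam r ^ n ≤ 1 := pow_le_one₀ hd0.le (by linarith)
    exact ⟨h.1.le, by linarith [h.2]⟩
  · have a1 := hf.expandsOn_right hlam hr (yPt 1) t le_rfl hty ht.2
    have a2 := hf.expandsOn_right hlam hr t 4 hty ht.2 le_rfl
    rw [hf.map_yPt_one hlam hr] at a1
    rw [hf.eq_four 4 ⟨h7.le, le_rfl⟩, pieceFour] at a2
    constructor <;> linarith [ht.2]

theorem IsConstructedMap.iterate_near_zero (hf : IsConstructedMap lam r s φ f) (hlam : 14 ≤ lam)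
    (n : ℕ) {t : ℝ} (h0 : 0 ≤ t) (ht : t ≤ 5 / 2 * delta lam r ^ n) :
    f^[n] t = (lam ^ r) ^ n * t := by
  have hdL := delta_mul_pow (r := r) hlam
  have hd0 := delta_pos (r := r) hlam
  induction n generalizing t with
  | zero => simp
  | succ n ih =>
    have hdn : delta lam r ^ (n + 1) ≤ delta lam r := by
      rw [pow_succ]
      have : delta lam r ≤ 1 := by
        rw [delta]
        exact inv_le_one_of_one_le₀ (one_le_pow₀ (by linarith))
      have : delta lam r ^ n ≤ 1 := pow_le_one₀ hd0.le this
      nlinarith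
    have hL : 0 < lam ^ r := by positivity
    rw [Function.iterate_succ_apply, hf.eq_zero t ⟨h0, ht.trans (by linarith)⟩, pieceZero, ih,
      pow_succ]
    · ring
    · positivity
    · have := mul_le_mul_of_nonneg_left ht hL.le
      have e : lam ^ r * (5 / 2 * delta lam r ^ (n + 1)) = 5 / 2 * delta lam r ^ n := by
        rw [pow_succ]
        linear_combination 5 / 2 * delta lam r ^ n * hdL
      linarith

theorem pow_mul_delta_pow (hlam : 14 ≤ lam) (n : ℕ) : (lam ^ r) ^ n * delta lam r ^ n = 1 := by
  rw [← mul_pow, mul_comm, delta_mul_pow hlam, one_pow]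

/-- After entering the linear zone of `0`, an orbit starting in `[y_{n+1}, y_n]` returns to unit
size in `n` steps. -/
theorem IsConstructedMap.iterate_small (hf : IsConstructedMap lam r s φ f) (hlam : 14 ≤ lam)
    (hr : 1 ≤ r) {n : ℕ} (hn : 1 ≤ n) {t : ℝ} (ht : t ∈ Icc (yPt (n + 1)) (yPt n)) :
    f^[n + 1] t = (lam ^ r) ^ n * f t := by
  have h := hf.small_mem hlam hr hn ht
  rw [Function.iterate_succ_apply]
  exact hf.iterate_near_zero hlam n h.1.le h.2

/-- On `[x_n, y_n]` the iterate `f^{n+1}` is the rescaled `s_n`. -/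
theorem IsConstructedMap.iterate_osc (hf : IsConstructedMap lam r s φ f) (hlam : 14 ≤ lam)
    (hr : 1 ≤ r) {n : ℕ} (hn : 1 ≤ n) {t : ℝ} (ht : t ∈ Icc (xPt n) (yPt n)) :
    f^[n + 1] t = xPt n + (yPt n - xPt n) * s n (zoom lam n * (t - xPt n)) := by
  have := pow_mul_delta_pow (r := r) hlam n
  rw [hf.iterate_small hlam hr hn ⟨(yPt_succ_lt_xPt hn).le.trans ht.1, ht.2⟩, hf.osc_eq hn ht]
  linear_combination
    (xPt n + (yPt n - xPt n) * s n (zoom lam n * (t - xPt n))) * this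

theorem IsConstructedMap.expandsOn_iterate_conn (hf : IsConstructedMap lam r s φ f)
    (hlam : 14 ≤ lam) (hr : 1 ≤ r) {n : ℕ} (hn : 1 ≤ n) :
    ExpandsOn (4 / 3) f^[n + 1] (yPt (n + 1)) (xPt n) := by
  intro p q hp hpq hq
  have h := hf.expandsOn_conn hlam hr hn p q hp hpq hq
  have hxy := xPt_lt_yPt hn
  have e := pow_mul_delta_pow (r := r) hlam n
  rw [hf.iterate_small hlam hr hn ⟨hp, by linarith⟩,
    hf.iterate_small hlam hr hn ⟨hp.trans hpq, by linarith⟩, ← mul_sub]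
  have hL : 0 < (lam ^ r) ^ n := by positivity
  refine le_trans (le_of_eq ?_) (mul_le_mul_of_nonneg_left h hL.le)
  linear_combination (-(4 / 3 * (q - p))) * e

/-- The point `y_{n+1}` is periodic, and `f^{n+2}` expands by `2 λ^r` on its right. -/
theorem IsConstructedMap.iterate_affine (hf : IsConstructedMap lam r s φ f) (hlam : 14 ≤ lam)
    {n : ℕ} (hn : 1 ≤ n) {v : ℝ} (h0 : 0 ≤ v)
    (hv : v ≤ wPt lam r n - yPt (n + 1)) :
    f^[n + 2] (yPt (n + 1) + 1 * v) = yPt (n + 1) + 1 * (2 * lam ^ r * v) := by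
  have e := pow_mul_delta_pow (r := r) hlam (n + 1)
  have ht : yPt (n + 1) + 1 * v ∈ Icc (yPt (n + 1)) (wPt lam r n) :=
    ⟨by linarith, by linarith⟩
  have hd0 := delta_pos (r := r) hlam
  have h := hf.affine_mem hlam hn ht
  have h5 : f (yPt (n + 1) + 1 * v) ≤ 5 / 2 * delta lam r ^ (n + 1) := by
    have : delta lam r ^ (n + 1) * xPt n ≤ delta lam r ^ (n + 1) * (5 / 2) := by
      have := xPt_le hn
      gcongr
      linarith
    linarith [h.2]
  have h0 : 0 ≤ f (yPt (n + 1) + 1 * v) := by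
    refine le_trans ?_ h.1
    have := yPt_gt (n := n + 1) (by omega)
    positivity
  rw [Function.iterate_succ_apply, hf.iterate_near_zero hlam (n + 1) h0 h5, hf.eq_affine n hn _ ht,
    pieceY, mul_assoc (delta lam r ^ (n + 1)) (osc lam (n + 1) : ℝ),
    osc_mul_slope hlam (by omega)]
  linear_combination (yPt (n + 1) + 2 * lam ^ r * v) * e

/-- The point `x_n` is periodic, and `f^{n+1}` expands by `2 λ^r` on its right. -/
theorem IsConstructedMap.iterate_xPt_right (hf : IsConstructedMap lam r s φ f) (hlam : 14 ≤ lam)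
    (hr : 1 ≤ r) {n : ℕ} (hn : 1 ≤ n) {v : ℝ} (h0 : 0 ≤ v) (hv : v ≤ delta lam r / zoom lam n) :
    f^[n + 1] (xPt n + 1 * v) = xPt n + 1 * (2 * lam ^ r * v) := by
  have hlt := delta_div_zoom_lt hlam hr hn
  have e := pow_mul_delta_pow (r := r) hlam n
  rw [hf.iterate_small hlam hr hn ⟨by linarith [yPt_succ_lt_xPt hn], by linarith⟩,
    hf.eqOn_pieceX hlam hr hn ⟨by linarith, by linarith⟩, pieceX]
  linear_combination (xPt n + 2 * lam ^ r * v) * e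

/-- The point `y_n` is periodic, and `f^{n+1}` expands by `2 λ^r` on its left. -/
theorem IsConstructedMap.iterate_yPt_left (hf : IsConstructedMap lam r s φ f) (hlam : 14 ≤ lam)
    (hr : 1 ≤ r) {n : ℕ} (hn : 1 ≤ n) {v : ℝ} (h0 : 0 ≤ v) (hv : v ≤ delta lam r / zoom lam n) :
    f^[n + 1] (yPt n + (-1) * v) = yPt n + (-1) * (2 * lam ^ r * v) := by
  have hlt := delta_div_zoom_lt hlam hr hn
  have e := pow_mul_delta_pow (r := r) hlam n
  rw [hf.iterate_small hlam hr hn ⟨by linarith [yPt_succ_lt_xPt hn], by linarith⟩,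
    hf.eqOn_pieceY_left hlam hr hn ⟨by linarith, by linarith⟩, pieceY,
    mul_assoc (delta lam r ^ n) (osc lam n : ℝ), osc_mul_slope hlam hn]
  linear_combination (yPt n - 2 * lam ^ r * v) * e

end Map

/-! ### Covering from special points -/

section Map

variable {lam : ℝ} {r : ℕ} {s φ : ℕ → ℝ → ℝ} {f : ℝ → ℝ}

/-- The turning points satisfy `f (1/2) = 4` and `f 1 = 0`. -/
theorem IsConstructedMap.covers_half_one (hf : IsConstructedMap lam r s φ f) (hlam : 14 ≤ lam)
    (hr : 1 ≤ r) : Covers f (uIcc (1 / 2) 1) := by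
  refine Covers.of_uIcc (hf.continuousOn hlam hr) (hf.mapsTo hlam hr) (by norm_num) (by norm_num) 1
    ⟨0, ?_⟩
  have hd0 := delta_pos (r := r) hlam
  have h1 : f (1 / 2) = 4 := by
    rw [hf.map_half hlam (by simpa using hd0.le)]
    norm_num
  rw [Function.iterate_one, Function.iterate_zero, image_id, h1, hf.map_one hlam hr,
    uIcc_of_ge (by norm_num)]

theorem IsConstructedMap.covers_of_le_of_ge (hf : IsConstructedMap lam r s φ f) (hlam : 14 ≤ lam)
    (hr : 1 ≤ r) {p q : ℝ} (hp : p ≤ 1 / 2) (hq : 1 ≤ q) : Covers f (uIcc p q) := by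
  refine (hf.covers_half_one hlam hr).mono ?_
  rw [uIcc_of_le (by norm_num), uIcc_of_le (by linarith)]
  exact Icc_subset_Icc hp hq

theorem IsConstructedMap.covers_zero (hf : IsConstructedMap lam r s φ f) (hlam : 14 ≤ lam)
    (hr : 1 ≤ r) {z : ℝ} (hz : z ∈ Icc (0 : ℝ) 4) (h0 : 0 < z) : Covers f (uIcc 0 z) := by
  have hL := pow_ge hlam hr
  have hd0 := delta_pos (r := r) hlam
  have hdL := delta_mul_pow (r := r) hlam
  have hc := hf.continuousOn hlam hr
  have hm := hf.mapsTo hlam hr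
  have f0 : f 0 = 0 := by rw [hf.eq_zero 0 ⟨le_rfl, by positivity⟩, pieceZero, mul_zero]
  refine covers_of_expanding (κ := lam ^ r) (σ := 1) hc hm (by linarith) (by norm_num) 1 f0
    (fun z hz hz0 => ?_) hz (by linarith)
  rcases le_total z (5 / 2 * delta lam r) with h | h
  · right
    rw [Function.iterate_one, hf.eq_zero z ⟨hz.1, h⟩, pieceZero]
    linarith
  · left
    have hmem : 5 / 2 * delta lam r ∈ Icc (0 : ℝ) 4 := ⟨by positivity, h.trans hz.2⟩
    have : Covers f (uIcc 0 (5 / 2 * delta lam r)) := by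
      refine Covers.of_uIcc hc hm (by norm_num) hmem 1 ?_
      rw [Function.iterate_one, f0, hf.eq_zero _ ⟨hmem.1, le_rfl⟩, pieceZero]
      exact hf.covers_of_le_of_ge hlam hr (by norm_num) (by linarith)
    refine this.mono ?_
    rw [uIcc_of_le hmem.1, uIcc_of_le hz.1]
    exact Icc_subset_Icc_right h

theorem IsConstructedMap.covers_four (hf : IsConstructedMap lam r s φ f) (hlam : 14 ≤ lam)
    (hr : 1 ≤ r) {z : ℝ} (hz : z ∈ Icc (0 : ℝ) 4) (h4 : z < 4) : Covers f (uIcc 4 z) := by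
  obtain ⟨h1, h2, h3, h4', h5, h6, h7⟩ := joints_lt hlam hr
  have hL := pow_ge hlam hr
  have hd0 := delta_pos (r := r) hlam
  have hd := delta_le hlam hr
  have hdL := delta_mul_pow (r := r) hlam
  have hc := hf.continuousOn hlam hr
  have hm := hf.mapsTo hlam hr
  have f4 : f 4 = 4 := by rw [hf.eq_four 4 ⟨by linarith, le_rfl⟩, pieceFour]; ring
  refine covers_of_expanding (κ := lam ^ r) (σ := -1) hc hm (by linarith) (by norm_num) 1 f4
    (fun z hz hz0 => ?_) hz (by linarith)
  rcases le_total (4 - 3 / 2 * delta lam r) z with h | h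
  · right
    rw [Function.iterate_one, hf.eq_four z ⟨h, hz.2⟩, pieceFour]
    linarith
  · left
    have hmem : 4 - 3 / 2 * delta lam r ∈ Icc (0 : ℝ) 4 := ⟨by linarith, by linarith⟩
    have h52 : (5 / 2 : ℝ) ∈ Icc (0 : ℝ) 4 := by norm_num
    have : Covers f (uIcc 4 (4 - 3 / 2 * delta lam r)) := by
      refine Covers.of_uIcc hc hm (by norm_num) hmem 1 ?_
      rw [Function.iterate_one, f4, hf.eq_four _ ⟨le_rfl, h7.le⟩, pieceFour,
        show 4 + lam ^ r * (4 - 3 / 2 * delta lam r - 4) = 5 / 2 by linarith]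
      refine Covers.of_uIcc hc hm (by norm_num) h52 1 ?_
      rw [Function.iterate_one, f4, ← yPt_one, hf.map_yPt_one hlam hr, uIcc_comm]
      exact hf.covers_of_le_of_ge hlam hr (by linarith) (by norm_num)
    refine this.mono ?_
    rw [uIcc_of_ge h7.le, uIcc_of_ge hz.2]
    exact Icc_subset_Icc_left h

/-- A short subsegment of `[c, z]` starting at `c`. -/
theorem exists_mem_uIcc_near {c z ε : ℝ} (hε : 0 < ε) (hz : z ≠ c) :
    ∃ w ∈ uIcc c z, w ≠ c ∧ |w - c| ≤ ε ∧ 0 < (w - c) * (z - c) := by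
  have hzc : 0 < |z - c| := abs_pos.2 (sub_ne_zero.2 hz)
  set θ := min 1 (ε / |z - c|)
  have h0 : 0 < θ := lt_min one_pos (by positivity)
  have h1 : θ ≤ 1 := min_le_left _ _
  have hne := sub_ne_zero.2 hz
  refine ⟨c + θ * (z - c), ?_, ?_, ?_, ?_⟩
  · have : c + θ * (z - c) ∈ segment ℝ c z := ⟨1 - θ, θ, by linarith, h0.le, by ring, by
      simp only [smul_eq_mul]; ring⟩
    rwa [segment_eq_uIcc] at this
  · intro h
    have : θ * (z - c) = 0 := by linarith
    rcases mul_eq_zero.1 this with h | h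
    · linarith
    · exact hne h
  · rw [add_sub_cancel_left, abs_mul, abs_of_pos h0]
    have := min_le_right 1 (ε / |z - c|)
    exact (le_div_iff₀ hzc).1 this
  · have : 0 < (z - c) ^ 2 := by positivity
    rw [add_sub_cancel_left]
    nlinarith

theorem uIcc_subset_of_mem {c z w : ℝ} (hw : w ∈ uIcc c z) : uIcc c w ⊆ uIcc c z :=
  uIcc_subset_uIcc left_mem_uIcc hw

theorem IsConstructedMap.covers_half (hf : IsConstructedMap lam r s φ f) (hlam : 14 ≤ lam)
    (hr : 1 ≤ r) {z : ℝ} (hz : z ∈ Icc (0 : ℝ) 4) (h : z ≠ 1 / 2) :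
    Covers f (uIcc (1 / 2) z) := by
  have hd0 := delta_pos (r := r) hlam
  have hc := hf.continuousOn hlam hr
  have hm := hf.mapsTo hlam hr
  have hhalf : (1 / 2 : ℝ) ∈ Icc (0 : ℝ) 4 := by norm_num
  obtain ⟨w, hw, hwne, hwd, -⟩ := exists_mem_uIcc_near hd0 h
  have hw4 := uIcc_subset_Icc hhalf hz hw
  refine Covers.mono ?_ (uIcc_subset_of_mem hw)
  refine Covers.of_uIcc hc hm hhalf hw4 1 ?_
  have f1 : f (1 / 2) = 4 := by
    rw [hf.map_half hlam (by simpa using hd0.le)]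
    norm_num
  rw [Function.iterate_one, f1]
  refine hf.covers_four hlam hr (hm hw4) ?_
  rw [hf.map_half hlam hwd]
  have : 0 < |w - 1 / 2| := abs_pos.2 (sub_ne_zero.2 hwne)
  have : 0 < lam ^ r * |w - 1 / 2| ^ 2 := by positivity
  linarith

theorem IsConstructedMap.covers_one (hf : IsConstructedMap lam r s φ f) (hlam : 14 ≤ lam)
    (hr : 1 ≤ r) {z : ℝ} (hz : z ∈ Icc (0 : ℝ) 4) (h : z ≠ 1) : Covers f (uIcc 1 z) := by
  have hd0 := delta_pos (r := r) hlam
  have hd := delta_le hlam hr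
  have hc := hf.continuousOn hlam hr
  have hm := hf.mapsTo hlam hr
  have hone : (1 : ℝ) ∈ Icc (0 : ℝ) 4 := by norm_num
  obtain ⟨w, hw, hwne, hwd, -⟩ := exists_mem_uIcc_near hd0 h
  have hw4 := uIcc_subset_Icc hone hz hw
  have hwd' := abs_le.1 hwd
  refine Covers.mono ?_ (uIcc_subset_of_mem hw)
  refine Covers.of_uIcc hc hm hone hw4 1 ?_
  rw [Function.iterate_one, hf.map_one hlam hr]
  refine hf.covers_zero hlam hr (hm hw4) ?_
  rcases lt_or_gt_of_ne hwne with h1 | h1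
  · have := hf.map_near_one hlam (u := 1 - w) (by linarith) (by linarith)
    rw [sub_sub_cancel] at this
    have h2 : 0 < 1 - w := by linarith
    rw [this]
    positivity
  · obtain ⟨n, hn, hn1, hn2⟩ := exists_yPt_le h1 (by rw [yPt_one]; linarith)
    exact (hf.small_mem hlam hr hn ⟨hn1, hn2.le⟩).1

theorem mem_Icc_of_le {t : ℝ} (h1 : 1 ≤ t) (h2 : t ≤ 5 / 2) : t ∈ Icc (0 : ℝ) 4 :=
  ⟨by linarith, by linarith⟩

theorem IsConstructedMap.iterate_xPt (hf : IsConstructedMap lam r s φ f) (hlam : 14 ≤ lam)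
    (hr : 1 ≤ r) {n : ℕ} (hn : 1 ≤ n) : f^[n + 1] (xPt n) = xPt n := by
  have hE := div_pos (delta_pos (r := r) hlam) (zoom_pos hlam hn)
  simpa using hf.iterate_xPt_right hlam hr hn le_rfl hE.le

theorem IsConstructedMap.iterate_yPt (hf : IsConstructedMap lam r s φ f) (hlam : 14 ≤ lam)
    (hr : 1 ≤ r) {n : ℕ} (hn : 1 ≤ n) : f^[n + 1] (yPt n) = yPt n := by
  have hE := div_pos (delta_pos (r := r) hlam) (zoom_pos hlam hn)
  simpa using hf.iterate_yPt_left hlam hr hn le_rfl hE.le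

/-- The iterate `f^{n+1}` maps `[w_n, x_n]` over `[δ x_n, x_n]`, which contains `[1/2, 1]`. -/
theorem IsConstructedMap.covers_conn (hf : IsConstructedMap lam r s φ f) (hlam : 14 ≤ lam)
    (hr : 1 ≤ r) {n : ℕ} (hn : 1 ≤ n) : Covers f (uIcc (wPt lam r n) (xPt n)) := by
  have h1 := yPt_gt (n := n + 1) (by omega)
  have h2 := yPt_lt_wPt (r := r) hlam hn
  have h3 := wPt_lt_xPt hlam hr hn
  have h4 := xPt_lt_yPt hn
  have h5 := xPt_le hn
  have hd := delta_le hlam hr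
  have hd0 := delta_pos (r := r) hlam
  refine Covers.of_uIcc (hf.continuousOn hlam hr) (hf.mapsTo hlam hr)
    (mem_Icc_of_le (by linarith) (by linarith)) (mem_Icc_of_le (by linarith) (by linarith))
    (n + 1) ?_
  refine hf.covers_of_le_of_ge hlam hr ?_ ?_
  · have e := pow_mul_delta_pow (r := r) hlam n
    rw [hf.iterate_small hlam hr hn ⟨h2.le, by linarith⟩, hf.eq_affine n hn _ ⟨h2.le, le_rfl⟩,
      pieceY_wPt hlam hn]
    have : (lam ^ r) ^ n * (delta lam r ^ (n + 1) * xPt n) = delta lam r * xPt n := by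
      rw [pow_succ]
      linear_combination delta lam r * xPt n * e
    rw [this]
    nlinarith
  · rw [hf.iterate_xPt hlam hr hn]
    linarith

theorem IsConstructedMap.covers_of_conn_subset (hf : IsConstructedMap lam r s φ f)
    (hlam : 14 ≤ lam) (hr : 1 ≤ r) {n : ℕ} (hn : 1 ≤ n) {p q : ℝ} (hp : p ≤ wPt lam r n)
    (hq : xPt n ≤ q) : Covers f (uIcc p q) := by
  have h3 := wPt_lt_xPt hlam hr hn
  refine (hf.covers_conn hlam hr hn).mono ?_
  rw [uIcc_of_le h3.le, uIcc_of_le (by linarith)]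
  exact Icc_subset_Icc hp hq

theorem IsConstructedMap.covers_yPt_right (hf : IsConstructedMap lam r s φ f) (hlam : 14 ≤ lam)
    (hr : 1 ≤ r) {n : ℕ} (hn : 1 ≤ n) {z : ℝ} (hz : z ∈ Icc (0 : ℝ) 4)
    (h : yPt (n + 1) < z) : Covers f (uIcc (yPt (n + 1)) z) := by
  have h1 := yPt_gt (n := n + 1) (by omega)
  have h2 := yPt_lt_wPt (r := r) hlam hn
  have h3 := wPt_lt_xPt hlam hr hn
  have h5 := xPt_le hn
  have hL := pow_ge hlam hr
  have hc := hf.continuousOn hlam hr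
  have hm := hf.mapsTo hlam hr
  have hy : yPt (n + 1) ∈ Icc (0 : ℝ) 4 := mem_Icc_of_le h1.le (by linarith)
  have hdL := delta_mul_pow (r := r) hlam
  have hfix : f^[n + 2] (yPt (n + 1)) = yPt (n + 1) := by
    simpa using hf.iterate_affine hlam hn le_rfl (by linarith)
  refine covers_of_expanding (κ := 2 * lam ^ r) (σ := 1) hc hm (by linarith) hy (n + 2) hfix
    (fun z hz hz0 => ?_) hz (by linarith)
  rcases le_total z (wPt lam r n) with hzw | hzw
  · right
    have := hf.iterate_affine hlam hn (v := z - yPt (n + 1)) (by linarith) (by linarith)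
    rw [one_mul, add_sub_cancel] at this
    rw [this]
    linarith
  · left
    have := hf.iterate_affine hlam hn (v := wPt lam r n - yPt (n + 1)) (by linarith) le_rfl
    rw [one_mul, add_sub_cancel] at this
    have e : yPt (n + 1) + 1 * (2 * lam ^ r * (wPt lam r n - yPt (n + 1))) = xPt n := by
      rw [wPt_sub_yPt hlam hn]
      linear_combination (xPt n - yPt (n + 1)) * hdL
    have hcov : Covers f (uIcc (yPt (n + 1)) (wPt lam r n)) := by
      refine Covers.of_uIcc hc hm hy (mem_Icc_of_le (by linarith) (by linarith)) (n + 2) ?_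
      rw [hfix, this, e]
      exact hf.covers_of_conn_subset hlam hr hn h2.le le_rfl
    refine hcov.mono ?_
    rw [uIcc_of_le h2.le, uIcc_of_le (by linarith)]
    exact Icc_subset_Icc_right hzw

/-- To the right of `y_1` no formula is prescribed, but the orbit of `y_1` is `5/2`, `5δ/2`, `5/2`,
and `f` has slope at least `3/2` near both points, unless it reaches the turning point `1/2`. -/
theorem IsConstructedMap.covers_yPt_one_right (hf : IsConstructedMap lam r s φ f)
    (hlam : 14 ≤ lam) (hr : 1 ≤ r) {z : ℝ} (hz : z ∈ Icc (0 : ℝ) 4) (h : yPt 1 < z) :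
    Covers f (uIcc (yPt 1) z) := by
  obtain ⟨h1, h2, h3, h4', h5, h6, h7⟩ := joints_lt hlam hr
  have hd0 := delta_pos (r := r) hlam
  have hd := delta_le hlam hr
  have hdL := delta_mul_pow (r := r) hlam
  have hc := hf.continuousOn hlam hr
  have hm := hf.mapsTo hlam hr
  have hy : yPt 1 ∈ Icc (0 : ℝ) 4 := by rw [yPt_one]; norm_num
  have hfix : f^[2] (yPt 1) = yPt 1 := hf.iterate_yPt hlam hr le_rfl
  refine covers_of_expanding (κ := 2) (σ := 1) hc hm (by norm_num) hy 2 hfix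
    (fun z hz hz0 => ?_) hz (by linarith)
  have hzy : yPt 1 ≤ z := by linarith
  have e1 := hf.expandsOn_right hlam hr (yPt 1) z le_rfl hzy hz.2
  rw [hf.map_yPt_one hlam hr] at e1
  rcases le_total (1 / 2) (f z) with hfz | hfz
  · left
    refine Covers.of_uIcc hc hm hy hz 1 ?_
    rw [Function.iterate_one, hf.map_yPt_one hlam hr]
    refine (hf.covers_half hlam hr (z := 5 / 2 * delta lam r) ⟨by linarith, by linarith⟩
      (by linarith)).mono ?_
    rw [uIcc_of_ge (by linarith), uIcc_of_le (by linarith)]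
    exact Icc_subset_Icc_right hfz
  · right
    have f5 : f (5 / 2 * delta lam r) = 5 / 2 := by
      rw [hf.eq_zero _ ⟨h1.le, le_rfl⟩, pieceZero]
      linarith
    have e2 : 3 / 2 * (f z - 5 / 2 * delta lam r) ≤ f (f z) - 5 / 2 := by
      rcases le_total (f z) (1 / 2 - delta lam r) with hf2 | hf2
      · have := hf.expandsOn_left hlam hr (5 / 2 * delta lam r) (f z) h1.le (by linarith) hf2
        rwa [f5] at this
      · have hab : |f z - 1 / 2| ≤ delta lam r := abs_le.2 ⟨by linarith, by linarith⟩
        rw [hf.map_half hlam hab]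
        have : lam ^ r * |f z - 1 / 2| ^ 2 ≤ lam ^ r * delta lam r ^ 2 := by gcongr
        have : lam ^ r * delta lam r ^ 2 = delta lam r := by linear_combination delta lam r * hdL
        linarith
    have : f^[2] z = f (f z) := rfl
    rw [this]
    rw [yPt_one] at *
    linarith

/-- The values of `s_n` near an interior integer `j`, in terms of the displacement from `j`. -/
theorem IsConstructedMap.osc_at_int (hf : IsConstructedMap lam r s φ f) {n : ℕ}
    (hn : 1 ≤ n) {j : ℤ} (h0 : 0 < j) (hj : j < osc lam n) {u : ℝ} (hu : |u| ≤ delta lam r) :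
    (Odd j → s n (j + u) = 1 - curv lam r * u ^ 2) ∧
      (Even j → s n (j + u) = -mMin n + curv lam r * u ^ 2) := by
  constructor
  · intro h
    have := hf.oscFamily.near_max n hn j h0 hj h (j + u) (by simpa using hu)
    rwa [add_sub_cancel_left] at this
  · intro h
    have := hf.oscFamily.near_min n hn j h0 hj h (j + u) (by simpa using hu)
    rwa [add_sub_cancel_left] at this

/-- The point of `[x_n, y_n]` with rescaled coordinate `τ`. -/
noncomputable def oscPt (lam : ℝ) (n : ℕ) (τ : ℝ) : ℝ := xPt n + τ / zoom lam n

theorem oscPt_zero (n : ℕ) : oscPt lam n 0 = xPt n := by simp [oscPt]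

theorem oscPt_end (hlam : 14 ≤ lam) {n : ℕ} (hn : 1 ≤ n) : oscPt lam n (osc lam n) = yPt n := by
  have := (zoom_pos hlam hn).ne'
  rw [oscPt, ← zoom_mul hn]
  field_simp
  ring

theorem zoom_oscPt (hlam : 14 ≤ lam) {n : ℕ} (hn : 1 ≤ n) (τ : ℝ) :
    zoom lam n * (oscPt lam n τ - xPt n) = τ := by
  have := (zoom_pos hlam hn).ne'
  rw [oscPt]
  field_simp
  ring

theorem oscPt_zoom (hlam : 14 ≤ lam) {n : ℕ} (hn : 1 ≤ n) (t : ℝ) :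
    oscPt lam n (zoom lam n * (t - xPt n)) = t := by
  have := (zoom_pos hlam hn).ne'
  rw [oscPt]
  field_simp
  ring

theorem oscPt_mem (hlam : 14 ≤ lam) {n : ℕ} (hn : 1 ≤ n) {τ : ℝ} (h : τ ∈ Icc 0 (osc lam n : ℝ)) :
    oscPt lam n τ ∈ Icc (xPt n) (yPt n) := by
  have hz := zoom_pos hlam hn
  constructor
  · rw [oscPt]
    have : 0 ≤ τ / zoom lam n := div_nonneg h.1 hz.le
    linarith
  · rw [← oscPt_end hlam hn, oscPt, oscPt]
    have := (div_le_div_iff_of_pos_right hz).2 h.2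
    linarith

theorem oscPt_mem_Icc (hlam : 14 ≤ lam) {n : ℕ} (hn : 1 ≤ n) {τ : ℝ}
    (h : τ ∈ Icc 0 (osc lam n : ℝ)) : oscPt lam n τ ∈ Icc (0 : ℝ) 4 := by
  have := oscPt_mem hlam hn h
  exact mem_Icc_of_le ((xPt_gt hn).le.trans this.1) (this.2.trans (yPt_le hn))

theorem IsConstructedMap.iterate_oscPt (hf : IsConstructedMap lam r s φ f) (hlam : 14 ≤ lam)
    (hr : 1 ≤ r) {n : ℕ} (hn : 1 ≤ n) {τ : ℝ} (h : τ ∈ Icc 0 (osc lam n : ℝ)) :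
    f^[n + 1] (oscPt lam n τ) = xPt n + (yPt n - xPt n) * s n τ := by
  rw [hf.iterate_osc hlam hr hn (oscPt_mem hlam hn h), zoom_oscPt hlam hn]

theorem curv_pos (hlam : 14 ≤ lam) : 0 < curv lam r := by
  have := delta_pos (r := r) hlam
  unfold curv
  positivity

theorem IsConstructedMap.covers_yPt_left (hf : IsConstructedMap lam r s φ f) (hlam : 14 ≤ lam)
    (hr : 1 ≤ r) {n : ℕ} (hn : 1 ≤ n) {z : ℝ} (hz : z ∈ Icc (0 : ℝ) 4) (h : z < yPt n) :
    Covers f (uIcc (yPt n) z) := by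
  have hL := pow_ge hlam hr
  have hc := hf.continuousOn hlam hr
  have hm := hf.mapsTo hlam hr
  have hzo := zoom_pos hlam hn
  have hd0 := delta_pos (r := r) hlam
  have hdL := delta_mul_pow (r := r) hlam
  have hE := div_pos (delta_pos (r := r) hlam) hzo
  have hMi := osc_ge_int hlam hn
  have hM := osc_ge hlam hn
  have hy : yPt n ∈ Icc (0 : ℝ) 4 := mem_Icc_of_le (yPt_gt hn).le (yPt_le hn)
  have hfix := hf.iterate_yPt hlam hr hn
  have hlast : ((osc lam n - 1 : ℤ) : ℝ) ∈ Icc 0 (osc lam n : ℝ) := by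
    push_cast
    constructor <;> linarith
  -- the last lap is mapped over `[y_{n+1}, y_n]`
  have hlap : Covers f (uIcc (yPt n) (oscPt lam n ((osc lam n - 1 : ℤ) : ℝ))) := by
    refine Covers.of_uIcc hc hm hy (oscPt_mem_Icc hlam hn hlast) (n + 1) ?_
    have hs := (hf.osc_at_int hn (j := osc lam n - 1) (by omega) (by omega) (u := 0)
      (by simpa using hd0.le)).2 ((osc_odd n).sub_odd odd_one)
    rw [add_zero] at hs
    rw [hfix, hf.iterate_oscPt hlam hr hn hlast, hs, uIcc_comm]
    refine hf.covers_of_conn_subset hlam hr hn ?_ (xPt_lt_yPt hn).le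
    have := xPt_sub_mMin hn
    have := yPt_lt_wPt (r := r) hlam hn
    linarith
  have hlt := delta_div_zoom_lt hlam hr hn
  refine covers_of_expanding (κ := 2 * lam ^ r) (σ := -1) hc hm (by linarith) hy (n + 1) hfix
    (fun z hz hz0 => ?_) hz (by linarith)
  rcases le_total (yPt n - delta lam r / zoom lam n) z with hzw | hzw
  · right
    have := hf.iterate_yPt_left hlam hr hn (v := yPt n - z) (by linarith) (by linarith)
    rw [show yPt n + -1 * (yPt n - z) = z by ring] at this
    rw [this]
    linarith
  · left
    have := hf.iterate_yPt_left hlam hr hn (v := delta lam r / zoom lam n) hE.le le_rfl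
    have hmem : yPt n + -1 * (delta lam r / zoom lam n) ∈ Icc (0 : ℝ) 4 :=
      ⟨hz.1.trans (by linarith), by linarith [hy.2]⟩
    have hcov : Covers f (uIcc (yPt n) (yPt n + -1 * (delta lam r / zoom lam n))) := by
      refine Covers.of_uIcc hc hm hy hmem (n + 1) (hlap.mono ?_)
      rw [hfix, this]
      refine uIcc_subset_of_mem ?_
      have e : 2 * lam ^ r * (delta lam r / zoom lam n) = 2 / zoom lam n := by
        field_simp
        linarith
      have e2 : oscPt lam n ((osc lam n - 1 : ℤ) : ℝ) = yPt n - 1 / zoom lam n := by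
        rw [← oscPt_end hlam hn, oscPt, oscPt]
        push_cast
        ring
      have h1 : 0 < 1 / zoom lam n := by positivity
      rw [e, e2, uIcc_of_ge (by rw [show 2 / zoom lam n = 2 * (1 / zoom lam n) by ring]; linarith)]
      constructor
      · rw [show 2 / zoom lam n = 2 * (1 / zoom lam n) by ring]; linarith
      · linarith
    refine hcov.mono (uIcc_subset_of_mem ?_)
    rw [uIcc_of_ge (by linarith)]
    constructor <;> linarith

/-- The extrema of the oscillations are mapped to `y_n` and `y_{n+1}` by `f^{n+1}`. -/
theorem IsConstructedMap.covers_extremum (hf : IsConstructedMap lam r s φ f) (hlam : 14 ≤ lam)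
    (hr : 1 ≤ r) {n : ℕ} (hn : 1 ≤ n) {j : ℤ} (h0 : 0 < j) (hj : j < osc lam n) {z : ℝ}
    (hz : z ∈ Icc (0 : ℝ) 4) (h : z ≠ oscPt lam n j) : Covers f (uIcc (oscPt lam n j) z) := by
  have hd0 := delta_pos (r := r) hlam
  have hd := delta_le hlam hr
  have hc := hf.continuousOn hlam hr
  have hm := hf.mapsTo hlam hr
  have hzo := zoom_pos hlam hn
  have hC := curv_pos (r := r) hlam
  have hyx := xPt_lt_yPt hn
  have hj0 : (1 : ℝ) ≤ j := by exact_mod_cast h0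
  have hjM : (j : ℝ) + 1 ≤ osc lam n := by exact_mod_cast hj
  have hjmem : (j : ℝ) ∈ Icc 0 (osc lam n : ℝ) := ⟨by linarith, by linarith⟩
  have hcr := oscPt_mem_Icc hlam hn hjmem
  obtain ⟨w, hw, hwne, hwd, -⟩ := exists_mem_uIcc_near (div_pos hd0 hzo) h
  have hw4 := uIcc_subset_Icc hcr hz hw
  refine Covers.mono ?_ (uIcc_subset_of_mem hw)
  set u := zoom lam n * (w - oscPt lam n j)
  have hu : |u| ≤ delta lam r := by
    rw [abs_mul, abs_of_pos hzo, ← le_div_iff₀' hzo]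
    exact hwd
  have hu0 : u ≠ 0 := mul_ne_zero hzo.ne' (sub_ne_zero.2 hwne)
  have hwe : w = oscPt lam n (j + u) := by
    have : u = zoom lam n * (w - xPt n) - j := by
      rw [← zoom_oscPt hlam hn (j : ℝ)]; ring
    rw [this, add_sub_cancel, oscPt_zoom hlam hn]
  have hu' := abs_le.1 hu
  have hjumem : (j : ℝ) + u ∈ Icc 0 (osc lam n : ℝ) := ⟨by linarith, by linarith⟩
  refine Covers.of_uIcc hc hm hcr hw4 (n + 1) ?_
  have hw' := hm.iterate (n + 1) hw4
  rw [hwe, hf.iterate_oscPt hlam hr hn hjumem] at hw' ⊢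
  rw [hf.iterate_oscPt hlam hr hn hjmem]
  have a0 := hf.osc_at_int hn h0 hj (u := 0) (by simpa using hd0.le)
  have au := hf.osc_at_int hn h0 hj hu
  have hpos : 0 < (yPt n - xPt n) * (curv lam r * u ^ 2) := by
    have : 0 < yPt n - xPt n := by linarith
    positivity
  simp only [add_zero] at a0
  rcases Int.even_or_odd j with hj2 | hj2
  · rw [au.2 hj2] at hw' ⊢
    rw [a0.2 hj2]
    have e : xPt n + (yPt n - xPt n) * (-mMin n + curv lam r * 0 ^ 2) = yPt (n + 1) := by
      rw [← xPt_sub_mMin hn]; ring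
    rw [e]
    refine hf.covers_yPt_right hlam hr hn hw' ?_
    rw [← xPt_sub_mMin hn]
    linarith
  · rw [au.1 hj2] at hw' ⊢
    rw [a0.1 hj2]
    have e : xPt n + (yPt n - xPt n) * (1 - curv lam r * 0 ^ 2) = yPt n := by ring
    rw [e]
    refine hf.covers_yPt_left hlam hr hn hw' ?_
    linarith

theorem IsConstructedMap.covers_xPt (hf : IsConstructedMap lam r s φ f) (hlam : 14 ≤ lam)
    (hr : 1 ≤ r) {n : ℕ} (hn : 1 ≤ n) {z : ℝ} (hz : z ∈ Icc (0 : ℝ) 4) (h : z ≠ xPt n) :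
    Covers f (uIcc (xPt n) z) := by
  have hL := pow_ge hlam hr
  have hc := hf.continuousOn hlam hr
  have hm := hf.mapsTo hlam hr
  have hzo := zoom_pos hlam hn
  have hd0 := delta_pos (r := r) hlam
  have hdL := delta_mul_pow (r := r) hlam
  have hE := div_pos (delta_pos (r := r) hlam) hzo
  have hx : xPt n ∈ Icc (0 : ℝ) 4 := mem_Icc_of_le (xPt_gt hn).le (by linarith [xPt_le hn])
  have hfix := hf.iterate_xPt hlam hr hn
  rcases lt_or_gt_of_ne h with h | h
  · refine covers_of_expanding (κ := 4 / 3) (σ := -1) hc hm (by norm_num) hx (n + 1) hfix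
      (fun z hz hz0 => ?_) hz (by linarith)
    rcases le_total (wPt lam r n) z with hzw | hzw
    · right
      have := hf.expandsOn_iterate_conn hlam hr hn z (xPt n)
        ((yPt_lt_wPt hlam hn).le.trans hzw) (by linarith) le_rfl
      rw [hfix] at this
      linarith
    · left
      rw [uIcc_comm]
      exact hf.covers_of_conn_subset hlam hr hn hzw le_rfl
  · refine covers_of_expanding (κ := 2 * lam ^ r) (σ := 1) hc hm (by linarith) hx (n + 1) hfix
      (fun z hz hz0 => ?_) hz (by linarith)
    rcases le_total z (xPt n + delta lam r / zoom lam n) with hzw | hzw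
    · right
      have := hf.iterate_xPt_right hlam hr hn (v := z - xPt n) (by linarith) (by linarith)
      rw [one_mul, add_sub_cancel] at this
      rw [this]
      linarith
    · left
      have := hf.iterate_xPt_right hlam hr hn (v := delta lam r / zoom lam n) hE.le le_rfl
      have hmem : xPt n + 1 * (delta lam r / zoom lam n) ∈ Icc (0 : ℝ) 4 :=
        ⟨by linarith [hx.1], by linarith [hz.2]⟩
      have hcov : Covers f (uIcc (xPt n) (xPt n + 1 * (delta lam r / zoom lam n))) := by
        refine Covers.of_uIcc hc hm hx hmem (n + 1) ?_
        have e : 2 * lam ^ r * (delta lam r / zoom lam n) = 2 * (1 / zoom lam n) := by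
          field_simp
          linarith
        have h1 : 0 < 1 / zoom lam n := by positivity
        have hz1 : oscPt lam n ((1 : ℤ) : ℝ) = xPt n + 1 / zoom lam n := by rw [oscPt]; norm_num
        have := hf.covers_extremum hlam hr hn (j := 1) (by norm_num)
          (by linarith [osc_ge_int hlam hn]) hx (by rw [hz1]; linarith)
        rw [hfix, ‹f^[n + 1] _ = _›, e]
        refine this.mono ?_
        rw [hz1, uIcc_of_ge (by linarith), uIcc_of_le (by linarith)]
        exact Icc_subset_Icc_right (by linarith)
      refine hcov.mono (uIcc_subset_of_mem ?_)
      rw [uIcc_of_le (by linarith)]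
      constructor <;> linarith

/-- The turning points of `f`, its fixed points `0` and `4`, and the end points `x_n`, `y_n`. -/
def IsSpecial (lam : ℝ) (t : ℝ) : Prop :=
  t = 0 ∨ t = 4 ∨ t = 1 / 2 ∨ t = 1 ∨
    ∃ n : ℕ, 1 ≤ n ∧ ∃ j : ℤ, 0 ≤ j ∧ j ≤ osc lam n ∧ t = oscPt lam n j

theorem IsConstructedMap.covers_special (hf : IsConstructedMap lam r s φ f) (hlam : 14 ≤ lam)
    (hr : 1 ≤ r) {t z : ℝ} (ht : IsSpecial lam t) (hz : z ∈ Icc (0 : ℝ) 4) (h : z ≠ t) :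
    Covers f (uIcc t z) := by
  rcases ht with rfl | rfl | rfl | rfl | ⟨n, hn, j, hj0, hjM, rfl⟩
  · exact hf.covers_zero hlam hr hz (lt_of_le_of_ne hz.1 h.symm)
  · exact hf.covers_four hlam hr hz (lt_of_le_of_ne hz.2 h)
  · exact hf.covers_half hlam hr hz h
  · exact hf.covers_one hlam hr hz h
  · rcases hj0.eq_or_lt with rfl | hj0
    · rw [Int.cast_zero, oscPt_zero] at h ⊢
      exact hf.covers_xPt hlam hr hn hz h
    rcases hjM.eq_or_lt with rfl | hjM
    · rw [oscPt_end hlam hn] at h ⊢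
      rcases lt_or_gt_of_ne h with h | h
      · exact hf.covers_yPt_left hlam hr hn hz h
      · rcases Nat.exists_eq_succ_of_ne_zero (Nat.one_le_iff_ne_zero.1 hn) with ⟨m, rfl⟩
        rcases Nat.eq_zero_or_pos m with rfl | hm
        · exact hf.covers_yPt_one_right hlam hr hz h
        · exact hf.covers_yPt_right hlam hr hm hz h
    · exact hf.covers_extremum hlam hr hn hj0 hjM hz h

end Map

/-! ### Stretching between special points -/

/-- A quadratic function `K x²` with average slope at least `c` on `[0, b]` has average slope at
least `c` on every `[a, b]` with `0 ≤ a ≤ b`. -/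
theorem le_mul_sq_sub_sq {K c a b : ℝ} (hb : 0 < b) (ha : 0 ≤ a) (hab : a ≤ b) (hc : 0 ≤ c)
    (hK : c * b ≤ K * b ^ 2) : c * (b - a) ≤ K * (b ^ 2 - a ^ 2) := by
  have h1 : c ≤ K * b := by
    refine le_of_mul_le_mul_right ?_ hb
    linarith
  have h2 : c * (b - a) ≤ K * b * (b - a) := mul_le_mul_of_nonneg_right h1 (by linarith)
  have hK0 : 0 ≤ K := by
    by_contra h
    push Not at h
    have := mul_neg_of_neg_of_pos h hb
    linarith
  have h3 : 0 ≤ K * a * (b - a) := mul_nonneg (mul_nonneg hK0 ha) (by linarith)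
  nlinarith

theorem iterate_iterate {f : ℝ → ℝ} (m i : ℕ) (t : ℝ) : (f^[m])^[i] t = f^[m * i] t := by
  rw [Function.iterate_mul]

/-- Some iterate of `f` stretches the distance between `p` and `q` by at least `5/4`. -/
def Stretches (f : ℝ → ℝ) (p q : ℝ) : Prop := ∃ k : ℕ, 5 / 4 * |q - p| ≤ |f^[k] q - f^[k] p|

theorem Stretches.symm {f : ℝ → ℝ} {p q : ℝ} (h : Stretches f p q) : Stretches f q p := by
  obtain ⟨k, hk⟩ := h
  exact ⟨k, by rwa [abs_sub_comm p, abs_sub_comm (f^[k] p)]⟩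

theorem Stretches.of_expandsOn {f g : ℝ → ℝ} {p q c : ℝ} (k : ℕ) (hc : 5 / 4 ≤ c)
    (hpq : p ≤ q) (hg : g q - g p ≤ |f^[k] q - f^[k] p|) (h : c * (q - p) ≤ g q - g p) :
    Stretches f p q := by
  refine ⟨k, ?_⟩
  rw [abs_of_nonneg (sub_nonneg.2 hpq)]
  have : 5 / 4 * (q - p) ≤ c * (q - p) := mul_le_mul_of_nonneg_right hc (by linarith)
  linarith

section Map

variable {lam : ℝ} {r : ℕ} {s φ : ℕ → ℝ → ℝ} {f : ℝ → ℝ}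

/-- Next to the turning point `1/2` the small derivative is made up for by the time that the orbit
spends next to the fixed point `4`. -/
theorem IsConstructedMap.stretches_near_half (hf : IsConstructedMap lam r s φ f) (hlam : 14 ≤ lam)
    (hr : 1 ≤ r) {p q : ℝ} (hpq : |q - 1 / 2| < |p - 1 / 2|) (hp : |p - 1 / 2| ≤ delta lam r)
    (hside : |q - p| = |p - 1 / 2| - |q - 1 / 2|) : Stretches f p q := by
  have hL := pow_ge hlam hr
  have hd0 := delta_pos (r := r) hlam
  have hdL := delta_mul_pow (r := r) hlam
  set b := |p - 1 / 2|
  set a := |q - 1 / 2|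
  have ha : 0 ≤ a := abs_nonneg _
  have hb : 0 < b := lt_of_le_of_lt ha hpq
  obtain ⟨i, hi, hv⟩ := exists_escape (T := f) (c := 4) (σ := -1) (κ := lam ^ r)
    (E := 3 / 2 * delta lam r) (b := 3 / 2 * lam ^ r * b ^ 2) (by linarith) (by positivity)
    (fun v h0 h => by rw [hf.eq_four _ ⟨by linarith, by linarith⟩, pieceFour]; ring)
  refine ⟨i + 1, ?_⟩
  have ep : f p = 4 + -1 * (3 / 2 * lam ^ r * b ^ 2) := by rw [hf.map_half hlam hp]; ring
  have eq : f q = 4 + -1 * (3 / 2 * lam ^ r * a ^ 2) := by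
    rw [hf.map_half hlam (hpq.le.trans hp)]; ring
  rw [Function.iterate_succ_apply, Function.iterate_succ_apply, ep, eq, hv _ (by positivity) le_rfl,
    hv _ (by positivity) (by gcongr), hside]
  have key := le_mul_sq_sub_sq (K := (lam ^ r) ^ i * (3 / 2 * lam ^ r)) (c := 3 / 2) hb ha hpq.le
    (by norm_num) (by linarith)
  refine le_trans ?_ (le_abs_self _)
  linarith

/-- Between a point of the quadratic zone of `1/2` and the boundary of that zone the average slope
is at least `3/2`, although the slope tends to `0` at `1/2`. -/
theorem IsConstructedMap.margin_half (hf : IsConstructedMap lam r s φ f) (hlam : 14 ≤ lam)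
    {t : ℝ} (ht : |t - 1 / 2| ≤ delta lam r) :
    3 / 2 * (delta lam r - |t - 1 / 2|) ≤ f t - (4 - 3 / 2 * delta lam r) := by
  have hd0 := delta_pos (r := r) hlam
  have hdL := delta_mul_pow (r := r) hlam
  have h0 := abs_nonneg (t - 1 / 2)
  rw [hf.map_half hlam ht]
  have := le_mul_sq_sub_sq (K := 3 / 2 * lam ^ r) (c := 3 / 2) hd0 h0 ht (by norm_num)
    (le_of_eq (by linear_combination (-(3 / 2 * delta lam r)) * hdL))
  have e : lam ^ r * delta lam r ^ 2 = delta lam r := by linear_combination delta lam r * hdL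
  linarith

theorem IsConstructedMap.map_half_edge (hf : IsConstructedMap lam r s φ f) (hlam : 14 ≤ lam)
    {t : ℝ} (ht : |t - 1 / 2| = delta lam r) : f t = 4 - 3 / 2 * delta lam r := by
  have hdL := delta_mul_pow (r := r) hlam
  rw [hf.map_half hlam ht.le, ht]
  linear_combination (-(3 / 2 * delta lam r)) * hdL

theorem IsConstructedMap.stretches_left (hf : IsConstructedMap lam r s φ f) (hlam : 14 ≤ lam)
    (hr : 1 ≤ r) {p q : ℝ} (hp : 0 ≤ p) (hpq : p < q) (hq : q < 1 / 2) : Stretches f p q := by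
  have hd0 := delta_pos (r := r) hlam
  have hd := delta_le hlam hr
  rcases le_total (1 / 2 - delta lam r) p with h | h
  · have e1 : |p - 1 / 2| = 1 / 2 - p := by rw [abs_of_neg (by linarith)]; ring
    have e2 : |q - 1 / 2| = 1 / 2 - q := by rw [abs_of_neg (by linarith)]; ring
    refine hf.stretches_near_half hlam hr ?_ ?_ ?_
    · rw [e1, e2]; linarith
    · rw [e1]; linarith
    · rw [e1, e2, abs_of_pos (by linarith)]; ring
  · refine Stretches.of_expandsOn (c := 3 / 2) (g := f) 1 (by norm_num) hpq.le (le_abs_self _) ?_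
    refine (hf.expandsOn_left hlam hr).le_of_margins (by linarith) (fun h => ?_) (fun h => ?_)
      hpq.le (by linarith) h
    · rw [le_antisymm h hp]; simp
    · have e2 : |q - 1 / 2| = 1 / 2 - q := by rw [abs_of_neg (by linarith)]; ring
      have := hf.margin_half hlam (t := q) (by rw [e2]; linarith)
      rw [hf.map_half_edge hlam (t := 1 / 2 - delta lam r) (by
        rw [abs_of_neg (by linarith)]; ring)]
      rw [e2] at this
      linarith

/-- The average slope of `x ^ m` on `[A, B]` is at least its average slope on `[0, B]`. -/
theorem mul_pow_sub_pow_le {A B : ℝ} (hA : 0 ≤ A) (hAB : A ≤ B) {m : ℕ} (hm : 1 ≤ m) :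
    B ^ m * (B - A) ≤ B * (B ^ m - A ^ m) := by
  obtain ⟨k, rfl⟩ : ∃ k, m = k + 1 := ⟨m - 1, by omega⟩
  have : A ^ k ≤ B ^ k := pow_le_pow_left₀ hA hAB k
  have : B * A * A ^ k ≤ B * A * B ^ k := by
    apply mul_le_mul_of_nonneg_left this
    exact mul_nonneg (hA.trans hAB) hA
  rw [pow_succ, pow_succ]
  linarith

/-- To the left of the turning point `1` the small derivative is made up for by the time that the
orbit spends next to the fixed point `0`. -/
theorem IsConstructedMap.stretches_near_one (hf : IsConstructedMap lam r s φ f) (hlam : 14 ≤ lam)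
    (hr : 1 ≤ r) {p q : ℝ} (hp : 1 - delta lam r ≤ p) (hpq : p < q) (hq : q < 1) :
    Stretches f p q := by
  have hL := pow_ge hlam hr
  have hd0 := delta_pos (r := r) hlam
  set B := (1 - p) / delta lam r
  set A := (1 - q) / delta lam r
  have hA : 0 < A := div_pos (by linarith) hd0
  have hAB : A < B := (div_lt_div_iff_of_pos_right hd0).2 (by linarith)
  have hB : 0 < B := hA.trans hAB
  have hB1 : B ≤ 1 := by rw [div_le_one hd0]; linarith
  obtain ⟨i, hi, hv⟩ := exists_escape (T := f) (c := 0) (σ := 1) (κ := lam ^ r)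
    (E := 5 / 2 * delta lam r) (b := delta lam r * B ^ (2 * r)) (by linarith) (by positivity)
    (fun v h0 h => by rw [hf.eq_zero _ ⟨by linarith, by linarith⟩, pieceZero]; ring)
  refine ⟨i + 1, ?_⟩
  have ep : f p = 0 + 1 * (delta lam r * B ^ (2 * r)) := by
    have := hf.map_near_one hlam (u := 1 - p) (by linarith) (by linarith)
    rw [sub_sub_cancel] at this
    rw [this]; ring
  have eq : f q = 0 + 1 * (delta lam r * A ^ (2 * r)) := by
    have := hf.map_near_one hlam (u := 1 - q) (by linarith) (by linarith)
    rw [sub_sub_cancel] at this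
    rw [this]; ring
  rw [Function.iterate_succ_apply, Function.iterate_succ_apply, ep, eq, hv _ (by positivity) le_rfl,
    hv _ (by positivity) (by gcongr)]
  have key := mul_pow_sub_pow_le hA.le hAB.le (m := 2 * r) (by omega)
  have hqp : q - p = delta lam r * (B - A) := by
    simp only [A, B]
    field_simp
    ring
  rw [abs_sub_comm (0 + _), hqp, abs_of_pos (mul_pos hd0 (by linarith))]
  refine le_trans ?_ (le_abs_self _)
  set K := (lam ^ r) ^ i
  have hK : 0 < K := by positivity
  have h1 : 5 / 2 < K * B ^ (2 * r) := by
    refine lt_of_mul_lt_mul_right ?_ hd0.le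
    linarith
  have h2 : K * (B ^ (2 * r) * (B - A)) ≤ K * (B * (B ^ (2 * r) - A ^ (2 * r))) :=
    mul_le_mul_of_nonneg_left key hK.le
  have h3 : B * (K * (B ^ (2 * r) - A ^ (2 * r))) ≤ K * (B ^ (2 * r) - A ^ (2 * r)) := by
    have : 0 ≤ K * (B ^ (2 * r) - A ^ (2 * r)) :=
      mul_nonneg hK.le (sub_nonneg.2 (by gcongr))
    nlinarith
  have h4 : 5 / 2 * (B - A) ≤ K * B ^ (2 * r) * (B - A) :=
    mul_le_mul_of_nonneg_right h1.le (by linarith)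
  have h5 : 5 / 2 * (B - A) ≤ K * (B ^ (2 * r) - A ^ (2 * r)) := by linarith
  have h6 := mul_le_mul_of_nonneg_left h5 hd0.le
  have : 0 < delta lam r * (B - A) := mul_pos hd0 (by linarith)
  linarith

/-- When `[p, q]` reaches into the flat zone left of `1`, either the expanding part is the larger
one, or `f p` is in the linear zone of `0` and the second iterate regains the loss. -/
theorem IsConstructedMap.stretches_mid (hf : IsConstructedMap lam r s φ f) (hlam : 14 ≤ lam)
    (hr : 1 ≤ r) {p q : ℝ} (hp : 1 / 2 < p) (hpq : p < q) (hq : q < 1) : Stretches f p q := by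
  have hL := pow_ge hlam hr
  have hd0 := delta_pos (r := r) hlam
  have hd := delta_le hlam hr
  have hdL := delta_mul_pow (r := r) hlam
  rcases le_total (1 - delta lam r) p with hp1 | hp1
  · exact hf.stretches_near_one hlam hr hp1 hpq hq
  rcases le_total q (1 / 2 + delta lam r) with hq1 | hq1
  · have e1 : |p - 1 / 2| = p - 1 / 2 := abs_of_pos (by linarith)
    have e2 : |q - 1 / 2| = q - 1 / 2 := abs_of_pos (by linarith)
    refine (hf.stretches_near_half hlam hr (p := q) (q := p) ?_ ?_ ?_).symm
    · rw [e1, e2]; linarith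
    · rw [e2]; linarith
    · rw [e1, e2, abs_of_neg (by linarith)]; ring
  have core : ∀ q, 1 / 2 + delta lam r ≤ q → q ≤ 1 - delta lam r → p ≤ q →
      3 / 2 * (q - p) ≤ f p - f q := by
    intro q hq1 hq2 hpq
    have := hf.expandsOn_mid.le_of_margins (p := p) (q := q) (by linarith) (fun h => ?_)
      (fun h => ?_) hpq hq1 hp1
    · simpa [neg_add_eq_sub] using this
    · have e2 : |p - 1 / 2| = p - 1 / 2 := abs_of_pos (by linarith)
      have := hf.margin_half hlam (t := p) (by rw [e2]; linarith)
      rw [hf.map_half_edge hlam (t := 1 / 2 + delta lam r) (by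
        rw [abs_of_pos (by linarith)]; ring)]
      rw [e2] at this
      linarith
    · rw [le_antisymm hq2 h]; simp
  rcases le_total q (1 - delta lam r) with hq2 | hq2
  · refine ⟨1, ?_⟩
    rw [abs_of_pos (by linarith), abs_sub_comm]
    refine le_trans ?_ (le_abs_self _)
    have := core q hq1 hq2 hpq.le
    rw [Function.iterate_one]
    linarith
  have c1 := core (1 - delta lam r) (by linarith) le_rfl hp1
  have f1 : f (1 - delta lam r) = delta lam r := by
    rw [hf.map_near_one hlam hd0.le le_rfl, div_self hd0.ne', one_pow, mul_one]
  have fq : f q ≤ 1 - q ∧ 0 ≤ f q := by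
    have := hf.map_near_one hlam (u := 1 - q) (by linarith) (by linarith)
    rw [sub_sub_cancel] at this
    rw [this]
    have h0 : 0 ≤ (1 - q) / delta lam r := div_nonneg (by linarith) hd0.le
    have h1 : (1 - q) / delta lam r ≤ 1 := by rw [div_le_one hd0]; linarith
    refine ⟨?_, by positivity⟩
    have h2 : ((1 - q) / delta lam r) ^ (2 * r) ≤ (1 - q) / delta lam r :=
      pow_le_of_le_one h0 h1 (by omega)
    calc delta lam r * ((1 - q) / delta lam r) ^ (2 * r)
        ≤ delta lam r * ((1 - q) / delta lam r) := by gcongr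
      _ = 1 - q := by field_simp
  rw [f1] at c1
  rcases le_total (f p) (5 / 2 * delta lam r) with hfp | hfp
  · refine ⟨2, ?_⟩
    have e1 : f^[2] p = lam ^ r * f p := hf.eq_zero (f p) ⟨by linarith, hfp⟩
    have e2 : f^[2] q = lam ^ r * f q := hf.eq_zero (f q) ⟨fq.2, by linarith⟩
    rw [e1, e2, ← mul_sub, abs_mul, abs_of_pos (by linarith : 0 < lam ^ r),
      abs_of_pos (by linarith : 0 < q - p), abs_sub_comm, abs_of_pos (by linarith : 0 < f p - f q)]
    have : 14 * (f p - f q) ≤ lam ^ r * (f p - f q) :=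
      mul_le_mul_of_nonneg_right hL (by linarith)
    linarith
  · refine ⟨1, ?_⟩
    rw [Function.iterate_one, abs_of_pos (by linarith : 0 < q - p), abs_sub_comm,
      abs_of_pos (by linarith : 0 < f p - f q)]
    rcases le_total (1 - delta lam r - p) (delta lam r - (1 - q)) with h | h <;> linarith

/-- The least slope of `s_n` away from its extrema. -/
noncomputable def minSlope (lam : ℝ) (r n : ℕ) : ℝ := min (1 / 2) (slope lam r n)

theorem minSlope_pos (hlam : 14 ≤ lam) {n : ℕ} (hn : 1 ≤ n) : 0 < minSlope lam r n :=
  lt_min (by norm_num) (slope_pos hlam hn)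

theorem curv_mul_sq (hlam : 14 ≤ lam) : curv lam r * delta lam r ^ 2 = 1 / 4 := by
  have := (delta_pos (r := r) hlam).ne'
  rw [curv]
  field_simp

/-- Between a point of the quadratic zone of an extremum and the boundary of that zone, the average
slope of `s_n` is at least the least slope away from the extrema. -/
theorem le_curv_mul (hlam : 14 ≤ lam) (hr : 1 ≤ r) {u : ℝ} (h0 : 0 ≤ u) (hu : u ≤ delta lam r)
    (n : ℕ) :
    minSlope lam r n * (delta lam r - u) ≤ curv lam r * delta lam r ^ 2 - curv lam r * u ^ 2 := by
  have hd0 := delta_pos (r := r) hlam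
  have h1 := le_mul_sq_sub_sq (K := curv lam r) (c := 1 / 2) hd0 h0 hu (by norm_num) (by
    rw [curv_mul_sq hlam]; linarith [delta_le hlam hr])
  have h2 : minSlope lam r n * (delta lam r - u) ≤ 1 / 2 * (delta lam r - u) :=
    mul_le_mul_of_nonneg_right (min_le_left _ _) (by linarith)
  linarith

/-- The derivative of a function that is monotone around `t` is nonnegative there. -/
theorem abs_derivWithin_eq_of_monotoneOn {g : ℝ → ℝ} {A : Set ℝ} {a b t : ℝ}
    (hg : DifferentiableOn ℝ g A) (hsub : Icc a b ⊆ A)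
    (ht : t ∈ Ioo a b) (hm : MonotoneOn g (Icc a b)) :
    |derivWithin g A t| = derivWithin g A t := by
  have htI : t ∈ Icc a b := Ioo_subset_Icc_self ht
  rw [← derivWithin_subset hsub (uniqueDiffOn_Icc (ht.1.trans ht.2) t htI) (hg t (hsub htI))]
  exact abs_of_nonneg hm.derivWithin_nonneg

/-- The sign making `s_n` increasing on the lap `[j, j+1]`. -/
def lapSign (j : ℤ) : ℝ := if Even j then 1 else -1

theorem abs_lapSign (j : ℤ) : |lapSign j| = 1 := by
  unfold lapSign
  split_ifs <;> simp

/-- On the lap `[j, j+1]`, two points that are not in the same `δ`-neighbourhood of an extremum are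
separated by `s_n` at the rate `min(1/2, k_n)`. -/
theorem IsConstructedMap.lap_expands (hf : IsConstructedMap lam r s φ f) (hlam : 14 ≤ lam)
    (hr : 1 ≤ r) {n : ℕ} (hn : 1 ≤ n) {j : ℤ} (h0 : 0 ≤ j) (hj : j < osc lam n) {p q : ℝ}
    (hjp : j ≤ p) (hpq : p ≤ q) (hqj : q ≤ j + 1)
    (hl : 0 < j → j + delta lam r ≤ q) (hr' : j + 1 < osc lam n → p ≤ j + 1 - delta lam r) :
    minSlope lam r n * (q - p) ≤ lapSign j * s n q - lapSign j * s n p := by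
  have hd0 := delta_pos (r := r) hlam
  have hd := delta_le hlam hr
  have hj0 : (0 : ℝ) ≤ j := by exact_mod_cast h0
  have hjM : (j : ℝ) + 1 ≤ osc lam n := by exact_mod_cast hj
  set a : ℝ := if 0 < j then j + delta lam r else j with ha
  set b : ℝ := if j + 1 < osc lam n then j + 1 - delta lam r else j + 1 with hb
  have hja : (j : ℝ) ≤ a := by rw [ha]; split_ifs <;> linarith
  have haj : a ≤ j + delta lam r := by rw [ha]; split_ifs <;> linarith
  have hbj : b ≤ j + 1 := by rw [hb]; split_ifs <;> linarith
  have hjb : j + 1 - delta lam r ≤ b := by rw [hb]; split_ifs <;> linarith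
  have hab : a ≤ b := by linarith
  have hdiff : DifferentiableOn ℝ (s n) (Icc 0 (osc lam n : ℝ)) :=
    (hf.oscFamily.smooth n hn).differentiableOn (by simp)
  have hsub : Icc (j : ℝ) (j + 1) ⊆ Icc 0 (osc lam n : ℝ) := Icc_subset_Icc hj0 hjM
  have hmono : MonotoneOn (fun t => lapSign j * s n t) (Icc (j : ℝ) (j + 1)) := by
    rcases Int.even_or_odd j with h | h
    · simpa [lapSign, h] using (hf.oscFamily.increasing n hn j h0 hj h).monotoneOn
    · have := (hf.oscFamily.decreasing n hn j h0 hj h).antitoneOn.neg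
      simpa [lapSign, Int.not_even_iff_odd.2 h] using this
  have core : ExpandsOn (minSlope lam r n) (fun t => lapSign j * s n t) a b := by
    intro p q hp hpq hq
    refine mul_sub_le_of_le_derivWithin ((hdiff.mono ((Icc_subset_Icc hja hbj).trans
      hsub)).const_mul _) (fun t ht => ?_) hp hpq hq
    have htj : t ∈ Ioo (j : ℝ) (j + 1) := ⟨by linarith [ht.1], by linarith [ht.2]⟩
    have htM : t ∈ Icc 0 (osc lam n : ℝ) := hsub (Ioo_subset_Icc_self htj)
    rw [derivWithin_subset ((Icc_subset_Icc hja hbj).trans hsub)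
      (uniqueDiffOn_Icc (ht.1.trans ht.2) t (Ioo_subset_Icc_self ht)) ((hdiff t htM).const_mul _),
      ← abs_derivWithin_eq_of_monotoneOn (hdiff.const_mul _) hsub htj hmono,
      derivWithin_const_mul _ (hdiff t htM), abs_mul, abs_lapSign, one_mul]
    refine hf.oscFamily.le_deriv n hn t htM fun i hi0 hiM => ?_
    rcases lt_trichotomy i j with hij | rfl | hij
    · have h1 : (i : ℝ) + 1 ≤ j := by exact_mod_cast hij
      exact le_trans (by linarith [htj.1]) (le_abs_self _)
    · have := ht.1
      rw [ha, if_pos hi0] at this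
      exact le_trans (by linarith) (le_abs_self _)
    · rw [abs_sub_comm]
      rcases eq_or_lt_of_le (Int.add_one_le_iff.2 hij) with rfl | hij'
      · have := ht.2
        rw [hb, if_pos hiM] at this
        push_cast
        exact le_trans (by linarith) (le_abs_self _)
      · have h1 : (j : ℝ) + 1 + 1 ≤ i := by exact_mod_cast hij'
        exact le_trans (by linarith [htj.2]) (le_abs_self _)
  refine core.le_of_margins hab (fun hpa => ?_) (fun hbq => ?_) hpq ?_ ?_
  · by_cases hj1 : 0 < j
    · have ea : a = j + delta lam r := by rw [ha, if_pos hj1]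
      have s1 := hf.osc_at_int hn hj1 hj (u := delta lam r) (by rw [abs_of_pos hd0])
      have s2 := hf.osc_at_int hn hj1 hj (u := p - j)
        (by rw [abs_of_nonneg (by linarith)]; linarith)
      rw [add_sub_cancel] at s2
      rw [← ea] at s1
      have := le_curv_mul hlam hr (u := p - j) (by linarith) (by linarith) n
      rcases Int.even_or_odd j with h | h
      · simp only [lapSign, h, if_true, s1.2 h, s2.2 h]
        rw [ea]; linarith
      · simp only [lapSign, Int.not_even_iff_odd.2 h, if_false, s1.1 h, s2.1 h]
        rw [ea]; linarith
    · have ea : a = j := by rw [ha, if_neg hj1]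
      rw [le_antisymm (hpa) (ea ▸ hjp)]; simp
  · by_cases hj1 : j + 1 < osc lam n
    · have eb : b = j + 1 - delta lam r := by rw [hb, if_pos hj1]
      have s1 := hf.osc_at_int hn (j := j + 1) (by omega) hj1 (u := -delta lam r)
        (by rw [abs_neg, abs_of_pos hd0])
      have s2 := hf.osc_at_int hn (j := j + 1) (by omega) hj1 (u := q - (j + 1))
        (by rw [abs_of_nonpos (by linarith)]; linarith)
      push_cast at s1 s2
      rw [add_sub_cancel] at s2
      rw [← sub_eq_add_neg, ← eb] at s1
      have := le_curv_mul hlam hr (u := j + 1 - q) (by linarith) (by linarith) n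
      rcases Int.even_or_odd j with h | h
      · simp only [lapSign, h, if_true, s1.1 h.add_one, s2.1 h.add_one]
        rw [eb]; linarith
      · simp only [lapSign, Int.not_even_iff_odd.2 h, if_false, s1.2 h.add_one, s2.2 h.add_one]
        rw [eb]; linarith
    · have eb : b = j + 1 := by rw [hb, if_neg hj1]
      rw [le_antisymm (eb ▸ hqj) hbq]; simp
  · rw [ha]; split_ifs with h
    · exact hl h
    · linarith
  · rw [hb]; split_ifs with h
    · exact hr' h
    · linarith

theorem oscPt_sub (n : ℕ) (τ τ' : ℝ) : oscPt lam n τ - oscPt lam n τ' = (τ - τ') / zoom lam n := by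
  rw [oscPt, oscPt]; ring

/-- The factor `13/2` is the lower bound of `M_n min(1/2, k_n)`. -/
theorem IsConstructedMap.lap_stretch (hf : IsConstructedMap lam r s φ f) (hlam : 14 ≤ lam)
    (hr : 1 ≤ r) {n : ℕ} (hn : 1 ≤ n) {j : ℤ} (h0 : 0 ≤ j) (hj : j < osc lam n) {p q : ℝ}
    (hjp : j ≤ p) (hpq : p ≤ q) (hqj : q ≤ j + 1)
    (hl : 0 < j → j + delta lam r ≤ q) (hr' : j + 1 < osc lam n → p ≤ j + 1 - delta lam r) :
    13 / 2 * |oscPt lam n q - oscPt lam n p| ≤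
      |f^[n + 1] (oscPt lam n q) - f^[n + 1] (oscPt lam n p)| := by
  have hj0 : (0 : ℝ) ≤ j := by exact_mod_cast h0
  have hjM : (j : ℝ) + 1 ≤ osc lam n := by exact_mod_cast hj
  have h := hf.lap_expands hlam hr hn h0 hj hjp hpq hqj hl hr'
  have hz := zoom_pos hlam hn
  have hyx := xPt_lt_yPt hn
  rw [hf.iterate_oscPt hlam hr hn ⟨by linarith, by linarith⟩,
    hf.iterate_oscPt hlam hr hn ⟨by linarith, by linarith⟩, oscPt_sub,
    abs_of_nonneg (div_nonneg (by linarith) hz.le)]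
  have e : xPt n + (yPt n - xPt n) * s n q - (xPt n + (yPt n - xPt n) * s n p) =
    (yPt n - xPt n) * (s n q - s n p) := by ring
  have e2 : |s n q - s n p| = |lapSign j * s n q - lapSign j * s n p| := by
    rw [← mul_sub, abs_mul, abs_lapSign, one_mul]
  rw [e, abs_mul, abs_of_pos (by linarith : 0 < yPt n - xPt n), e2]
  refine le_trans ?_ (mul_le_mul_of_nonneg_left (h.trans (le_abs_self _)) (by linarith))
  have hm : 13 / 2 ≤ (osc lam n : ℝ) * minSlope lam r n := le_osc_mul_min hlam hr hn
  rw [← zoom_mul hn] at hm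
  have : (yPt n - xPt n) * (minSlope lam r n * (q - p)) =
      zoom lam n * (yPt n - xPt n) * minSlope lam r n * ((q - p) / zoom lam n) := by
    field_simp
  rw [this]
  exact mul_le_mul_of_nonneg_right hm (div_nonneg (by linarith) hz.le)

/-- Next to a maximum of the oscillations, the orbit first follows the periodic orbit of `y_n`. -/
theorem IsConstructedMap.stretches_near_max (hf : IsConstructedMap lam r s φ f) (hlam : 14 ≤ lam)
    (hr : 1 ≤ r) {n : ℕ} (hn : 1 ≤ n) {j : ℤ} (h0 : 0 < j) (hj : j < osc lam n) (hodd : Odd j)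
    {a b : ℝ} (hab : |a| < |b|) (hb : |b| ≤ delta lam r) (hside : |b - a| = |b| - |a|) :
    Stretches f (oscPt lam n (j + b)) (oscPt lam n (j + a)) := by
  have hL := pow_ge hlam hr
  have hd0 := delta_pos (r := r) hlam
  have hd := delta_le hlam hr
  have hz := zoom_pos hlam hn
  have hC := curv_pos (r := r) hlam
  have hyx : 0 < yPt n - xPt n := by linarith [xPt_lt_yPt hn]
  have hM := osc_ge hlam hn
  have hMi := osc_ge_int hlam hn
  have hj0 : (1 : ℝ) ≤ j := by exact_mod_cast h0
  have hjM : (j : ℝ) + 1 ≤ osc lam n := by exact_mod_cast hj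
  have ha := hab.le.trans hb
  have hb' := abs_le.1 hb
  have ha' := abs_le.1 ha
  have hb0 : 0 < |b| := lt_of_le_of_lt (abs_nonneg _) hab
  have hbne : b ≠ 0 := abs_pos.1 hb0
  set W := (yPt n - xPt n) * curv lam r
  have hW : 0 < W := by positivity
  obtain ⟨i, hi, hv⟩ := exists_escape (T := f^[n + 1]) (c := yPt n) (σ := -1) (κ := 2 * lam ^ r)
    (E := delta lam r / zoom lam n) (b := W * |b| ^ 2) (by linarith) (by positivity)
    (fun v h0 h => hf.iterate_yPt_left hlam hr hn h0 h)
  have eb : f^[n + 1] (oscPt lam n (j + b)) = yPt n + -1 * (W * |b| ^ 2) := by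
    rw [hf.iterate_oscPt hlam hr hn ⟨by linarith, by linarith⟩,
      (hf.osc_at_int hn h0 hj hb).1 hodd, sq_abs]
    ring
  have ea : f^[n + 1] (oscPt lam n (j + a)) = yPt n + -1 * (W * |a| ^ 2) := by
    rw [hf.iterate_oscPt hlam hr hn ⟨by linarith, by linarith⟩,
      (hf.osc_at_int hn h0 hj ha).1 hodd, sq_abs]
    ring
  set K := (2 * lam ^ r) ^ i
  have hK : 0 < K := by positivity
  have fb : f^[(n + 1) * i + (n + 1)] (oscPt lam n (j + b)) = yPt n + -1 * (K * (W * |b| ^ 2)) := by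
    rw [Function.iterate_add_apply, eb, ← iterate_iterate, hv _ (by positivity) le_rfl]
  have fa : f^[(n + 1) * i + (n + 1)] (oscPt lam n (j + a)) = yPt n + -1 * (K * (W * |a| ^ 2)) := by
    rw [Function.iterate_add_apply, ea, ← iterate_iterate, hv _ (by positivity) (by gcongr)]
  have hdist : |oscPt lam n (j + a) - oscPt lam n (j + b)| = (|b| - |a|) / zoom lam n := by
    rw [oscPt_sub, add_sub_add_left_eq_sub, abs_div, abs_sub_comm a b, hside, abs_of_pos hz]
  -- At the time of escape the point at distance `|b|` has been moved to the distance
  -- `V = K * (W * |b| ^ 2)` from `y_n`, and, the germ being quadratic, lengths have been multiplied by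
  -- `V * zoom / |b|` at least. As `|b| ≤ δ`, this is at least `2` if `V` is twice the size of the
  -- linear zone. In any case it is at least `1`.
  rcases le_total (2 * (delta lam r / zoom lam n)) (K * (W * |b| ^ 2)) with hV | hV
  · refine ⟨(n + 1) * i + (n + 1), ?_⟩
    rw [fa, fb, hdist]
    refine le_trans ?_ (le_abs_self _)
    have := le_mul_sq_sub_sq (K := K * W) (c := 2 * (1 / zoom lam n)) hb0 (abs_nonneg a) hab.le
      (by positivity) (by
        refine le_trans ?_ (hV.trans_eq (by ring))
        rw [mul_assoc, div_mul_eq_mul_div, one_mul]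
        gcongr)
    have h2 : 0 ≤ (1 / zoom lam n) * (|b| - |a|) := mul_nonneg (by positivity) (by linarith)
    rw [div_eq_mul_one_div (|b| - |a|)]
    linarith
  -- Otherwise the escaping points are in the steep part of the last lap, where one more turn
  -- multiplies lengths by `13/2`.
  · refine ⟨(n + 1) + ((n + 1) * i + (n + 1)), ?_⟩
    rw [Function.iterate_add_apply, Function.iterate_add_apply _ (n + 1), fa, fb, hdist]
    have conv : ∀ v : ℝ, yPt n + -1 * v = oscPt lam n (osc lam n - zoom lam n * v) := fun v => by
      rw [← oscPt_end hlam hn, oscPt, oscPt]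
      field_simp
      ring
    have hVz : zoom lam n * (K * (W * |b| ^ 2)) ≤ 2 * delta lam r := by
      have := mul_le_mul_of_nonneg_left hV hz.le
      refine this.trans (le_of_eq ?_)
      field_simp
    have hab2 : zoom lam n * (K * (W * |a| ^ 2)) ≤ zoom lam n * (K * (W * |b| ^ 2)) := by gcongr
    have ha2 : 0 ≤ zoom lam n * (K * (W * |a| ^ 2)) := by positivity
    have h := hf.lap_stretch hlam hr hn (j := osc lam n - 1) (by omega) (by omega)
      (p := osc lam n - zoom lam n * (K * (W * |b| ^ 2)))
      (q := osc lam n - zoom lam n * (K * (W * |a| ^ 2))) (by push_cast; linarith) (by linarith)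
      (by push_cast; linarith) (fun _ => by push_cast; linarith) (fun h => by omega)
    rw [← conv, ← conv] at h
    refine le_trans ?_ h
    have := le_mul_sq_sub_sq (K := K * W) (c := 1 / zoom lam n) hb0 (abs_nonneg a) hab.le
      (by positivity) (by
        refine le_trans ?_ (hi.le.trans_eq (by ring))
        rw [div_mul_eq_mul_div, one_mul]
        gcongr)
    have h2 : 0 ≤ (1 / zoom lam n) * (|b| - |a|) := mul_nonneg (by positivity) (by linarith)
    have h3 := le_abs_self (yPt n + -1 * (K * (W * |a| ^ 2)) - (yPt n + -1 * (K * (W * |b| ^ 2))))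
    rw [div_eq_mul_one_div (|b| - |a|)]
    linarith

/-- Next to a minimum of the oscillations, the orbit first follows the periodic orbit of
`y_{n+1}`. -/
theorem IsConstructedMap.stretches_near_min (hf : IsConstructedMap lam r s φ f) (hlam : 14 ≤ lam)
    (hr : 1 ≤ r) {n : ℕ} (hn : 1 ≤ n) {j : ℤ} (h0 : 0 < j) (hj : j < osc lam n) (heven : Even j)
    {a b : ℝ} (hab : |a| < |b|) (hb : |b| ≤ delta lam r) (hside : |b - a| = |b| - |a|) :
    Stretches f (oscPt lam n (j + b)) (oscPt lam n (j + a)) := by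
  have hL := pow_ge hlam hr
  have hd0 := delta_pos (r := r) hlam
  have hd := delta_le hlam hr
  have hz := zoom_pos hlam hn
  have hC := curv_pos (r := r) hlam
  have hyx : 0 < yPt n - xPt n := by linarith [xPt_lt_yPt hn]
  have hM := osc_ge hlam hn
  have hj0 : (1 : ℝ) ≤ j := by exact_mod_cast h0
  have hjM : (j : ℝ) + 1 ≤ osc lam n := by exact_mod_cast hj
  have ha := hab.le.trans hb
  have hb' := abs_le.1 hb
  have ha' := abs_le.1 ha
  have hb0 : 0 < |b| := lt_of_le_of_lt (abs_nonneg _) hab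
  have hbne : b ≠ 0 := abs_pos.1 hb0
  set W := (yPt n - xPt n) * curv lam r with hWdef
  have hW : 0 < W := by positivity
  obtain ⟨i, hi, hv⟩ := exists_escape (T := f^[n + 2]) (c := yPt (n + 1)) (σ := 1)
    (κ := 2 * lam ^ r) (E := wPt lam r n - yPt (n + 1)) (b := W * |b| ^ 2) (by linarith)
    (by positivity) (fun v h0 h => hf.iterate_affine hlam hn h0 h)
  have eb : f^[n + 1] (oscPt lam n (j + b)) = yPt (n + 1) + 1 * (W * |b| ^ 2) := by
    rw [hf.iterate_oscPt hlam hr hn ⟨by linarith, by linarith⟩,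
      (hf.osc_at_int hn h0 hj hb).2 heven, sq_abs, ← xPt_sub_mMin hn]
    ring
  have ea : f^[n + 1] (oscPt lam n (j + a)) = yPt (n + 1) + 1 * (W * |a| ^ 2) := by
    rw [hf.iterate_oscPt hlam hr hn ⟨by linarith, by linarith⟩,
      (hf.osc_at_int hn h0 hj ha).2 heven, sq_abs, ← xPt_sub_mMin hn]
    ring
  set K := (2 * lam ^ r) ^ i
  have hK : 0 < K := by positivity
  refine ⟨(n + 2) * i + (n + 1), ?_⟩
  rw [Function.iterate_add_apply _ ((n + 2) * i) (n + 1) (oscPt lam n (j + a)),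
    Function.iterate_add_apply _ ((n + 2) * i) (n + 1), eb, ea, ← iterate_iterate,
    ← iterate_iterate, hv _ (by positivity) le_rfl, hv _ (by positivity) (by gcongr),
    oscPt_sub, add_sub_add_left_eq_sub, abs_div, abs_sub_comm a b, hside, abs_of_pos hz,
    abs_sub_comm (yPt (n + 1) + _)]
  refine le_trans ?_ (le_abs_self _)
  -- The linear zone of `y_{n+1}` is at least four times that of `y_n`, so that the escape alone gives
  -- the factor `4`.
  have hzone : 4 * (delta lam r / zoom lam n) ≤ wPt lam r n - yPt (n + 1) := by
    have h1 : (1 : ℝ) ≤ n := by exact_mod_cast hn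
    rw [wPt_sub_yPt hlam hn, mul_div_assoc', div_le_iff₀ hz, zoom, yPt_sub_xPt, xPt_sub_yPt hn]
    have e : ((n : ℝ) + 2) / (2 * n * (n + 1) ^ 2) * (delta lam r / 2) *
        ((osc lam n : ℝ) / (1 / (2 * (n : ℝ) ^ 2))) =
        delta lam r * (osc lam n * (n * (n + 2) / (2 * ((n : ℝ) + 1) ^ 2))) := by
      field_simp
    have e2 : (3 : ℝ) / 8 ≤ n * (n + 2) / (2 * ((n : ℝ) + 1) ^ 2) := by
      rw [div_le_div_iff₀ (by norm_num) (by positivity)]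
      nlinarith
    have e3 : (13 : ℝ) * (3 / 8) ≤ osc lam n * (n * (n + 2) / (2 * ((n : ℝ) + 1) ^ 2)) := by gcongr
    rw [e]
    nlinarith
  have := le_mul_sq_sub_sq (K := K * W) (c := 4 * (1 / zoom lam n)) hb0 (abs_nonneg a) hab.le
    (by positivity) (by
      refine le_trans ?_ (hzone.trans (hi.le.trans_eq (by ring)))
      rw [mul_assoc, div_mul_eq_mul_div, one_mul]
      gcongr)
  have h2 : 0 ≤ (1 / zoom lam n) * (|b| - |a|) := mul_nonneg (by positivity) (by linarith)
  rw [div_eq_mul_one_div (|b| - |a|)]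
  linarith

theorem IsConstructedMap.stretches_near_extremum (hf : IsConstructedMap lam r s φ f)
    (hlam : 14 ≤ lam) (hr : 1 ≤ r) {n : ℕ} (hn : 1 ≤ n) {j : ℤ} (h0 : 0 < j)
    (hj : j < osc lam n) {a b : ℝ} (hab : |a| < |b|) (hb : |b| ≤ delta lam r)
    (hside : |b - a| = |b| - |a|) :
    Stretches f (oscPt lam n (j + b)) (oscPt lam n (j + a)) := by
  rcases Int.even_or_odd j with h | h
  · exact hf.stretches_near_min hlam hr hn h0 hj h hab hb hside
  · exact hf.stretches_near_max hlam hr hn h0 hj h hab hb hside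

theorem IsConstructedMap.stretches_lap (hf : IsConstructedMap lam r s φ f) (hlam : 14 ≤ lam)
    (hr : 1 ≤ r) {n : ℕ} (hn : 1 ≤ n) {j : ℤ} (h0 : 0 ≤ j) (hj : j < osc lam n) {p q : ℝ}
    (hjp : j < p) (hpq : p < q) (hqj : q < j + 1) :
    Stretches f (oscPt lam n p) (oscPt lam n q) := by
  by_cases h1 : 0 < j ∧ q < j + delta lam r
  · have ep : |p - j| = p - j := abs_of_pos (by linarith)
    have eq : |q - j| = q - j := abs_of_pos (by linarith)
    have := hf.stretches_near_extremum hlam hr hn h1.1 hj (a := p - j) (b := q - j)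
      (by rw [ep, eq]; linarith) (by rw [eq]; linarith [h1.2])
      (by rw [ep, eq, abs_of_pos (by linarith)])
    rw [add_sub_cancel, add_sub_cancel] at this
    exact this.symm
  by_cases h2 : j + 1 < osc lam n ∧ j + 1 - delta lam r < p
  · have ep : |p - (j + 1)| = j + 1 - p := by rw [abs_of_neg (by linarith)]; ring
    have eq : |q - (j + 1)| = j + 1 - q := by rw [abs_of_neg (by linarith)]; ring
    have := hf.stretches_near_extremum hlam hr hn (j := j + 1) (by omega) h2.1
      (a := q - (j + 1)) (b := p - (j + 1))
      (by rw [ep, eq]; linarith) (by rw [ep]; linarith [h2.2])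
      (by rw [ep, eq, abs_of_neg (by linarith)]; ring)
    push_cast at this
    rwa [add_sub_cancel, add_sub_cancel] at this
  · have := hf.lap_stretch hlam hr hn h0 hj hjp.le hpq.le hqj.le
      (fun h => by by_contra hc; exact h1 ⟨h, not_le.1 hc⟩)
      (fun h => by by_contra hc; exact h2 ⟨h, not_le.1 hc⟩)
    refine ⟨n + 1, le_trans ?_ this⟩
    exact mul_le_mul_of_nonneg_right (by norm_num) (abs_nonneg _)

/-- A segment without special points is stretched by some iterate. -/
theorem IsConstructedMap.stretches (hf : IsConstructedMap lam r s φ f) (hlam : 14 ≤ lam)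
    (hr : 1 ≤ r) {p q : ℝ} (hp : 0 ≤ p) (hpq : p < q) (hq : q ≤ 4)
    (h : ∀ t ∈ Icc p q, ¬ IsSpecial lam t) : Stretches f p q := by
  -- a special point to the right of `p` is also to the right of `q`
  have cut : ∀ t, IsSpecial lam t → p ≤ t → p < t ∧ q < t := fun t ht hpt => by
    have hqt : q < t := by
      by_contra hc
      exact h t ⟨hpt, not_lt.1 hc⟩ ht
    exact ⟨hpq.trans hqt, hqt⟩
  rcases le_total p (1 / 2) with h1 | h1
  · exact hf.stretches_left hlam hr hp hpq (cut _ (by simp [IsSpecial]) h1).2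
  rcases le_total p 1 with h2 | h2
  · refine hf.stretches_mid hlam hr (lt_of_le_of_ne h1 fun he => ?_) hpq
      (cut _ (by simp [IsSpecial]) h2).2
    exact h p ⟨le_rfl, hpq.le⟩ (by simp [IsSpecial, ← he])
  have hp1 : 1 < p := lt_of_le_of_ne h2 fun he =>
    h p ⟨le_rfl, hpq.le⟩ (by simp [IsSpecial, ← he])
  rcases le_or_gt (yPt 1) p with h3 | h3
  · exact Stretches.of_expandsOn (c := 3 / 2) (g := f) 1 (by norm_num) hpq.le (le_abs_self _)
      (hf.expandsOn_right hlam hr p q h3 hpq.le hq)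
  obtain ⟨n, hn, hn1, hn2⟩ := exists_yPt_le hp1 h3
  have hz := zoom_pos hlam hn
  have special : ∀ j : ℤ, 0 ≤ j → j ≤ osc lam n → IsSpecial lam (oscPt lam n j) :=
    fun j h0 hj => Or.inr (Or.inr (Or.inr (Or.inr ⟨n, hn, j, h0, hj, rfl⟩)))
  have hMi := osc_ge_int hlam hn
  rcases le_or_gt p (xPt n) with h4 | h4
  · have := cut (xPt n) (by
      have := special 0 le_rfl (by omega)
      rwa [Int.cast_zero, oscPt_zero] at this) h4
    exact Stretches.of_expandsOn (c := 4 / 3) (g := f^[n + 1]) (n + 1) (by norm_num) hpq.le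
      (le_abs_self _) (hf.expandsOn_iterate_conn hlam hr hn p q hn1 hpq.le this.2.le)
  · set τ := zoom lam n * (p - xPt n) with hτ
    have hτ0 : 0 < τ := mul_pos hz (by linarith)
    have hτM : τ < osc lam n := by
      rw [hτ, ← zoom_mul hn]
      exact mul_lt_mul_of_pos_left (by linarith) hz
    have hj0 : 0 ≤ ⌊τ⌋ := Int.floor_nonneg.2 hτ0.le
    have hjM : ⌊τ⌋ < osc lam n := Int.floor_lt.2 hτM
    have ep : oscPt lam n τ = p := oscPt_zoom hlam hn p
    have eq : oscPt lam n (zoom lam n * (q - xPt n)) = q := oscPt_zoom hlam hn q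
    have hlt : ∀ a b : ℝ, oscPt lam n a < oscPt lam n b ↔ a < b := fun a b => by
      rw [oscPt, oscPt, add_lt_add_iff_left, div_lt_div_iff_of_pos_right hz]
    have hle : ∀ a b : ℝ, oscPt lam n a ≤ oscPt lam n b ↔ a ≤ b := fun a b => by
      rw [oscPt, oscPt, add_le_add_iff_left, div_le_div_iff_of_pos_right hz]
    have c1 := cut (oscPt lam n ((⌊τ⌋ + 1 : ℤ) : ℝ)) (special _ (by omega) (by omega)) (by
      rw [← ep, hle]
      push_cast
      exact (Int.lt_floor_add_one τ).le)
    rw [← ep, ← eq]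
    refine hf.stretches_lap hlam hr hn hj0 hjM (lt_of_le_of_ne (Int.floor_le τ) fun he => ?_) ?_ ?_
    · refine h p ⟨le_rfl, hpq.le⟩ ?_
      rw [← ep, ← he]
      exact special _ hj0 hjM.le
    · rw [← hlt, ep, eq]; exact hpq
    · rw [← hlt, eq]
      have := c1.2
      push_cast at this
      exact this

/-- Every nondegenerate interval is eventually mapped over `[0, 4]`: it is stretched until it meets
a special point. -/
theorem IsConstructedMap.covers (hf : IsConstructedMap lam r s φ f) (hlam : 14 ≤ lam)
    (hr : 1 ≤ r) {p q : ℝ} (hp : p ∈ Icc (0 : ℝ) 4) (hq : q ∈ Icc (0 : ℝ) 4) (hpq : p ≠ q) :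
    Covers f (uIcc p q) := by
  have hc := hf.continuousOn hlam hr
  have hm := hf.mapsTo hlam hr
  have key : ∀ i : ℕ, ∀ p ∈ Icc (0 : ℝ) 4, ∀ q ∈ Icc (0 : ℝ) 4, p < q →
      4 < (5 / 4 : ℝ) ^ i * (q - p) → Covers f (uIcc p q) := by
    intro i
    induction i with
    | zero =>
      intro p hp q hq _ h
      rw [pow_zero, one_mul] at h
      linarith [hp.1, hq.2]
    | succ i ih =>
      intro p hp q hq hlt h
      by_cases hs : ∃ t ∈ Icc p q, IsSpecial lam t
      · obtain ⟨t, ht, hst⟩ := hs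
        rcases ne_or_eq p t with hne | rfl
        · refine (hf.covers_special hlam hr hst hp hne).mono ?_
          rw [uIcc_comm]
          exact uIcc_subset_of_mem (by rwa [uIcc_of_le hlt.le])
        · exact hf.covers_special hlam hr hst hq hlt.ne'
      · push Not at hs
        obtain ⟨k, hk⟩ := hf.stretches hlam hr hp.1 hlt hq.2 hs
        rw [abs_of_pos (by linarith)] at hk
        refine Covers.of_uIcc hc hm hp hq k ?_
        have hp' := hm.iterate k hp
        have hq' := hm.iterate k hq
        have hpow : (5 / 4 : ℝ) ^ (i + 1) * (q - p) ≤ (5 / 4) ^ i * |f^[k] q - f^[k] p| := by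
          rw [pow_succ, mul_assoc]
          gcongr
        rcases lt_trichotomy (f^[k] p) (f^[k] q) with h1 | h1 | h1
        · rw [abs_of_pos (by linarith)] at hpow
          exact ih _ hp' _ hq' h1 (by linarith)
        · rw [h1, sub_self, abs_zero] at hk
          linarith
        · rw [abs_of_neg (by linarith), neg_sub] at hpow
          rw [uIcc_comm]
          exact ih _ hq' _ hp' h1 (by linarith)
  rcases lt_or_gt_of_ne hpq with h | h
  · obtain ⟨i, hi⟩ := pow_unbounded_of_one_lt (4 / (q - p)) (by norm_num : (1 : ℝ) < 5 / 4)
    exact key i p hp q hq h ((div_lt_iff₀ (by linarith)).1 hi)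
  · obtain ⟨i, hi⟩ := pow_unbounded_of_one_lt (4 / (p - q)) (by norm_num : (1 : ℝ) < 5 / 4)
    rw [uIcc_comm]
    exact key i q hq p hp h ((div_lt_iff₀ (by linarith)).1 hi)

theorem IsConstructedMap.exists_image_eq (hf : IsConstructedMap lam r s φ f) (hlam : 14 ≤ lam)
    (hr : 1 ≤ r) {J : Set ℝ} (hJ : J ⊆ Icc 0 4) (ho : J.OrdConnected) (hn : J.Nontrivial) :
    ∃ k : ℕ, f^[k] '' J = Icc 0 4 := by
  obtain ⟨p, hp, q, hq, hpq⟩ := hn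
  obtain ⟨k, hk⟩ := (hf.covers hlam hr (hJ hp) (hJ hq) hpq).mono (ho.uIcc_subset hp hq)
  refine ⟨k, Subset.antisymm ?_ hk⟩
  exact (((hf.mapsTo hlam hr).iterate k).mono_left hJ).image_subset

end Map

/-- If every nondegenerate subinterval is eventually mapped onto the whole interval, then the map is
topologically mixing. -/
theorem isTopMixing_of_exists_image_eq {f : ℝ → ℝ} {a b : ℝ} (hab : a < b)
    (hm : MapsTo f (Icc a b) (Icc a b)) (h : ∀ J : Set ℝ, J ⊆ Icc a b → J.OrdConnected →
      J.Nontrivial → ∃ k : ℕ, f^[k] '' J = Icc a b) :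
    IsTopMixing (hm.restrict f (Icc a b) (Icc a b)) := by
  have hnt : (Icc a b).Nontrivial := ⟨a, ⟨le_rfl, hab.le⟩, b, ⟨hab.le, le_rfl⟩, hab.ne⟩
  have hsurj : f '' Icc a b = Icc a b := by
    obtain ⟨k, hk⟩ := h (Icc a b) subset_rfl ordConnected_Icc hnt
    refine Subset.antisymm hm.image_subset ?_
    rcases Nat.eq_zero_or_pos k with rfl | hk0
    -- An interval of half the size is mapped onto `[a, b]` after at least one step.
    · have hsub : Icc a ((a + b) / 2) ⊆ Icc a b := Icc_subset_Icc_right (by linarith)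
      obtain ⟨k, hk⟩ := h (Icc a ((a + b) / 2)) hsub ordConnected_Icc
        ⟨a, ⟨le_rfl, by linarith⟩, (a + b) / 2, ⟨by linarith, le_rfl⟩, by linarith⟩
      rcases Nat.eq_zero_or_pos k with rfl | hk0
      · have : b ∈ f^[0] '' Icc a ((a + b) / 2) := by rw [hk]; exact ⟨hab.le, le_rfl⟩
        rw [Function.iterate_zero, image_id] at this
        linarith [this.2]
      · obtain ⟨m, rfl⟩ : ∃ m, k = m + 1 := ⟨k - 1, by omega⟩
        rw [Function.iterate_succ', image_comp] at hk
        rw [← hk]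
        exact image_mono (((hm.iterate m).mono_left hsub).image_subset.trans (hk ▸ subset_rfl))
    · obtain ⟨m, rfl⟩ : ∃ m, k = m + 1 := ⟨k - 1, by omega⟩
      rw [Function.iterate_succ', image_comp] at hk
      conv_lhs => rw [← hk]
      exact image_mono (hm.iterate m).image_subset
  intro U V hU hV ⟨u, hu⟩ hVne
  obtain ⟨V', hV', rfl⟩ := isOpen_induced_iff.1 hV
  obtain ⟨v, hv⟩ := hVne
  obtain ⟨J, hJV, hJ, hJo, hJn⟩ : ∃ J : Set ℝ, J ⊆ V' ∧ J ⊆ Icc a b ∧ J.OrdConnected ∧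
      J.Nontrivial := by
    obtain ⟨ε, hε, hball⟩ := Metric.isOpen_iff.1 hV' v hv
    refine ⟨Metric.ball (v : ℝ) ε ∩ Icc a b, inter_subset_left.trans hball, inter_subset_right,
      ?_, ?_⟩
    · rw [Real.ball_eq_Ioo]
      exact ordConnected_Ioo.inter ordConnected_Icc
    · have hva := v.2.1
      have hvb := v.2.2
      rcases lt_or_ge (v : ℝ) b with h1 | h1
      · have h2 : 0 < min (ε / 2) (b - v) := lt_min (by linarith) (by linarith)
        have h3 := min_le_left (ε / 2) (b - v)
        have h4 := min_le_right (ε / 2) (b - v)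
        refine ⟨v, ⟨Metric.mem_ball_self hε, v.2⟩, v + min (ε / 2) (b - v), ⟨?_, ?_, ?_⟩, ?_⟩
        · rw [Real.ball_eq_Ioo]; constructor <;> linarith
        · linarith
        · linarith
        · linarith
      · have h2 : 0 < min (ε / 2) (v - a) := lt_min (by linarith) (by linarith)
        have h3 := min_le_left (ε / 2) (v - a)
        have h4 := min_le_right (ε / 2) (v - a)
        refine ⟨v, ⟨Metric.mem_ball_self hε, v.2⟩, v - min (ε / 2) (v - a), ⟨?_, ?_, ?_⟩, ?_⟩
        · rw [Real.ball_eq_Ioo]; constructor <;> linarith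
        · linarith
        · linarith
        · linarith
  obtain ⟨k, hk⟩ := h J hJ hJo hJn
  refine ⟨k, fun n hn => ?_⟩
  have hon : ∀ n, k ≤ n → f^[n] '' J = Icc a b := fun n hn => by
    induction n, hn using Nat.le_induction with
    | base => exact hk
    | succ n _ ih => rw [Function.iterate_succ', image_comp, ih, hsurj]
  have : (u : ℝ) ∈ f^[n] '' J := by rw [hon n hn]; exact u.2
  obtain ⟨x, hx, hxu⟩ := this
  refine ⟨⟨x, hJ hx⟩, ?_, hJV hx⟩
  have e : (hm.restrict f (Icc a b) (Icc a b))^[n] ⟨x, hJ hx⟩ = u := by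
    apply Subtype.ext
    rw [← hxu, MapsTo.iterate_restrict]
    rfl
  rw [mem_preimage, e]
  exact hu

/-! ### Smooth interpolation with bounded derivatives -/

/-- A smooth cut-off, equal to `1` on `]-∞, a]` and to `0` on `[a + ε, ∞[`. -/
noncomputable def leftCut (a ε t : ℝ) : ℝ := Real.smoothTransition ((a + ε - t) / ε)

/-- A smooth cut-off, equal to `0` on `]-∞, b - ε]` and to `1` on `[b, ∞[`. -/
noncomputable def rightCut (b ε t : ℝ) : ℝ := Real.smoothTransition ((t - (b - ε)) / ε)

theorem contDiff_leftCut (a ε : ℝ) : ContDiff ℝ ∞ (leftCut a ε) :=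
  Real.smoothTransition.contDiff.comp (by fun_prop : ContDiff ℝ ∞ fun t : ℝ => (a + ε - t) / ε)

theorem contDiff_rightCut (b ε : ℝ) : ContDiff ℝ ∞ (rightCut b ε) :=
  Real.smoothTransition.contDiff.comp (by fun_prop : ContDiff ℝ ∞ fun t : ℝ => (t - (b - ε)) / ε)

theorem leftCut_mem (a ε t : ℝ) : leftCut a ε t ∈ Icc (0 : ℝ) 1 :=
  ⟨Real.smoothTransition.nonneg _, Real.smoothTransition.le_one _⟩

theorem rightCut_mem (b ε t : ℝ) : rightCut b ε t ∈ Icc (0 : ℝ) 1 :=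
  ⟨Real.smoothTransition.nonneg _, Real.smoothTransition.le_one _⟩

theorem leftCut_eq_one {a ε t : ℝ} (hε : 0 < ε) (h : t ≤ a) : leftCut a ε t = 1 :=
  Real.smoothTransition.one_of_one_le (by rw [le_div_iff₀ hε]; linarith)

theorem leftCut_eq_zero {a ε t : ℝ} (hε : 0 < ε) (h : a + ε ≤ t) : leftCut a ε t = 0 :=
  Real.smoothTransition.zero_of_nonpos (div_nonpos_of_nonpos_of_nonneg (by linarith) hε.le)

theorem rightCut_eq_one {b ε t : ℝ} (hε : 0 < ε) (h : b ≤ t) : rightCut b ε t = 1 :=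
  Real.smoothTransition.one_of_one_le (by rw [le_div_iff₀ hε]; linarith)

theorem rightCut_eq_zero {b ε t : ℝ} (hε : 0 < ε) (h : t ≤ b - ε) : rightCut b ε t = 0 :=
  Real.smoothTransition.zero_of_nonpos (div_nonpos_of_nonpos_of_nonneg (by linarith) hε.le)

/-- The derivative of a join: `P` to the left of `a`, `Q` to the right of `b`, and the constant `c`
in between, blended over intervals of length `ε`. -/
noncomputable def blend (a b ε : ℝ) (P Q : ℝ → ℝ) (c t : ℝ) : ℝ :=
  leftCut a ε t * P t + rightCut b ε t * Q t + c * (1 - leftCut a ε t - rightCut b ε t)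

theorem contDiff_blend {a b ε : ℝ} {P Q : ℝ → ℝ} (hP : ContDiff ℝ ∞ P) (hQ : ContDiff ℝ ∞ Q)
    (c : ℝ) : ContDiff ℝ ∞ (blend a b ε P Q c) := by
  have h1 := contDiff_leftCut a ε
  have h2 := contDiff_rightCut b ε
  exact ((h1.mul hP).add (h2.mul hQ)).add (contDiff_const.mul ((contDiff_const.sub h1).sub h2))

theorem blend_mem {a b ε : ℝ} {P Q : ℝ → ℝ} {c m M t : ℝ} (hε : 0 < ε) (hab : a + ε ≤ b - ε)
    (ht : t ∈ Icc a b) (hc : c ∈ Icc m M) (hP : ∀ t ∈ Icc a (a + ε), P t ∈ Icc m M)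
    (hQ : ∀ t ∈ Icc (b - ε) b, Q t ∈ Icc m M) : blend a b ε P Q c t ∈ Icc m M := by
  have hl := leftCut_mem a ε t
  have hr := rightCut_mem b ε t
  have conv : ∀ θ x y : ℝ, θ ∈ Icc (0 : ℝ) 1 → x ∈ Icc m M → y ∈ Icc m M →
      θ * x + (1 - θ) * y ∈ Icc m M := fun θ x y hθ hx hy =>
    (convex_Icc m M) hx hy hθ.1 (by linarith [hθ.2]) (by ring)
  unfold blend
  rcases le_total t (a + ε) with h | h
  · rw [rightCut_eq_zero hε (h.trans hab)]
    have := conv _ _ _ hl (hP t ⟨ht.1, h⟩) hc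
    convert this using 1; ring
  · rw [leftCut_eq_zero hε h]
    rcases le_total t (b - ε) with h' | h'
    · rw [rightCut_eq_zero hε h']
      convert hc using 1; ring
    · have := conv _ _ _ hr (hQ t ⟨h', ht.2⟩) hc
      convert this using 1; ring

theorem integral_mem_Icc_of_mem {g : ℝ → ℝ} {u v m M : ℝ} (huv : u ≤ v) (hg : Continuous g)
    (h : ∀ t ∈ Icc u v, g t ∈ Icc m M) :
    ∫ t in u..v, g t ∈ Icc (m * (v - u)) (M * (v - u)) := by
  have h1 := intervalIntegral.integral_mono_on (μ := MeasureTheory.volume) huv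
    (intervalIntegrable_const (c := m)) (hg.intervalIntegrable u v) (fun t ht => (h t ht).1)
  have h2 := intervalIntegral.integral_mono_on (μ := MeasureTheory.volume) huv
    (hg.intervalIntegrable u v) (intervalIntegrable_const (c := M)) (fun t ht => (h t ht).2)
  rw [intervalIntegral.integral_const, smul_eq_mul] at h1 h2
  exact ⟨by linarith, by linarith⟩

/-- The integral over `[a, b]` of a function with separate bounds on the margins and the core. -/
theorem integral_mem_of_margins {g : ℝ → ℝ} {a b ε m₀ M₀ m₁ M₁ : ℝ} (hε : 0 < ε)
    (hab : a + ε ≤ b - ε) (hg : Continuous g) (h₁ : ∀ t ∈ Icc a (a + ε), g t ∈ Icc m₀ M₀)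
    (h₂ : ∀ t ∈ Icc (a + ε) (b - ε), g t ∈ Icc m₁ M₁) (h₃ : ∀ t ∈ Icc (b - ε) b, g t ∈ Icc m₀ M₀) :
    ∫ t in a..b, g t ∈
      Icc (2 * m₀ * ε + m₁ * (b - a - 2 * ε)) (2 * M₀ * ε + M₁ * (b - a - 2 * ε)) := by
  have i1 := integral_mem_Icc_of_mem (by linarith) hg h₁
  have i2 := integral_mem_Icc_of_mem hab hg h₂
  have i3 := integral_mem_Icc_of_mem (by linarith) hg h₃
  have e := intervalIntegral.integral_add_adjacent_intervals (μ := MeasureTheory.volume)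
    (hg.intervalIntegrable a (a + ε)) (hg.intervalIntegrable (a + ε) (b - ε))
  have e' := intervalIntegral.integral_add_adjacent_intervals (μ := MeasureTheory.volume)
    (hg.intervalIntegrable a (b - ε)) (hg.intervalIntegrable (b - ε) b)
  rw [← e', ← e]
  constructor <;> linarith [i1.1, i1.2, i2.1, i2.2, i3.1, i3.2]

/-- Smooth interpolation between `p` on the left of `a` and `q` on the right of `b`, with the
derivative in `[m, M]`. The derivative is a `blend`, whose constant is chosen so that the total
increment is right. -/
theorem exists_join {p q P Q : ℝ → ℝ} {a b ε m M : ℝ} (hp : ∀ t, HasDerivAt p (P t) t)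
    (hq : ∀ t, HasDerivAt q (Q t) t) (hP : ContDiff ℝ ∞ P) (hQ : ContDiff ℝ ∞ Q) (hε : 0 < ε)
    (hab : a + ε < b - ε) (hm : 0 ≤ m) (hPm : ∀ t ∈ Icc a (a + ε), P t ∈ Icc m M)
    (hQm : ∀ t ∈ Icc (b - ε) b, Q t ∈ Icc m M) (hlow : m * (b - a) + 2 * M * ε ≤ q b - p a)
    (hup : q b - p a ≤ M * (b - a - 2 * ε)) :
    ∃ (G : ℝ → ℝ) (c : ℝ), c ∈ Icc m M ∧ (∀ t, HasDerivAt G (blend a b ε P Q c t) t) ∧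
      (∀ t ≤ a, G t = p t) ∧ ∀ t, b ≤ t → G t = q t := by
  have hmM : m ≤ M := (hPm a ⟨le_rfl, by linarith⟩).1.trans (hPm a ⟨le_rfl, by linarith⟩).2
  have cl := (contDiff_leftCut a ε).continuous
  have cr := (contDiff_rightCut b ε).continuous
  have hI₁ := integral_mem_of_margins (g := fun t => leftCut a ε t * P t + rightCut b ε t * Q t)
    (m₀ := 0) (M₀ := M) (m₁ := 0) (M₁ := 0) hε hab.le
    ((cl.mul hP.continuous).add (cr.mul hQ.continuous))
    (fun t ht => by
      have h1 := hPm t ht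
      have h2 := leftCut_mem a ε t
      rw [rightCut_eq_zero hε (by linarith [ht.2])]
      constructor <;> nlinarith [h1.1, h1.2, h2.1, h2.2])
    (fun t ht => by rw [leftCut_eq_zero hε ht.1, rightCut_eq_zero hε ht.2]; simp)
    (fun t ht => by
      have h1 := hQm t ht
      have h2 := rightCut_mem b ε t
      rw [leftCut_eq_zero hε (by linarith [ht.1])]
      constructor <;> nlinarith [h1.1, h1.2, h2.1, h2.2])
  have hI₂ := integral_mem_of_margins (g := fun t => 1 - leftCut a ε t - rightCut b ε t)
    (m₀ := 0) (M₀ := 1) (m₁ := 1) (M₁ := 1) hε hab.le ((continuous_const.sub cl).sub cr)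
    (fun t ht => by
      have h2 := leftCut_mem a ε t
      rw [rightCut_eq_zero hε (by linarith [ht.2])]
      constructor <;> linarith [h2.1, h2.2])
    (fun t ht => by rw [leftCut_eq_zero hε ht.1, rightCut_eq_zero hε ht.2]; simp)
    (fun t ht => by
      have h2 := rightCut_mem b ε t
      rw [leftCut_eq_zero hε (by linarith [ht.1])]
      constructor <;> linarith [h2.1, h2.2])
  set I₁ := ∫ t in a..b, (leftCut a ε t * P t + rightCut b ε t * Q t) with hI₁def
  set I₂ := ∫ t in a..b, (1 - leftCut a ε t - rightCut b ε t) with hI₂def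
  have hI₂pos : 0 < I₂ := by linarith [hI₂.1]
  -- the constant is determined by the total increment
  set c := (q b - p a - I₁) / I₂ with hc
  have hcmem : c ∈ Icc m M := by
    constructor
    · rw [hc, le_div_iff₀ hI₂pos]
      have : m * I₂ ≤ m * (b - a) := mul_le_mul_of_nonneg_left (by linarith [hI₂.2]) hm
      linarith [hI₁.2]
    · rw [hc, div_le_iff₀ hI₂pos]
      have : M * (b - a - 2 * ε) ≤ M * I₂ :=
        mul_le_mul_of_nonneg_left (by linarith [hI₂.1]) (hm.trans hmM)
      linarith [hI₁.1]
  have hB := (contDiff_blend (a := a) (b := b) (ε := ε) hP hQ c).continuous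
  have hint : ∫ t in a..b, blend a b ε P Q c t = q b - p a := by
    have : ∫ t in a..b, blend a b ε P Q c t = I₁ + c * I₂ := by
      rw [hI₁def, hI₂def, ← intervalIntegral.integral_const_mul,
        ← intervalIntegral.integral_add]
      · rfl
      · exact ((cl.mul hP.continuous).add (cr.mul hQ.continuous)).intervalIntegrable _ _
      · exact (continuous_const.mul ((continuous_const.sub cl).sub cr)).intervalIntegrable _ _
    rw [this, hc, div_mul_cancel₀ _ hI₂pos.ne']
    ring
  refine ⟨fun t => p a + ∫ x in a..t, blend a b ε P Q c x, c, hcmem, fun t => ?_, fun t ht => ?_,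
    fun t ht => ?_⟩
  · exact (hB.integral_hasStrictDerivAt a t).hasDerivAt.const_add _
  · have : ∫ x in a..t, blend a b ε P Q c x = ∫ x in a..t, P x := by
      refine intervalIntegral.integral_congr fun x hx => ?_
      rw [uIcc_of_ge ht] at hx
      simp only [blend]
      rw [leftCut_eq_one hε hx.2, rightCut_eq_zero hε (by linarith [hx.2])]
      ring
    simp only [this]
    rw [intervalIntegral.integral_eq_sub_of_hasDerivAt (fun x _ => hp x)
      (hP.continuous.intervalIntegrable _ _)]
    ring
  · have e : ∫ x in b..t, blend a b ε P Q c x = ∫ x in b..t, Q x := by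
      refine intervalIntegral.integral_congr fun x hx => ?_
      rw [uIcc_of_le ht] at hx
      simp only [blend]
      rw [leftCut_eq_zero hε (by linarith [hx.1]), rightCut_eq_one hε hx.1]
      ring
    simp only
    rw [← intervalIntegral.integral_add_adjacent_intervals (hB.intervalIntegrable a b)
      (hB.intervalIntegrable b t), hint, e,
      intervalIntegral.integral_eq_sub_of_hasDerivAt (fun x _ => hq x)
      (hQ.continuous.intervalIntegrable _ _)]
    ring

theorem iteratedDeriv_add_add_mul {A B E : ℝ → ℝ} (hA : ContDiff ℝ ∞ A) (hB : ContDiff ℝ ∞ B)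
    (hE : ContDiff ℝ ∞ E) (α β c : ℝ) (k : ℕ) (t : ℝ) :
    iteratedDeriv k (fun t => α * A t + β * B t + c * E t) t =
      α * iteratedDeriv k A t + β * iteratedDeriv k B t + c * iteratedDeriv k E t := by
  have hk : (k : ℕ∞ω) ≤ ∞ := by exact_mod_cast le_top
  have h1 : ContDiffAt ℝ k (fun t => α * A t) t := (contDiff_const.mul (hA.of_le hk)).contDiffAt
  have h2 : ContDiffAt ℝ k (fun t => β * B t) t := (contDiff_const.mul (hB.of_le hk)).contDiffAt
  have h3 : ContDiffAt ℝ k (fun t => c * E t) t := (contDiff_const.mul (hE.of_le hk)).contDiffAt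
  rw [iteratedDeriv_fun_add (h1.add h2) h3, iteratedDeriv_fun_add h1 h2,
    iteratedDeriv_const_mul_field, iteratedDeriv_const_mul_field, iteratedDeriv_const_mul_field]

theorem exists_bound_iteratedDeriv {A : ℝ → ℝ} (hA : ContDiff ℝ ∞ A) (k : ℕ) (x y : ℝ) :
    ∃ B : ℝ, 0 ≤ B ∧ ∀ t ∈ Icc x y, |iteratedDeriv k A t| ≤ B := by
  obtain ⟨B, hB⟩ := isCompact_Icc.exists_bound_of_continuousOn
    (hA.continuous_iteratedDeriv k (by exact_mod_cast le_top)).continuousOn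
  exact ⟨max B 0, le_max_right _ _, fun t ht => (hB t ht).trans (le_max_left _ _)⟩

/-- Interpolation with bounds on all derivatives that are uniform in the data: the derivatives of
the two outer functions are multiples `α u`, `β v` of fixed functions, with bounded `α`, `β`. -/
theorem exists_join_uniform {u v : ℝ → ℝ} (hu : ContDiff ℝ ∞ u) (hv : ContDiff ℝ ∞ v)
    {a b ε : ℝ} (hε : 0 < ε) (hab : a + ε < b - ε) (K : ℝ) :
    ∃ Bd : ℕ → ℝ, ∀ (α β m M : ℝ) (p q : ℝ → ℝ), |α| ≤ K → |β| ≤ K → 0 ≤ m → M ≤ K →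
      (∀ t, HasDerivAt p (α * u t) t) → (∀ t, HasDerivAt q (β * v t) t) →
      (∀ t ∈ Icc a (a + ε), α * u t ∈ Icc m M) → (∀ t ∈ Icc (b - ε) b, β * v t ∈ Icc m M) →
      m * (b - a) + 2 * M * ε ≤ q b - p a → q b - p a ≤ M * (b - a - 2 * ε) →
      ∃ G : ℝ → ℝ, ContDiff ℝ ∞ G ∧ (∀ t ≤ a, G t = p t) ∧ (∀ t, b ≤ t → G t = q t) ∧
        (∀ t ∈ Icc a b, deriv G t ∈ Icc m M) ∧
        ∀ k, 1 ≤ k → ∀ t ∈ Icc (a - 1) (b + 1), |iteratedDeriv k G t| ≤ Bd k := by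
  have cl := contDiff_leftCut a ε
  have cr := contDiff_rightCut b ε
  have hA : ContDiff ℝ ∞ fun t => leftCut a ε t * u t := cl.mul hu
  have hB : ContDiff ℝ ∞ fun t => rightCut b ε t * v t := cr.mul hv
  have hE : ContDiff ℝ ∞ fun t => 1 - leftCut a ε t - rightCut b ε t :=
    (contDiff_const.sub cl).sub cr
  choose BA hBA0 hBA using fun k => exists_bound_iteratedDeriv hA k (a - 1) (b + 1)
  choose BB hBB0 hBB using fun k => exists_bound_iteratedDeriv hB k (a - 1) (b + 1)
  choose BE hBE0 hBE using fun k => exists_bound_iteratedDeriv hE k (a - 1) (b + 1)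
  refine ⟨fun k => K * BA (k - 1) + K * BB (k - 1) + K * BE (k - 1), ?_⟩
  intro α β m M p q hα hβ hm hM hp hq hPm hQm hlow hup
  have hP : ContDiff ℝ ∞ fun t => α * u t := contDiff_const.mul hu
  have hQ : ContDiff ℝ ∞ fun t => β * v t := contDiff_const.mul hv
  obtain ⟨G, c, hc, hG, hGp, hGq⟩ := exists_join hp hq hP hQ hε hab hm hPm hQm hlow hup
  have hdG : deriv G = blend a b ε (fun t => α * u t) (fun t => β * v t) c :=
    funext fun t => (hG t).deriv
  refine ⟨G, ?_, hGp, hGq, fun t ht => ?_, fun k hk t ht => ?_⟩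
  · rw [contDiff_infty_iff_deriv, hdG]
    exact ⟨fun t => (hG t).differentiableAt, contDiff_blend hP hQ c⟩
  · rw [hdG]
    exact blend_mem hε hab.le ht hc hPm hQm
  · obtain ⟨j, rfl⟩ : ∃ j, k = j + 1 := ⟨k - 1, by omega⟩
    have hK : 0 ≤ K := (abs_nonneg _).trans hα
    have hcK : |c| ≤ K := abs_le.2 ⟨by linarith [hc.1], hc.2.trans hM⟩
    have e : blend a b ε (fun t => α * u t) (fun t => β * v t) c = fun t =>
        α * (leftCut a ε t * u t) + β * (rightCut b ε t * v t) +
          c * (1 - leftCut a ε t - rightCut b ε t) := by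
      funext t
      simp only [blend]
      ring
    simp only [Nat.add_sub_cancel]
    rw [iteratedDeriv_succ', hdG, e, iteratedDeriv_add_add_mul hA hB hE]
    refine (abs_add_three _ _ _).trans ?_
    rw [abs_mul, abs_mul, abs_mul]
    have h1 := hBA j t ht
    have h2 := hBB j t ht
    have h3 := hBE j t ht
    gcongr

theorem iteratedDeriv_eq_of_eqOn_Iic {f g : ℝ → ℝ} {a t : ℝ} (hf : ContDiff ℝ ∞ f)
    (hg : ContDiff ℝ ∞ g) (h : ∀ t ≤ a, f t = g t) (ht : t ≤ a) (k : ℕ) :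
    iteratedDeriv k f t = iteratedDeriv k g t := by
  have hlt : t - 1 < t := by linarith
  rw [← iteratedDerivWithin_Icc_eq_of_eqOn hlt hg (f := f) (fun z hz => h z (hz.2.trans ht)) k
    (right_mem_Icc.2 hlt.le), iteratedDerivWithin_Icc_eq_of_eqOn hlt hf (fun z _ => rfl) k
    (right_mem_Icc.2 hlt.le)]

theorem iteratedDeriv_eq_of_eqOn_Ici {f g : ℝ → ℝ} {a t : ℝ} (hf : ContDiff ℝ ∞ f)
    (hg : ContDiff ℝ ∞ g) (h : ∀ t, a ≤ t → f t = g t) (ht : a ≤ t) (k : ℕ) :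
    iteratedDeriv k f t = iteratedDeriv k g t := by
  have hlt : t < t + 1 := by linarith
  rw [← iteratedDerivWithin_Icc_eq_of_eqOn hlt hg (f := f) (fun z hz => h z (ht.trans hz.1)) k
    (left_mem_Icc.2 hlt.le), iteratedDerivWithin_Icc_eq_of_eqOn hlt hf (fun z _ => rfl) k
    (left_mem_Icc.2 hlt.le)]

/-- A single smooth join, in the form used for the three completions of the map. -/
theorem exists_smoothJoin {p q : ℝ → ℝ} (hp : ContDiff ℝ ∞ p) (hq : ContDiff ℝ ∞ q)
    {a b ε m M : ℝ} (hε : 0 < ε) (hab : a + ε < b - ε) (hm : 0 ≤ m)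
    (hPm : ∀ t ∈ Icc a (a + ε), deriv p t ∈ Icc m M)
    (hQm : ∀ t ∈ Icc (b - ε) b, deriv q t ∈ Icc m M) (hlow : m * (b - a) + 2 * M * ε ≤ q b - p a)
    (hup : q b - p a ≤ M * (b - a - 2 * ε)) :
    ∃ G : ℝ → ℝ, ContDiff ℝ ∞ G ∧ (∀ t ≤ a, G t = p t) ∧ (∀ t, b ≤ t → G t = q t) ∧
      ∀ t ∈ Icc a b, deriv G t ∈ Icc m M := by
  have hp' := contDiff_infty_iff_deriv.1 hp
  have hq' := contDiff_infty_iff_deriv.1 hq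
  obtain ⟨_, h⟩ := exists_join_uniform hp'.2 hq'.2 hε hab (max 1 M)
  obtain ⟨G, h1, h2, h3, h4, -⟩ := h 1 1 m M p q (by simp) (by simp) hm (le_max_right _ _)
    (fun t => by simpa using (hp'.1 t).hasDerivAt) (fun t => by simpa using (hq'.1 t).hasDerivAt)
    (by simpa using hPm) (by simpa using hQm) hlow hup
  exact ⟨G, h1, h2, h3, h4⟩

/-! ### The laps of the oscillating functions -/

section Families

variable {lam : ℝ} {r n : ℕ}

/-- The prescribed form of `s_n` near the integer `j`, as a function of the displacement from `j`:
affine at the two end points `0` and `M_n`, quadratic at the interior integers. -/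
noncomputable def oscGerm (lam : ℝ) (r n : ℕ) (j : ℤ) (u : ℝ) : ℝ :=
  if j = 0 then slope lam r n * u
  else if j = osc lam n then 1 + slope lam r n * u
  else if Even j then -mMin n + curv lam r * u ^ 2
  else 1 - curv lam r * u ^ 2

theorem contDiff_oscGerm (j : ℤ) : ContDiff ℝ ∞ (oscGerm lam r n j) := by
  unfold oscGerm
  split_ifs <;> fun_prop

theorem deriv_oscGerm (j : ℤ) (u : ℝ) : deriv (oscGerm lam r n j) u =
    if j = 0 ∨ j = osc lam n then slope lam r n else lapSign j * (2 * curv lam r * u) := by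
  have hq : deriv (fun u : ℝ => curv lam r * u ^ 2) u = 2 * curv lam r * u := by
    simp
    ring
  have hl : deriv (fun u : ℝ => slope lam r n * u) u = slope lam r n := by simp
  unfold oscGerm lapSign
  by_cases h0 : j = 0
  · simp [h0]
  · by_cases h1 : j = osc lam n
    · rw [if_pos (Or.inr h1)]
      simp only [if_neg h0, if_pos h1, deriv_const_add]
      exact hl
    · by_cases h2 : Even j
      · simp only [h0, h1, h2, if_true, if_false, or_self, deriv_const_add, one_mul]
        exact hq
      · simp only [h0, h1, h2, if_false, or_self, deriv_const_sub]
        rw [hq]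
        ring

theorem oscGerm_zero_mem (hn : 1 ≤ n) (j : ℤ) : oscGerm lam r n j 0 ∈ Icc (-mMin n) 1 := by
  have := mMin_bounds hn
  unfold oscGerm
  split_ifs <;> constructor <;> simp <;> linarith

/-- `P` is an admissible restriction of `s_n` to `[j, j + 1]`, translated to `[0, 1]`. -/
structure IsLap (lam : ℝ) (r n : ℕ) (j : ℤ) (P : ℝ → ℝ) : Prop where
  smooth : ContDiff ℝ ∞ P
  left : ∀ u ≤ delta lam r, P u = oscGerm lam r n j u
  right : ∀ u, 1 - delta lam r ≤ u → P u = oscGerm lam r n (j + 1) (u - 1)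
  slope_mem : ∀ u ∈ Icc (delta lam r) (1 - delta lam r),
    lapSign j * deriv P u ∈ Icc (minSlope lam r n) (lam ^ r)

theorem curv_mul_delta (hlam : 14 ≤ lam) : 2 * curv lam r * delta lam r = lam ^ r / 2 := by
  have h1 := curv_mul_sq (r := r) hlam
  have h2 := delta_mul_pow (r := r) hlam
  linear_combination 2 * lam ^ r * h1 - 2 * curv lam r * delta lam r * h2

/-- The laps exist, with bounds on their derivatives that do not depend on `n` and `j`: the boundary
data involve only three pairs of functions, scaled by factors bounded by `λ^r`. -/
theorem exists_lap (hlam : 14 ≤ lam) (hr : 1 ≤ r) :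
    ∃ Bd : ℕ → ℝ, ∀ n, 1 ≤ n → ∀ j : ℤ, 0 ≤ j → j < osc lam n → ∃ P : ℝ → ℝ,
      IsLap lam r n j P ∧ ∀ k, 1 ≤ k → ∀ u ∈ Icc (0 : ℝ) 1, |iteratedDeriv k P u| ≤ Bd k := by
  have hd := delta_pos (r := r) hlam
  have hd' := delta_le hlam hr
  have hL := pow_ge hlam hr
  have hdL := delta_mul_pow (r := r) hlam
  have hC := curv_mul_sq (r := r) hlam
  have hCd := curv_mul_delta (r := r) hlam
  have hCpos : 0 < curv lam r := by nlinarith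
  set d := delta lam r with hdd
  set L := lam ^ r with hLL
  set C := curv lam r with hCC
  have hε : 0 < d / 100 := by positivity
  have hab : d + d / 100 < 1 - d - d / 100 := by linarith
  have hu1 : ContDiff ℝ ∞ fun _ : ℝ => (1 : ℝ) := contDiff_const
  have hu2 : ContDiff ℝ ∞ fun t : ℝ => 2 * C * t := by fun_prop
  have hu3 : ContDiff ℝ ∞ fun t : ℝ => 2 * C * (1 - t) := by fun_prop
  obtain ⟨B1, h1⟩ := exists_join_uniform hu1 hu3 hε hab L
  obtain ⟨B2, h2⟩ := exists_join_uniform hu2 hu3 hε hab L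
  obtain ⟨B3, h3⟩ := exists_join_uniform hu2 hu1 hε hab L
  refine ⟨fun k => max (B1 k) (max (B2 k) (B3 k)), fun n hn j hj0 hjM => ?_⟩
  have hm := mMin_bounds hn
  have hk := slope_pos (r := r) hlam hn
  have hk' := slope_le (r := r) hlam hn
  have hkd : slope lam r n * d ≤ 2 / 13 := by nlinarith
  have hkd0 : 0 < slope lam r n * d := by positivity
  have hM := osc_ge_int hlam hn
  have hodd := osc_odd (lam := lam) n
  have hms := minSlope_pos (r := r) hlam hn
  have hms1 : minSlope lam r n ≤ 1 / 2 := min_le_left _ _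
  have hms2 : minSlope lam r n ≤ slope lam r n := min_le_right _ _
  have hsub : Icc (0 : ℝ) 1 ⊆ Icc (d - 1) (1 - d + 1) := Icc_subset_Icc (by linarith) (by linarith)
  -- The slope conditions and the height conditions of the joins. At distance `δ` from an extremum the
  -- slope is `2 C δ = λ^r / 2`, which leaves room for the margins of length `ε = δ / 100`.
  have s1 : ∀ t ∈ Icc d (d + d / 100), slope lam r n * 1 ∈ Icc (minSlope lam r n) L :=
    fun t _ => ⟨by linarith, by linarith⟩
  have s1' : ∀ t ∈ Icc (1 - d - d / 100) (1 - d), slope lam r n * 1 ∈ Icc (minSlope lam r n) L :=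
    fun t _ => ⟨by linarith, by linarith⟩
  have s2 : ∀ t ∈ Icc d (d + d / 100), 1 * (2 * C * t) ∈ Icc (minSlope lam r n) L := by
    intro t ht
    have e1 := mul_le_mul_of_nonneg_left ht.1 (by positivity : 0 ≤ 2 * C)
    have e2 := mul_le_mul_of_nonneg_left ht.2 (by positivity : 0 ≤ 2 * C)
    constructor <;> linarith
  have s3 : ∀ t ∈ Icc (1 - d - d / 100) (1 - d),
      1 * (2 * C * (1 - t)) ∈ Icc (minSlope lam r n) L := by
    intro t ht
    have e1 := mul_le_mul_of_nonneg_left (by linarith [ht.2] : d ≤ 1 - t)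
      (by positivity : 0 ≤ 2 * C)
    have e2 := mul_le_mul_of_nonneg_left (by linarith [ht.1] : 1 - t ≤ d + d / 100)
      (by positivity : 0 ≤ 2 * C)
    constructor <;> linarith
  have hlow : ∀ H : ℝ, 11 / 20 ≤ H →
      minSlope lam r n * (1 - d - d) + 2 * L * (d / 100) ≤ H := by
    intro H hH
    have : minSlope lam r n * (1 - d - d) ≤ 1 / 2 * 1 :=
      mul_le_mul hms1 (by linarith) (by linarith) (by norm_num)
    linarith
  have hup : ∀ H : ℝ, H ≤ 2 → H ≤ L * (1 - d - d - 2 * (d / 100)) := by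
    intro H hH
    linarith
  have hq : ∀ c t : ℝ, HasDerivAt (fun t => c + C * t ^ 2) (1 * (2 * C * t)) t := by
    intro c t
    have := ((hasDerivAt_pow 2 t).const_mul C).const_add c
    exact this.congr_deriv (by simp; ring)
  have hq' : ∀ c t : ℝ, HasDerivAt (fun t => c - C * (t - 1) ^ 2) (1 * (2 * C * (1 - t))) t := by
    intro c t
    have := ((((hasDerivAt_id t).sub_const 1).pow 2).const_mul C).const_sub c
    exact this.congr_deriv (by simp; ring)
  have hl : ∀ t : ℝ, HasDerivAt (fun t => slope lam r n * t) (slope lam r n * 1) t := fun t =>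
    (hasDerivAt_id t).const_mul _
  have hl' : ∀ t : ℝ, HasDerivAt (fun t => 1 + slope lam r n * (t - 1)) (slope lam r n * 1) t :=
    fun t => (((hasDerivAt_id t).sub_const 1).const_mul _).const_add 1
  have hkK : |slope lam r n| ≤ L := by rw [abs_of_pos hk]; linarith
  have h1K : |(1 : ℝ)| ≤ L := by rw [abs_one]; linarith
  rcases eq_or_ne j 0 with rfl | hj
  · have hne : (1 : ℤ) ≠ osc lam n := by omega
    obtain ⟨G, g1, g2, g3, g4, g5⟩ := h1 (slope lam r n) 1 (minSlope lam r n) L _ _ hkK h1K hms.le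
      le_rfl hl (hq' 1) s1 s3 (hlow _ (by norm_num; linarith)) (hup _ (by norm_num; linarith))
    refine ⟨G, ⟨g1, fun u hu => ?_, fun u hu => ?_, fun u hu => ?_⟩, fun k hk u hu =>
      (g5 k hk u (hsub hu)).trans (le_max_left _ _)⟩
    · rw [g2 u hu]; simp [oscGerm]
    · rw [g3 u hu]; simp [oscGerm, hne]; exact Or.inl rfl
    · simpa [lapSign] using g4 u hu
  rcases Int.even_or_odd j with he | ho
  · have hs : lapSign j = 1 := by simp [lapSign, he]
    have hjo : ¬ Even (j + 1) := Int.not_even_iff_odd.2 he.add_one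
    rcases eq_or_ne (j + 1) (osc lam n) with hje | hje
    · obtain ⟨G, g1, g2, g3, g4, g5⟩ := h3 1 (slope lam r n) (minSlope lam r n) L _ _ h1K hkK
        hms.le le_rfl (hq (-mMin n)) hl' s2 s1' (hlow _ (by norm_num; linarith))
        (hup _ (by norm_num; linarith))
      refine ⟨G, ⟨g1, fun u hu => ?_, fun u hu => ?_, fun u hu => ?_⟩, fun k hk u hu =>
        (g5 k hk u (hsub hu)).trans ((le_max_right _ _).trans (le_max_right _ _))⟩
      · rw [g2 u hu]; simp only [oscGerm, hj, hjM.ne, he, if_true, if_false]; rfl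
      · rw [g3 u hu]; simp only [oscGerm, if_pos hje, if_neg (by omega : ¬ j + 1 = 0)]
      · rw [hs, one_mul]; exact g4 u hu
    · obtain ⟨G, g1, g2, g3, g4, g5⟩ := h2 1 1 (minSlope lam r n) L _ _ h1K h1K
        hms.le le_rfl (hq (-mMin n)) (hq' 1) s2 s3 (hlow _ (by norm_num; linarith))
        (hup _ (by norm_num; linarith))
      refine ⟨G, ⟨g1, fun u hu => ?_, fun u hu => ?_, fun u hu => ?_⟩, fun k hk u hu =>
        (g5 k hk u (hsub hu)).trans ((le_max_left _ _).trans (le_max_right _ _))⟩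
      · rw [g2 u hu]; simp only [oscGerm, hj, hjM.ne, he, if_true, if_false]; rfl
      · rw [g3 u hu]
        simp only [oscGerm, if_neg hje, if_neg (by omega : ¬ j + 1 = 0), if_neg hjo]; rfl
      · rw [hs, one_mul]; exact g4 u hu
  · have hs : lapSign j = -1 := by simp [lapSign, Int.not_even_iff_odd.2 ho]
    have hje : j + 1 ≠ osc lam n := by
      intro h
      exact (Int.not_even_iff_odd.2 hodd) (h ▸ ho.add_one)
    obtain ⟨G, g1, g2, g3, g4, g5⟩ := h2 1 1 (minSlope lam r n) L _ _ h1K h1K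
      hms.le le_rfl (hq (-1)) (hq' (mMin n)) s2 s3 (hlow _ (by norm_num; linarith))
      (hup _ (by norm_num; linarith))
    refine ⟨fun t => -G t, ⟨g1.neg, fun u hu => ?_, fun u hu => ?_, fun u hu => ?_⟩,
      fun k hk u hu => ?_⟩
    · simp only [g2 u hu, oscGerm, if_neg hj, if_neg hjM.ne, if_neg (Int.not_even_iff_odd.2 ho)]
      change _ = 1 - C * u ^ 2
      ring
    · simp only [g3 u hu, oscGerm, if_neg hje, if_neg (by omega : ¬ j + 1 = 0),
        if_pos ho.add_one]
      change _ = -mMin n + C * (u - 1) ^ 2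
      ring
    · have : deriv (fun t => -G t) u = -deriv G u := deriv.fun_neg
      rw [hs, this, neg_mul_neg, one_mul]
      exact g4 u hu
    · have : iteratedDeriv k (fun t => -G t) u = -iteratedDeriv k G u := iteratedDeriv_fun_neg k G u
      rw [this, abs_neg]
      exact (g5 k hk u (hsub hu)).trans ((le_max_left _ _).trans (le_max_right _ _))

namespace IsLap

variable {j : ℤ} {P : ℝ → ℝ}

theorem deriv_left (h : IsLap lam r n j P) {u : ℝ} (hu : u ≤ delta lam r) :
    deriv P u = deriv (oscGerm lam r n j) u := by
  have := iteratedDeriv_eq_of_eqOn_Iic h.smooth (contDiff_oscGerm j) h.left hu 1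
  simpa only [iteratedDeriv_one] using this

theorem deriv_right (h : IsLap lam r n j P) {u : ℝ} (hu : 1 - delta lam r ≤ u) :
    deriv P u = deriv (oscGerm lam r n (j + 1)) (u - 1) := by
  have := iteratedDeriv_eq_of_eqOn_Ici h.smooth
    ((contDiff_oscGerm (lam := lam) (r := r) (n := n) (j + 1)).comp
      (contDiff_id.sub contDiff_const)) h.right hu 1
  simp only [iteratedDeriv_one] at this
  rw [this]
  exact deriv_comp_sub_const (f := oscGerm lam r n (j + 1)) (a := (1 : ℝ)) (x := u)

/-- A lap is strictly monotone, with slope at most `λ^r`. -/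
theorem sign_deriv (h : IsLap lam r n j P) (hlam : 14 ≤ lam) (hr : 1 ≤ r) (hn : 1 ≤ n)
    (h0 : 0 ≤ j) (hj : j < osc lam n) {u : ℝ} (hu : u ∈ Icc (0 : ℝ) 1) :
    lapSign j * deriv P u ∈ Icc 0 (lam ^ r) ∧ (u ∈ Ioo (0 : ℝ) 1 → 0 < lapSign j * deriv P u) := by
  have hd := delta_pos (r := r) hlam
  have hL := pow_ge hlam hr
  have hCd := curv_mul_delta (r := r) hlam
  have hC : 0 < curv lam r := by
    have := curv_mul_sq (r := r) hlam
    nlinarith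
  have hk := slope_pos (r := r) hlam hn
  have hk' := slope_le (r := r) hlam hn
  have hsq : lapSign j * lapSign j = 1 := by
    unfold lapSign; split_ifs <;> norm_num
  have hM := osc_ge_int hlam hn
  have hodd := osc_odd (lam := lam) n
  rcases le_total u (delta lam r) with h1 | h1
  · rw [h.deriv_left h1, deriv_oscGerm]
    by_cases hz : j = 0
    · subst hz
      simp only [true_or, if_true]
      have : lapSign 0 = 1 := by simp [lapSign]
      rw [this, one_mul]
      exact ⟨⟨hk.le, by linarith⟩, fun _ => hk⟩
    · rw [if_neg (by simp [hz, hj.ne]), ← mul_assoc, hsq, one_mul]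
      have := mul_le_mul_of_nonneg_left h1 (by positivity : 0 ≤ 2 * curv lam r)
      have h2 := hu.1
      exact ⟨⟨by positivity, by linarith⟩, fun h => by have := h.1; positivity⟩
  rcases le_total (1 - delta lam r) u with h2 | h2
  · rw [h.deriv_right h2, deriv_oscGerm]
    by_cases hz : j + 1 = osc lam n
    · rw [if_pos (Or.inr hz)]
      have he : Even j := by
        rw [← hz, ← Int.not_even_iff_odd, Int.even_add_one, not_not] at hodd
        exact hodd
      have : lapSign j = 1 := by simp [lapSign, he]
      rw [this, one_mul]
      exact ⟨⟨hk.le, by linarith⟩, fun _ => hk⟩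
    · rw [if_neg (by rintro (h | h); omega; exact hz h)]
      have e : lapSign j * (lapSign (j + 1) * (2 * curv lam r * (u - 1))) =
          2 * curv lam r * (1 - u) := by
        have : lapSign (j + 1) = -lapSign j := by
          unfold lapSign
          by_cases he : Even j <;> simp [he]
        rw [this]
        linear_combination (2 * curv lam r * (1 - u)) * hsq
      rw [e]
      have := mul_le_mul_of_nonneg_left (by linarith : 1 - u ≤ delta lam r)
        (by positivity : 0 ≤ 2 * curv lam r)
      have h3 : 0 ≤ 1 - u := by linarith [hu.2]
      exact ⟨⟨by positivity, by linarith⟩, fun h => by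
        have : 0 < 1 - u := by linarith [h.2]
        positivity⟩
  · have h3 := h.slope_mem u ⟨h1, h2⟩
    have h4 := minSlope_pos (r := r) hlam hn
    exact ⟨⟨h4.le.trans h3.1, h3.2⟩, fun _ => h4.trans_le h3.1⟩

end IsLap

end Families

/-! ### The oscillating and the connecting functions -/

section Families

variable {lam : ℝ} {r n : ℕ}

/-- The index of the lap of `s_n` used at `t`: the integer part of `t`, kept in `[0, M_n - 1]`. -/
noncomputable def lapIndex (lam : ℝ) (n : ℕ) (t : ℝ) : ℤ := max 0 (min ⌊t⌋ (osc lam n - 1))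

/-- The function on the line whose laps are the given functions `P n j`. -/
noncomputable def oscOfLaps (lam : ℝ) (P : ℕ → ℤ → ℝ → ℝ) (n : ℕ) (t : ℝ) : ℝ :=
  P n (lapIndex lam n t) (t - lapIndex lam n t)

variable {P : ℕ → ℤ → ℝ → ℝ}

/-- A lap determines the function a bit beyond its interval, since adjacent laps have the same
germ at their common end point. -/
theorem oscOfLaps_eq (hlam : 14 ≤ lam) (hr : 1 ≤ r)
    (hP : ∀ j : ℤ, 0 ≤ j → j < osc lam n → IsLap lam r n j (P n j)) {j : ℤ} (h0 : 0 ≤ j)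
    (hj : j < osc lam n) {t : ℝ} (ht : t ∈ Icc (j - delta lam r) (j + 1 + delta lam r)) :
    oscOfLaps lam P n t = P n j (t - j) := by
  have hd := delta_pos (r := r) hlam
  have hd' := delta_le hlam hr
  have hf1 := Int.floor_le t
  have hf2 := Int.lt_floor_add_one t
  have hi : lapIndex lam n t = j ∨ (lapIndex lam n t = j + 1 ∧ j + 1 < osc lam n) ∨
      (lapIndex lam n t = j - 1 ∧ 0 < j) := by
    have a1 : ⌊t⌋ < j + 2 := by
      rw [Int.floor_lt]; push_cast; linarith [ht.2]
    have a2 : j - 1 ≤ ⌊t⌋ := by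
      rw [Int.le_floor]; push_cast; linarith [ht.1]
    unfold lapIndex
    omega
  unfold oscOfLaps
  rcases hi with h | ⟨h, h'⟩ | ⟨h, h'⟩
  · rw [h]
  · have h1 : (j : ℝ) + 1 ≤ t := by
      have : j + 1 ≤ ⌊t⌋ := by unfold lapIndex at h; omega
      have : ((j + 1 : ℤ) : ℝ) ≤ ⌊t⌋ := by exact_mod_cast this
      push_cast at this
      linarith
    rw [h, (hP (j + 1) (by omega) h').left _ (by push_cast; linarith [ht.2]),
      (hP j h0 hj).right _ (by linarith)]
    push_cast
    ring_nf
  · have h1 := hP (j - 1) (by omega) (by omega)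
    rw [h, h1.right _ (by push_cast; linarith [ht.1]), sub_add_cancel,
      (hP j h0 hj).left _ ?_]
    · push_cast
      ring_nf
    · have : ⌊t⌋ + 1 ≤ j := by unfold lapIndex at h; omega
      have : ((⌊t⌋ + 1 : ℤ) : ℝ) ≤ j := by exact_mod_cast this
      push_cast at this
      linarith

theorem exists_lap_mem {t : ℝ} (hlam : 14 ≤ lam) (hn : 1 ≤ n)
    (ht : t ∈ Icc (0 : ℝ) (osc lam n)) :
    ∃ j : ℤ, 0 ≤ j ∧ j < osc lam n ∧ t - j ∈ Icc (0 : ℝ) 1 := by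
  have hM := osc_ge_int hlam hn
  have hf1 := Int.floor_le t
  have hf2 := Int.lt_floor_add_one t
  have h0 : 0 ≤ ⌊t⌋ := Int.floor_nonneg.2 ht.1
  rcases lt_or_ge ⌊t⌋ (osc lam n) with h | h
  · exact ⟨⌊t⌋, h0, h, by constructor <;> linarith⟩
  · have : (osc lam n : ℝ) ≤ ⌊t⌋ := by exact_mod_cast h
    refine ⟨osc lam n - 1, by omega, by omega, ?_⟩
    push_cast
    constructor <;> linarith [ht.2]

theorem iteratedDerivWithin_oscOfLaps (hlam : 14 ≤ lam) (hr : 1 ≤ r) (hn : 1 ≤ n)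
    (hP : ∀ j : ℤ, 0 ≤ j → j < osc lam n → IsLap lam r n j (P n j)) {j : ℤ} (h0 : 0 ≤ j)
    (hj : j < osc lam n) {t : ℝ} (ht : t - j ∈ Icc (0 : ℝ) 1) :
    ContDiffAt ℝ ∞ (oscOfLaps lam P n) t ∧
    ∀ k, iteratedDerivWithin k (oscOfLaps lam P n) (Icc 0 (osc lam n : ℝ)) t =
      iteratedDeriv k (P n j) (t - j) := by
  have hd := delta_pos (r := r) hlam
  have hM := osc_ge hlam hn
  have he : oscOfLaps lam P n =ᶠ[𝓝 t] fun z => P n j (z - j) := by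
    filter_upwards [Icc_mem_nhds (a := j - delta lam r) (b := j + 1 + delta lam r) (x := t)
      (by linarith [ht.1]) (by linarith [ht.2])] with z hz
    exact oscOfLaps_eq hlam hr hP h0 hj hz
  have hs : ContDiff ℝ ∞ fun z => P n j (z - j) :=
    (hP j h0 hj).smooth.comp (contDiff_id.sub contDiff_const)
  have hc : ContDiffAt ℝ ∞ (oscOfLaps lam P n) t := hs.contDiffAt.congr_of_eventuallyEq he
  have hjM : (j : ℝ) + 1 ≤ osc lam n := by exact_mod_cast hj
  have hj0 : (0 : ℝ) ≤ j := by exact_mod_cast h0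
  refine ⟨hc, fun k => ?_⟩
  rw [iteratedDerivWithin_eq_iteratedDeriv (uniqueDiffOn_Icc (by linarith))
    (hc.of_le (by exact_mod_cast le_top)) ⟨by linarith [ht.1], by linarith [ht.2]⟩,
    he.iteratedDeriv_eq]
  exact congrFun (iteratedDeriv_comp_sub_const (n := k) (f := P n j) (s := (j : ℝ))) t

/-- On each unit interval the function is strictly monotone, in the direction of `lapSign`. -/
theorem strictMonoOn_oscOfLaps (hlam : 14 ≤ lam) (hr : 1 ≤ r) (hn : 1 ≤ n)
    (hP : ∀ j : ℤ, 0 ≤ j → j < osc lam n → IsLap lam r n j (P n j)) {j : ℤ} (h0 : 0 ≤ j)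
    (hj : j < osc lam n) :
    StrictMonoOn (fun t => lapSign j * oscOfLaps lam P n t) (Icc (j : ℝ) (j + 1)) := by
  have hd := delta_pos (r := r) hlam
  have hL := hP j h0 hj
  have hm : StrictMonoOn (fun u => lapSign j * P n j u) (Icc 0 1) := by
    refine strictMonoOn_of_deriv_pos (convex_Icc _ _)
      (continuous_const.mul hL.smooth.continuous).continuousOn fun u hu => ?_
    rw [interior_Icc] at hu
    rw [deriv_const_mul_field]
    exact (hL.sign_deriv hlam hr hn h0 hj (Ioo_subset_Icc_self hu)).2 hu
  intro x hx y hy hxy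
  simp only
  rw [oscOfLaps_eq hlam hr hP h0 hj ⟨by linarith [hx.1], by linarith [hx.2]⟩,
    oscOfLaps_eq hlam hr hP h0 hj ⟨by linarith [hy.1], by linarith [hy.2]⟩]
  exact hm ⟨by linarith [hx.1], by linarith [hx.2]⟩ ⟨by linarith [hy.1], by linarith [hy.2]⟩
    (by linarith)

theorem oscOfLaps_eq_germ (hlam : 14 ≤ lam) (hr : 1 ≤ r)
    (hP : ∀ j : ℤ, 0 ≤ j → j < osc lam n → IsLap lam r n j (P n j)) {j : ℤ} (h0 : 0 ≤ j)
    (hj : j < osc lam n) {t : ℝ} (ht : |t - j| ≤ delta lam r) :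
    oscOfLaps lam P n t = oscGerm lam r n j (t - j) := by
  obtain ⟨h1, h2⟩ := abs_le.1 ht
  rw [oscOfLaps_eq hlam hr hP h0 hj ⟨by linarith, by linarith⟩, (hP j h0 hj).left _ h2]

theorem oscOfLaps_eq_germ_succ (hlam : 14 ≤ lam) (hr : 1 ≤ r)
    (hP : ∀ j : ℤ, 0 ≤ j → j < osc lam n → IsLap lam r n j (P n j)) {j : ℤ} (h0 : 0 ≤ j)
    (hj : j < osc lam n) {t : ℝ} (ht : |t - (j + 1)| ≤ delta lam r) :
    oscOfLaps lam P n t = oscGerm lam r n (j + 1) (t - (j + 1)) := by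
  obtain ⟨h1, h2⟩ := abs_le.1 ht
  have := delta_le hlam hr
  rw [oscOfLaps_eq hlam hr hP h0 hj ⟨by linarith, by linarith⟩,
    (hP j h0 hj).right _ (by linarith), sub_sub]

theorem oscOfLaps_mem (hlam : 14 ≤ lam) (hr : 1 ≤ r) (hn : 1 ≤ n)
    (hP : ∀ j : ℤ, 0 ≤ j → j < osc lam n → IsLap lam r n j (P n j)) {t : ℝ}
    (ht : t ∈ Icc (0 : ℝ) (osc lam n)) : oscOfLaps lam P n t ∈ Icc (-mMin n) 1 := by
  obtain ⟨j, h0, hj, htj⟩ := exists_lap_mem hlam hn ht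
  have hd := delta_pos (r := r) hlam
  have hm := (strictMonoOn_oscOfLaps hlam hr hn hP h0 hj).monotoneOn
  have hl : (j : ℝ) ∈ Icc (j : ℝ) (j + 1) := ⟨le_rfl, by linarith⟩
  have hu : (j : ℝ) + 1 ∈ Icc (j : ℝ) (j + 1) := ⟨by linarith, le_rfl⟩
  have ht' : t ∈ Icc (j : ℝ) (j + 1) := ⟨by linarith [htj.1], by linarith [htj.2]⟩
  have h1 := hm hl ht' ht'.1
  have h2 := hm ht' hu ht'.2
  have e1 : oscOfLaps lam P n j ∈ Icc (-mMin n) 1 := by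
    rw [oscOfLaps_eq_germ hlam hr hP h0 hj (by simpa using hd.le), sub_self]
    exact oscGerm_zero_mem hn j
  have e2 : oscOfLaps lam P n (j + 1) ∈ Icc (-mMin n) 1 := by
    rw [oscOfLaps_eq_germ_succ hlam hr hP h0 hj (by simpa using hd.le), sub_self]
    exact oscGerm_zero_mem hn (j + 1)
  unfold lapSign at h1 h2
  by_cases he : Even j
  · simp only [he, if_true, one_mul] at h1 h2
    exact ⟨e1.1.trans h1, h2.trans e2.2⟩
  · simp only [he, if_false, neg_mul, one_mul, neg_le_neg_iff] at h1 h2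
    exact ⟨e2.1.trans h2, h1.trans e1.2⟩

theorem exists_isOscFamily (hlam : 14 ≤ lam) (hr : 1 ≤ r) : ∃ s, IsOscFamily lam r s := by
  obtain ⟨Bd, hB⟩ := exists_lap hlam hr
  choose! P hP hPB using hB
  have hd := delta_pos (r := r) hlam
  have hd' := delta_le hlam hr
  have hM := fun {n : ℕ} (hn : 1 ≤ n) => osc_ge_int hlam hn
  have hodd := fun n : ℕ => osc_odd (lam := lam) n
  have hD := fun {n : ℕ} (hn : 1 ≤ n) {j : ℤ} (h0 : 0 ≤ j) (hj : j < osc lam n) {t : ℝ}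
    (ht : t - j ∈ Icc (0 : ℝ) 1) => iteratedDerivWithin_oscOfLaps hlam hr hn (hP n hn) h0 hj ht
  have hD1 := fun {n : ℕ} (hn : 1 ≤ n) {j : ℤ} (h0 : 0 ≤ j) (hj : j < osc lam n) {t : ℝ}
      (ht : t - j ∈ Icc (0 : ℝ) 1) => by
    simpa only [iteratedDerivWithin_one, iteratedDeriv_one] using (hD hn h0 hj ht).2 1
  have habs : ∀ (j : ℤ) (x : ℝ), |lapSign j * x| = |x| := fun j x => by
    rw [abs_mul, abs_lapSign, one_mul]
  refine ⟨oscOfLaps lam P, ?_, fun n hn t ht => oscOfLaps_mem hlam hr hn (hP n hn) ht,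
    ?_, ?_, ?_, ?_, ?_, ?_, ?_, ?_, ?_, ?_, ?_⟩
  · intro n hn t ht
    obtain ⟨j, h0, hj, htj⟩ := exists_lap_mem hlam hn ht
    exact (hD hn h0 hj htj).1.contDiffWithinAt
  · intro n hn
    have := oscOfLaps_eq_germ (t := 0) hlam hr (hP n hn) le_rfl (by linarith [hM hn])
      (by simpa using hd.le)
    simpa [oscGerm] using this
  · intro n hn
    have := oscOfLaps_eq_germ_succ (t := osc lam n) (j := osc lam n - 1) hlam hr (hP n hn)
      (by linarith [hM hn]) (by omega) (by push_cast; simpa using hd.le)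
    have h13 := hM hn
    rw [this, sub_add_cancel]
    simp only [oscGerm, if_neg (by omega : ¬ osc lam n = 0), if_true]
    push_cast
    ring
  · intro n hn j h0 hj he
    simpa [lapSign, he] using strictMonoOn_oscOfLaps hlam hr hn (hP n hn) h0 hj
  · intro n hn j h0 hj ho x hx y hy hxy
    have := strictMonoOn_oscOfLaps hlam hr hn (hP n hn) h0 hj hx hy hxy
    simpa [lapSign, Int.not_even_iff_odd.2 ho] using this
  · intro n hn j h0 hj ho t ht
    rw [oscOfLaps_eq_germ hlam hr (hP n hn) h0.le hj ht, oscGerm, if_neg h0.ne', if_neg hj.ne,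
      if_neg (Int.not_even_iff_odd.2 ho)]
  · intro n hn j h0 hj he t ht
    rw [oscOfLaps_eq_germ hlam hr (hP n hn) h0.le hj ht, oscGerm, if_neg h0.ne', if_neg hj.ne,
      if_pos he]
  · intro n hn t ht
    have h13 := hM hn
    rw [oscOfLaps_eq_germ_succ (j := osc lam n - 1) hlam hr (hP n hn) (by omega) (by omega),
      sub_add_cancel]
    · simp only [oscGerm, if_neg (by omega : ¬ osc lam n = 0), if_true]
      push_cast
      ring
    · push_cast
      rw [abs_le]
      constructor <;> linarith [ht.1, ht.2]
  · intro n hn t ht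
    rw [oscOfLaps_eq_germ (j := 0) hlam hr (hP n hn) le_rfl (by linarith [hM hn])]
    · simp [oscGerm]
    · simpa [abs_of_nonneg ht.1] using ht.2
  · intro k hk
    refine ⟨Bd k, fun n hn t ht => ?_⟩
    obtain ⟨j, h0, hj, htj⟩ := exists_lap_mem hlam hn ht
    rw [(hD hn h0 hj htj).2 k]
    exact hPB n hn j h0 hj k hk _ htj
  · intro n hn t ht
    obtain ⟨j, h0, hj, htj⟩ := exists_lap_mem hlam hn ht
    have h1 := ((hP n hn j h0 hj).sign_deriv hlam hr hn h0 hj htj).1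
    rw [hD1 hn h0 hj htj, ← habs j, abs_of_nonneg h1.1]
    exact h1.2
  · intro n hn t ht hfar
    obtain ⟨j, h0, hj, htj⟩ := exists_lap_mem hlam hn ht
    have hL := hP n hn j h0 hj
    have hk := slope_pos (r := r) hlam hn
    rw [hD1 hn h0 hj htj]
    rcases le_or_gt (delta lam r) (t - j) with h1 | h1
    · rcases le_or_gt (t - j) (1 - delta lam r) with h2 | h2
      · rw [← habs j]
        exact (hL.slope_mem _ ⟨h1, h2⟩).1.trans (le_abs_self _)
      · have hje : j + 1 = osc lam n := by
          by_contra hne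
          have := hfar (j + 1) (by omega) (by omega)
          push_cast at this
          rw [abs_of_nonpos (by linarith [htj.2])] at this
          linarith
        rw [hL.deriv_right h2.le, deriv_oscGerm, if_pos (Or.inr hje), abs_of_pos hk]
        exact min_le_right _ _
    · have hje : j = 0 := by
        by_contra hne
        have := hfar j (by omega) hj
        rw [abs_of_nonneg htj.1] at this
        linarith
      rw [hL.deriv_left h1.le, deriv_oscGerm, if_pos (Or.inl hje), abs_of_pos hk]
      exact min_le_right _ _

/-- The boundary slopes `α` and `α λ^r` with `0 < α ≤ 1/2` leave an increment that a slope between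
`(2/3) α` and `λ^r` can achieve. -/
theorem exists_isConnFamily (hlam : 14 ≤ lam) (hr : 1 ≤ r) : ∃ φ, IsConnFamily lam r φ := by
  have hL := pow_ge hlam hr
  have hdL := delta_mul_pow (r := r) hlam
  set L := lam ^ r with hLL
  have hLpos : 0 < L := by linarith
  -- The margins of the joins are so short that a slope `L` on them contributes only `1 / 50`.
  set ε := (100 * L)⁻¹ with hε'
  have hε : 0 < ε := by positivity
  have hLε : L * ε = 1 / 100 := by rw [hε']; field_simp
  have hε1 : ε ≤ 1 / 100 := by nlinarith
  obtain ⟨Bd, hB⟩ := exists_join_uniform (u := fun _ => (1 : ℝ)) (v := fun _ => (1 : ℝ))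
    contDiff_const contDiff_const hε (a := 0) (b := 1) (by linarith) L
  have key : ∀ n : ℕ, 1 ≤ n → ∃ G : ℝ → ℝ, ContDiff ℝ ∞ G ∧
      (∀ t ≤ 0, G t = 0 + 2 * (height lam r n)⁻¹ * len lam r n * delta lam r ^ n * (t - 0)) ∧
      (∀ t, 1 ≤ t → G t =
        1 + 2 * (height lam r n)⁻¹ * len lam r n * delta lam r ^ (n - 1) * (t - 1)) ∧
      (∀ t ∈ Icc 0 1, deriv G t ∈
        Icc (2 / 3 * (2 * (height lam r n)⁻¹ * len lam r n * delta lam r ^ n)) L) ∧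
      ∀ k, 1 ≤ k → ∀ t ∈ Icc (0 - 1 : ℝ) (1 + 1), |iteratedDeriv k G t| ≤ Bd k := by
    intro n hn
    obtain ⟨h1, h2⟩ := conn_slope_bounds hlam hr hn
    have hβ : 2 * (height lam r n)⁻¹ * len lam r n * delta lam r ^ (n - 1) =
        2 * (height lam r n)⁻¹ * len lam r n * delta lam r ^ n * L := by
      obtain ⟨m, rfl⟩ : ∃ m, n = m + 1 := ⟨n - 1, by omega⟩
      rw [Nat.add_sub_cancel, pow_succ (delta lam r)]
      linear_combination (-(2 * (height lam r (m + 1))⁻¹ * len lam r (m + 1) *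
        delta lam r ^ m)) * hdL
    rw [hβ]
    set α := 2 * (height lam r n)⁻¹ * len lam r n * delta lam r ^ n with hα
    have hαL : α * L ≤ 1 / 2 * L := by gcongr
    have hαL' : α * 14 ≤ α * L := by gcongr
    refine hB α (α * L) (2 / 3 * α) L (fun t => 0 + α * (t - 0)) (fun t => 1 + α * L * (t - 1))
      ?_ ?_ (by positivity) le_rfl ?_ ?_ ?_ ?_ ?_ ?_
    · rw [abs_of_pos h1]; linarith
    · rw [abs_of_pos (by positivity)]; linarith
    · exact fun t => (((hasDerivAt_id t).sub_const 0).const_mul _).const_add 0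
    · exact fun t => (((hasDerivAt_id t).sub_const 1).const_mul _).const_add 1
    · exact fun t _ => ⟨by linarith, by linarith⟩
    · exact fun t _ => ⟨by linarith, by linarith⟩
    · linarith
    · linarith
  choose! φ h1 h2 h3 h4 h5 using key
  have h01 : (0 : ℝ) < 1 := one_pos
  have hit : ∀ n, 1 ≤ n → ∀ k, ∀ t ∈ Icc (0 : ℝ) 1,
      iteratedDerivWithin k (φ n) (Icc 0 1) t = iteratedDeriv k (φ n) t := fun n hn k t ht =>
    iteratedDerivWithin_Icc_eq_of_eqOn h01 (h1 n hn) (fun _ _ => rfl) k ht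
  have hit1 : ∀ n, 1 ≤ n → ∀ t ∈ Icc (0 : ℝ) 1,
      derivWithin (φ n) (Icc 0 1) t = deriv (φ n) t := fun n hn t ht => by
    simpa only [iteratedDerivWithin_one, iteratedDeriv_one] using hit n hn 1 t ht
  have hz : ∀ n, 1 ≤ n → ∀ k, iteratedDeriv k (φ n) 0 = if k = 0 then _ else if k = 1 then
      2 * (height lam r n)⁻¹ * len lam r n * delta lam r ^ n else 0 := fun n hn k => by
    rw [iteratedDeriv_eq_of_eqOn_Iic (h1 n hn) (by fun_prop) (h2 n hn) le_rfl k]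
    exact iteratedDeriv_affine _ _ _ _ k
  have ho : ∀ n, 1 ≤ n → ∀ k, iteratedDeriv k (φ n) 1 = if k = 0 then _ else if k = 1 then
      2 * (height lam r n)⁻¹ * len lam r n * delta lam r ^ (n - 1) else 0 := fun n hn k => by
    rw [iteratedDeriv_eq_of_eqOn_Ici (h1 n hn) (by fun_prop) (h3 n hn) le_rfl k]
    exact iteratedDeriv_affine _ _ _ _ k
  have m0 : (0 : ℝ) ∈ Icc (0 : ℝ) 1 := ⟨le_rfl, h01.le⟩
  have m1 : (1 : ℝ) ∈ Icc (0 : ℝ) 1 := ⟨h01.le, le_rfl⟩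
  have v0 : ∀ n, 1 ≤ n → φ n 0 = 0 := fun n hn => by rw [h2 n hn 0 le_rfl]; ring
  have v1 : ∀ n, 1 ≤ n → φ n 1 = 1 := fun n hn => by rw [h3 n hn 1 le_rfl]; ring
  have d0 : ∀ n, 1 ≤ n → derivWithin (φ n) (Icc 0 1) 0 =
      2 * (height lam r n)⁻¹ * len lam r n * delta lam r ^ n := fun n hn => by
    rw [hit1 n hn 0 m0, ← iteratedDeriv_one, hz n hn 1]
    simp
  refine ⟨φ, fun n hn => (h1 n hn).contDiffOn, ?_, v0, v1, d0, ?_, ?_, ?_, ?_, ?_, ?_⟩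
  · intro n hn
    have hmono : MonotoneOn (φ n) (Icc 0 1) := by
      refine monotoneOn_of_deriv_nonneg (convex_Icc _ _) (h1 n hn).continuous.continuousOn
        ((h1 n hn).differentiable (by simp)).differentiableOn fun t ht => ?_
      rw [interior_Icc] at ht
      have := (conn_slope_bounds hlam hr hn).1
      exact le_trans (by positivity) (h4 n hn t (Ioo_subset_Icc_self ht)).1
    intro t ht
    constructor
    · rw [← v0 n hn]; exact hmono m0 ht ht.1
    · rw [← v1 n hn]; exact hmono ht m1 ht.2
  · intro n hn
    rw [hit1 n hn 1 m1, ← iteratedDeriv_one, ho n hn 1]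
    simp
  · intro n hn k hk
    rw [hit n hn k 0 m0, hz n hn k, if_neg (by omega), if_neg (by omega)]
  · intro n hn k hk
    rw [hit n hn k 1 m1, ho n hn k, if_neg (by omega), if_neg (by omega)]
  · intro k hk
    refine ⟨Bd k, fun n hn t ht => ?_⟩
    rw [hit n hn k t ht]
    exact h5 n hn k hk t ⟨by linarith [ht.1], by linarith [ht.2]⟩
  · intro n hn t ht
    rw [d0 n hn, hit1 n hn t ht]
    exact (h4 n hn t ht).1
  · intro n hn t ht
    rw [hit1 n hn t ht]
    exact (h4 n hn t ht).2

end Families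

/-! ### Existence of the map -/

section Existence

variable {lam : ℝ} {r : ℕ}

/-- The slope of the formula on the left of `1` stays below `λ^r` slightly beyond its zone. -/
theorem two_mul_mul_pow_le (hlam : 14 ≤ lam) {ρ : ℝ} (h1 : 1 ≤ ρ) (h2 : ρ ≤ 101 / 100)
    (hr : 1 ≤ r) : 2 * r * ρ ^ (2 * r - 1) ≤ lam ^ r := by
  have a1 : (2 : ℝ) ≤ 2 ^ r := le_self_pow₀ (by norm_num) (by omega)
  have a2 : (r : ℝ) ≤ 2 ^ r := by exact_mod_cast Nat.lt_two_pow_self.le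
  have a3 : ρ ^ (2 * r - 1) ≤ (5 / 4) ^ r :=
    calc ρ ^ (2 * r - 1) ≤ ρ ^ (2 * r) := pow_le_pow_right₀ h1 (by omega)
      _ = (ρ ^ 2) ^ r := pow_mul ρ 2 r
      _ ≤ (5 / 4) ^ r := pow_le_pow_left₀ (by positivity) (by nlinarith) r
  calc 2 * r * ρ ^ (2 * r - 1) ≤ 2 ^ r * 2 ^ r * (5 / 4) ^ r := by gcongr
    _ = 5 ^ r := by rw [← mul_pow, ← mul_pow]; norm_num
    _ ≤ lam ^ r := pow_le_pow_left₀ (by norm_num) (by linarith) r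

theorem exists_join_left (hlam : 14 ≤ lam) (hr : 1 ≤ r) : ∃ G : ℝ → ℝ, ContDiff ℝ ∞ G ∧
    (∀ t ≤ 5 / 2 * delta lam r, G t = pieceZero lam r t) ∧
    (∀ t, 1 / 2 - delta lam r ≤ t → G t = pieceHalf lam r t) ∧
    ∀ t ∈ Icc (5 / 2 * delta lam r) (1 / 2 - delta lam r), deriv G t ∈ Icc (3 / 2) (lam ^ r) := by
  have hd := delta_pos (r := r) hlam
  have hd' := delta_le hlam hr
  have hL := pow_ge hlam hr
  have hdL := delta_mul_pow (r := r) hlam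
  have hdd : (delta lam r)⁻¹ * delta lam r ^ 2 = delta lam r := by field_simp
  have hH : pieceHalf lam r (1 / 2 - delta lam r) - pieceZero lam r (5 / 2 * delta lam r) =
      3 / 2 - 3 / 2 * delta lam r := by
    unfold pieceHalf pieceZero
    linear_combination (-3 / 2) * hdd - 5 / 2 * hdL
  refine exists_smoothJoin contDiff_pieceZero contDiff_pieceHalf (ε := delta lam r / 100)
    (by positivity) (by linarith) (by norm_num) (fun t _ => ?_) (fun t ht => ?_) ?_ ?_
  · rw [deriv_pieceZero]
    exact ⟨by linarith, le_rfl⟩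
  · rw [deriv_pieceHalf]
    have e1 := mul_le_mul_of_nonneg_left (by linarith [ht.2] : delta lam r ≤ 1 / 2 - t)
      (by positivity : 0 ≤ 3 * lam ^ r)
    have e2 := mul_le_mul_of_nonneg_left
      (by linarith [ht.1] : 1 / 2 - t ≤ delta lam r + delta lam r / 100)
      (by positivity : 0 ≤ 3 * lam ^ r)
    constructor <;> linarith
  · rw [hH]
    linarith
  · rw [hH]
    linarith

theorem exists_join_mid (hlam : 14 ≤ lam) (hr : 1 ≤ r) : ∃ G : ℝ → ℝ, ContDiff ℝ ∞ G ∧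
    (∀ t ≤ 1 / 2 + delta lam r, G t = pieceHalf lam r t) ∧
    (∀ t, 1 - delta lam r ≤ t → G t = pieceOne lam r t) ∧
    ∀ t ∈ Icc (1 / 2 + delta lam r) (1 - delta lam r),
      deriv G t ∈ Icc (-lam ^ r) (-(3 / 2)) := by
  have hd := delta_pos (r := r) hlam
  have hd' := delta_le hlam hr
  have hL := pow_ge hlam hr
  have hdL := delta_mul_pow (r := r) hlam
  have hr' : (1 : ℝ) ≤ r := by exact_mod_cast hr
  have hdd : (delta lam r)⁻¹ * delta lam r ^ 2 = delta lam r := by field_simp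
  have hH : -pieceOne lam r (1 - delta lam r) - -pieceHalf lam r (1 / 2 + delta lam r) =
      4 - 5 / 2 * delta lam r := by
    rw [pieceOne_eq hlam, sub_sub_cancel, div_self hd.ne', one_pow]
    unfold pieceHalf
    linear_combination (-3 / 2) * hdd
  have hP : ∀ t ∈ Icc (1 / 2 + delta lam r) (1 / 2 + delta lam r + delta lam r / 100),
      deriv (fun t => -pieceHalf lam r t) t ∈ Icc (3 / 2) (lam ^ r) := by
    intro t ht
    have e : deriv (fun t => -pieceHalf lam r t) t = -deriv (pieceHalf lam r) t := deriv.fun_neg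
    rw [e, deriv_pieceHalf]
    have e1 := mul_le_mul_of_nonneg_left (by linarith [ht.1] : delta lam r ≤ t - 1 / 2)
      (by positivity : 0 ≤ 3 * lam ^ r)
    have e2 := mul_le_mul_of_nonneg_left
      (by linarith [ht.2] : t - 1 / 2 ≤ delta lam r + delta lam r / 100)
      (by positivity : 0 ≤ 3 * lam ^ r)
    constructor <;> linarith
  have hQ : ∀ t ∈ Icc (1 - delta lam r - delta lam r / 100) (1 - delta lam r),
      deriv (fun t => -pieceOne lam r t) t ∈ Icc (3 / 2) (lam ^ r) := by
    intro t ht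
    have e : deriv (fun t => -pieceOne lam r t) t = -deriv (pieceOne lam r) t := deriv.fun_neg
    rw [e, deriv_pieceOne_eq hlam, neg_neg]
    have h1 : 1 ≤ (1 - t) / delta lam r := by
      rw [le_div_iff₀ hd]; linarith [ht.2]
    have h2 : (1 - t) / delta lam r ≤ 101 / 100 := by
      rw [div_le_iff₀ hd]; linarith [ht.1]
    refine ⟨?_, two_mul_mul_pow_le hlam h1 h2 hr⟩
    have := one_le_pow₀ h1 (n := 2 * r - 1)
    nlinarith
  obtain ⟨G, g1, g2, g3, g4⟩ := exists_smoothJoin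
    (p := fun t => -pieceHalf lam r t) (q := fun t => -pieceOne lam r t) (m := 3 / 2)
    (M := lam ^ r) (a := 1 / 2 + delta lam r) (b := 1 - delta lam r)
    contDiff_pieceHalf.neg contDiff_pieceOne.neg (ε := delta lam r / 100)
    (by positivity) (by linarith) (by norm_num) hP hQ
    (by rw [hH]; linarith) (by rw [hH]; linarith)
  refine ⟨fun t => -G t, g1.neg, fun t ht => ?_, fun t ht => ?_, fun t ht => ?_⟩
  · simp only [g2 t ht, neg_neg]
  · simp only [g3 t ht, neg_neg]
  · have e : deriv (fun t => -G t) t = -deriv G t := deriv.fun_neg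
    rw [e]
    exact ⟨neg_le_neg (g4 t ht).2, neg_le_neg (g4 t ht).1⟩

theorem exists_join_right (hlam : 14 ≤ lam) (hr : 1 ≤ r) : ∃ G : ℝ → ℝ, ContDiff ℝ ∞ G ∧
    (∀ t ≤ yPt 1, G t = pieceY lam r 1 t) ∧
    (∀ t, 4 - 3 / 2 * delta lam r ≤ t → G t = pieceFour lam r t) ∧
    ∀ t ∈ Icc (yPt 1) (4 - 3 / 2 * delta lam r), deriv G t ∈ Icc (3 / 2) (lam ^ r) := by
  have hd := delta_pos (r := r) hlam
  have hd' := delta_le hlam hr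
  have hL := pow_ge hlam hr
  have hdL := delta_mul_pow (r := r) hlam
  have hM := osc_mul_slope (r := r) hlam (n := 1) le_rfl
  have hH : pieceFour lam r (4 - 3 / 2 * delta lam r) - pieceY lam r 1 (yPt 1) =
      5 / 2 - 5 / 2 * delta lam r := by
    unfold pieceFour pieceY
    rw [yPt_one]
    linear_combination (-3 / 2) * hdL
  have hy := yPt_one
  refine exists_smoothJoin contDiff_pieceY contDiff_pieceFour (ε := delta lam r / 100)
    (by positivity) (by linarith) (by norm_num) (fun t _ => ?_) (fun t _ => ?_) ?_ ?_
  · have e : pieceY lam r 1 = fun t => delta lam r ^ 1 * yPt 1 +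
      delta lam r ^ 1 * (osc lam 1 : ℝ) * slope lam r 1 * (t - yPt 1) := rfl
    have : deriv (pieceY lam r 1) t = 2 := by
      rw [e]
      simp only [deriv_const_add, deriv_const_mul_field, deriv_sub_const, deriv_id'']
      linear_combination delta lam r * hM + 2 * hdL
    rw [this]
    constructor <;> linarith
  · rw [deriv_pieceFour]
    exact ⟨by linarith, le_rfl⟩
  · rw [hH, hy]
    linarith
  · rw [hH, hy]
    linarith

/-- Functions that agree on half-lines have the same jets at the end points. -/
theorem isSmoothJoin_of_eqOn {p q f G : ℝ → ℝ} {a b : ℝ} (hab : a < b) (hp : ContDiff ℝ ∞ p)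
    (hq : ContDiff ℝ ∞ q) (hG : ContDiff ℝ ∞ G) (hGp : ∀ t ≤ a, G t = p t)
    (hGq : ∀ t, b ≤ t → G t = q t) (h : EqOn f G (Icc a b)) : IsSmoothJoin p q a b f where
  smooth := hG.contDiffOn.congr h
  left k := by
    rw [iteratedDerivWithin_Icc_eq_of_eqOn hab hG h k (left_mem_Icc.2 hab.le)]
    exact iteratedDeriv_eq_of_eqOn_Iic hG hp hGp le_rfl k
  right k := by
    rw [iteratedDerivWithin_Icc_eq_of_eqOn hab hG h k (right_mem_Icc.2 hab.le)]
    exact iteratedDeriv_eq_of_eqOn_Ici hG hq hGq le_rfl k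

theorem derivWithin_Icc_eq_of_eqOn {f G : ℝ → ℝ} {a b t : ℝ} (hab : a < b) (hG : ContDiff ℝ ∞ G)
    (h : EqOn f G (Icc a b)) (ht : t ∈ Icc a b) : derivWithin f (Icc a b) t = deriv G t := by
  simpa only [iteratedDerivWithin_one, iteratedDeriv_one] using
    iteratedDerivWithin_Icc_eq_of_eqOn hab hG h 1 ht

/-- The formulas of the map on `[y_{n+1}, y_n]`. -/
noncomputable def middlePiece (lam : ℝ) (r : ℕ) (s φ : ℕ → ℝ → ℝ) (n : ℕ) (t : ℝ) : ℝ :=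
  if t ≤ wPt lam r n then pieceY lam r (n + 1) t
  else if t ≤ xPt n then
    delta lam r ^ (n + 1) * xPt n + height lam r n * φ n ((t - wPt lam r n) / len lam r n)
  else delta lam r ^ n *
    (xPt n + (yPt n - xPt n) * s n ((osc lam n : ℝ) * ((t - xPt n) / (yPt n - xPt n))))

/-- The index `n` with `t ∈ [y_{n+1}, y_n[`; it is meaningful for `1 < t < y_1`. -/
noncomputable def pieceIndex (t : ℝ) : ℕ := sInf {n : ℕ | 1 ≤ n ∧ yPt (n + 1) ≤ t}

theorem pieceIndex_eq {n : ℕ} (hn : 1 ≤ n) {t : ℝ} (h1 : yPt (n + 1) ≤ t) (h2 : t < yPt n) :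
    pieceIndex t = n := by
  refine le_antisymm (Nat.sInf_le ⟨hn, h1⟩) (le_csInf ⟨n, hn, h1⟩ fun m hm => ?_)
  by_contra hlt
  have := yPt_anti (m := m + 1) (n := n) (by omega) (by omega)
  linarith [hm.2]

/-- The functions joined across a gap agree with the formulas on both sides of it, so the map is
given by three of them and the formulas on `]1, y_1[`. -/
theorem exists_isConstructedMap (hlam : 14 ≤ lam) (hr : 1 ≤ r) :
    ∃ (s φ : ℕ → ℝ → ℝ) (f : ℝ → ℝ), IsConstructedMap lam r s φ f := by
  obtain ⟨s, hs⟩ := exists_isOscFamily hlam hr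
  obtain ⟨φ, hφ⟩ := exists_isConnFamily hlam hr
  obtain ⟨gL, l1, l2, l3, l4⟩ := exists_join_left hlam hr
  obtain ⟨gM, m1, m2, m3, m4⟩ := exists_join_mid hlam hr
  obtain ⟨gR, r1, r2, r3, r4⟩ := exists_join_right hlam hr
  have hd := delta_pos (r := r) hlam
  obtain ⟨j1, j2, j3, j4, j5, j6, j7⟩ := joints_lt hlam hr
  have hy1 := yPt_one
  let f : ℝ → ℝ := fun t => if t ≤ 1 / 2 then gL t else if t ≤ 1 then gM t
    else if t < yPt 1 then middlePiece lam r s φ (pieceIndex t) t else gR t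
  have fL : ∀ t ≤ 1 / 2, f t = gL t := fun t h => if_pos h
  have fM : ∀ t, 1 / 2 < t → t ≤ 1 → f t = gM t := fun t h h' => by
    simp only [f, if_neg (not_le.2 h), if_pos h']
  have fR : ∀ t, yPt 1 ≤ t → f t = gR t := fun t h => by
    simp only [f, if_neg (not_lt.2 h), if_neg (by linarith : ¬ t ≤ 1 / 2),
      if_neg (by linarith : ¬ t ≤ 1)]
  have fI : ∀ n, 1 ≤ n → ∀ t, yPt (n + 1) ≤ t → t < yPt n → f t = middlePiece lam r s φ n t := by
    intro n hn t h1 h2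
    have h3 := yPt_gt (n := n + 1) (by omega)
    have h4 := yPt_anti le_rfl hn
    simp only [f, if_neg (by linarith : ¬ t ≤ 1 / 2), if_neg (by linarith : ¬ t ≤ 1),
      if_pos (by linarith : t < yPt 1), pieceIndex_eq hn h1 h2]
  -- the value at `y_n` is prescribed by the piece on its right
  have fY : ∀ n, 1 ≤ n → f (yPt n) = delta lam r ^ n * yPt n := by
    intro n hn
    rcases Nat.lt_or_ge 1 n with h | h
    · obtain ⟨m, rfl⟩ : ∃ m, n = m + 1 := ⟨n - 1, by omega⟩
      have hm : 1 ≤ m := by omega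
      rw [fI m hm _ le_rfl ((yPt_succ_lt_xPt hm).trans (xPt_lt_yPt hm)), middlePiece,
        if_pos (yPt_lt_wPt hlam hm).le, pieceY, sub_self, mul_zero, add_zero]
    · obtain rfl := le_antisymm h hn
      rw [fR _ le_rfl, r2 _ le_rfl, pieceY, sub_self, mul_zero, add_zero]
  have eL : EqOn f gL (Icc (5 / 2 * delta lam r) (1 / 2 - delta lam r)) := fun t ht =>
    fL t (by linarith [ht.2])
  have eM : EqOn f gM (Icc (1 / 2 + delta lam r) (1 - delta lam r)) := fun t ht =>
    fM t (by linarith [ht.1]) (by linarith [ht.2])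
  have eR : EqOn f gR (Icc (yPt 1) (4 - 3 / 2 * delta lam r)) := fun t ht => fR t ht.1
  have jL : 5 / 2 * delta lam r < 1 / 2 - delta lam r := j2
  refine ⟨s, φ, f, hs, hφ, ?_, ?_, ?_, ?_, ?_, ?_, ?_, ?_, ?_, ?_, ?_, ?_, ?_⟩
  · intro t ht
    rw [fL t (by linarith [ht.2]), l2 t ht.2]
  · intro t ht
    rcases le_or_gt t (1 / 2) with h | h
    · rw [fL t h, l3 t ht.1]
    · rw [fM t h (by linarith [ht.2]), m2 t ht.2]
  · intro t ht
    rw [fM t (by linarith [ht.1]) ht.2, m3 t ht.1]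
  · intro n hn t ht
    have hw := wPt_lt_xPt hlam hr hn
    have hxy := xPt_lt_yPt hn
    have hyx := yPt_succ_lt_xPt hn
    rcases eq_or_lt_of_le ht.2 with rfl | h
    · rw [fY n hn, div_self (by linarith), mul_one, hs.map_end n hn]
      ring
    · rw [fI n hn t (by linarith [ht.1]) h, middlePiece, if_neg (by linarith [ht.1])]
      rcases eq_or_lt_of_le ht.1 with rfl | h'
      · rw [if_pos le_rfl, sub_self, zero_div, mul_zero, hs.map_zero n hn]
        have hl := len_pos hlam hr hn
        have : (xPt n - wPt lam r n) / len lam r n = 1 := div_self hl.ne'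
        rw [this, hφ.map_one n hn, height]
        ring
      · rw [if_neg (not_le.2 h')]
  · intro n hn t ht
    have hw := wPt_lt_xPt hlam hr hn
    have hxy := xPt_lt_yPt hn
    rw [fI n hn t ht.1 (by linarith [ht.2]), middlePiece, if_pos ht.2]
  · intro n hn t ht
    have hw := yPt_lt_wPt (r := r) hlam hn
    have hxy := xPt_lt_yPt hn
    rw [fI n hn t (by linarith [ht.1]) (by linarith [ht.2]), middlePiece]
    rcases eq_or_lt_of_le ht.1 with rfl | h'
    · rw [if_pos le_rfl, pieceY_wPt hlam hn, sub_self, zero_div, hφ.map_zero n hn]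
      ring
    · rw [if_neg (not_le.2 h'), if_pos ht.2]
  · intro t ht
    rw [fR t (by linarith [ht.1]), r3 t ht.1]
  · exact isSmoothJoin_of_eqOn j2 contDiff_pieceZero contDiff_pieceHalf l1 l2 l3 eL
  · exact isSmoothJoin_of_eqOn j4 contDiff_pieceHalf contDiff_pieceOne m1 m2 m3 eM
  · exact isSmoothJoin_of_eqOn j6 contDiff_pieceY contDiff_pieceFour r1 r2 r3 eR
  · intro t ht
    rw [derivWithin_Icc_eq_of_eqOn j2 l1 eL ht]
    exact l4 t ht
  · intro t ht
    rw [derivWithin_Icc_eq_of_eqOn j4 m1 eM ht]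
    exact m4 t ht
  · intro t ht
    rw [derivWithin_Icc_eq_of_eqOn j6 r1 eR ht]
    exact r4 t ht

end Existence

end MixingInterval

theorem proposition1p13 (lam : ℝ) (hlam : 14 ≤ lam) (r : ℕ) (hr : 1 ≤ r) :
    (∃ (s φ : ℕ → ℝ → ℝ) (f : ℝ → ℝ), MixingInterval.IsConstructedMap lam r s φ f) ∧
    ∀ (s φ : ℕ → ℝ → ℝ) (f : ℝ → ℝ), MixingInterval.IsConstructedMap lam r s φ f →
      ContDiffOn ℝ r f (Icc 0 4) ∧
      ContDiffOn ℝ ∞ f (Icc 0 4 \ {1}) ∧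
      IsLUB ((fun t => |derivWithin f (Icc 0 4) t|) '' Icc 0 4) (lam ^ r) ∧
      (∃ h : MapsTo f (Icc 0 4) (Icc 0 4),
        MixingInterval.IsTopMixing (h.restrict f (Icc 0 4) (Icc 0 4))) ∧
      ∀ J : Set ℝ, J ⊆ Icc 0 4 → J.OrdConnected → J.Nontrivial →
        ∃ k : ℕ, f^[k] '' J = Icc 0 4 := by
  refine ⟨MixingInterval.exists_isConstructedMap hlam hr, fun s φ f hf => ?_⟩
  have hcov : ∀ J : Set ℝ, J ⊆ Icc 0 4 → J.OrdConnected → J.Nontrivial →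
      ∃ k : ℕ, f^[k] '' J = Icc 0 4 := fun J h1 h2 h3 => hf.exists_image_eq hlam hr h1 h2 h3
  exact ⟨hf.contDiffOn hlam hr, hf.contDiffOn_diff hlam hr, hf.isLUB_derivWithin hlam hr,
    ⟨hf.mapsTo hlam hr, MixingInterval.isTopMixing_of_exists_image_eq (by norm_num) _ hcov⟩, hcov⟩
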